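/- Let $p$ be a prime and let $N$ be the group of $\mathbb{Q}_p$-points of a unipotent algebraic group defined over $\mathbb{Q}_p$ (for instance over $\mathbb{Q}$), with its $p$-adic topology; that is, $N$ is, up to isomorphism, a Zariski closed subgroup of the group of upper triangular unipotent matrices in $\mathrm{GL}_n(\mathbb{Q}_p)$ for some $n$. Let $\widehat N$ be the unitary dual of $N$, the set of unitary equivalence classes of irreducible (strongly continuous) unitary representations of $N$. The Fell topology on $\widehat N$ is generated by the sets $\mathcal U(\pi,\Omega,\varepsilon;v_1,\dots,v_k;w_1,\dots,w_k)$, where $(\pi,\mathcal H)$ is an irreducible unitary representation, $\Omega\subseteq N$ is compact, $\varepsilon>0$, $k\in\mathbb N$ and $v_i,w_i\in\mathcal H$; this set consists of all $(\sigma,\mathcal K)\in\widehat N$ for which there are $v_i',w_i'\in\mathcal K$ $(1\le i\le k)$ with $$|\langle\pi(g)v_i,w_j\rangle-\langle\sigma(g)v_i',w_j'\rangle|<\varepsilon\quad\text{for all } g\in\Omega,\ 1\le i,j\le k.$$ A complex representation $(\sigma,V)$ of $N$ is smooth if every vector of $V$ is fixed by some compact open subgroup. The smooth dual $\widehat N_{\rm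 sm}$ of $N$ is the set of equivalence classes of (algebraically) irreducible smooth representations. The Gelfand–Kazhdan topology on $\widehat N_{\rm sm}$ is generated by the sets $\mathcal U(\pi,\Omega,\varepsilon;v_1,\dots,v_k;\lambda_1,\dots,\lambda_k)$, where $(\pi,V)$ is an irreducible smooth representation, $\Omega\subseteq N$ is compact, $\varepsilon>0$, $k\in\mathbb N$, $v_i\in V$ and $\lambda_i$ lies in the algebraic dual $V^*$; this set consists of all $(\sigma,W)\in\widehat N_{\rm sm}$ for which there are $v_i'\in W$, $\lambda_i'\in W^*$ $(1\le i\le k)$ with $$|\lambda_i(\pi(g)v_j)-\lambda_i'(\sigma(g)v_j')|<\varepsilon\quad\text{for all } g\in\Omega,\ 1\le i,j\le k.$$ Then the assignment sending an irreducible smooth representation $(\sigma,V)$ to the unitary representation of $N$ on the Hilbert space completion of $V$ with respect to an $N$-invariant positive definite Hermitian form is a well-defined bijection from $\widehat N_{\rm sm}$ onto $\widehat N$, and when $\widehat N_{\rm sm}$ is identified with $\widehat N$ through this bijection, the Gelfand–Kazhdan topology and the Fell topology on $\widehat N$ are identical. -/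

import Mathlib

/-! ### Unipotent `p`-adic groups -/

/-- `N` is the group of `ℚ_p`-points of a unipotent algebraic group over `ℚ_p`, realised as a
Zariski closed subgroup of the group of upper triangular unipotent matrices.  It carries the
`p`-adic topology, i.e. the subspace topology of `GL n ℚ_p`. -/
structure IsUnipotentAlgebraic {p : ℕ} [Fact p.Prime] {n : ℕ}
    (N : Subgroup (GL (Fin n) ℚ_[p])) : Prop where
  unitriangular : ∀ g ∈ N, ∀ i j : Fin n, j ≤ i →
    (g : Matrix (Fin n) (Fin n) ℚ_[p]) i j = if i = j then 1 else 0
  zariskiClosed : ∃ S : Set (MvPolynomial (Fin n × Fin n) ℚ_[p]),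
    ∀ g : GL (Fin n) ℚ_[p], g ∈ N ↔
      ∀ f ∈ S, MvPolynomial.eval
        (fun ij : Fin n × Fin n => (g : Matrix (Fin n) (Fin n) ℚ_[p]) ij.1 ij.2) f = 0

/-! ### Unitary representations, the unitary dual and the Fell topology -/

/-- An irreducible unitary representation: a strongly continuous homomorphism to the unitary
group of a nonzero complex Hilbert space having no nontrivial closed invariant subspace. -/
structure UnitaryIrrep (N : Type) [Group N] [TopologicalSpace N] where
  /-- the underlying Hilbert space -/
  H : Type
  [instNormed : NormedAddCommGroup H]
  [instInner : InnerProductSpace ℂ H]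
  [instComplete : CompleteSpace H]
  /-- the action by unitary operators -/
  act : N →* (H ≃ₗᵢ[ℂ] H)
  continuous_act : ∀ v : H, Continuous fun g : N => act g v
  nontrivial : Nontrivial H
  irreducible : ∀ W : Submodule ℂ H, IsClosed (W : Set H) →
    (∀ (g : N), ∀ v ∈ W, act g v ∈ W) → W = ⊥ ∨ W = ⊤

attribute [instance] UnitaryIrrep.instNormed UnitaryIrrep.instInner UnitaryIrrep.instComplete

/-- Unitary equivalence. -/
def UnitaryIrrep.Equivalent {N : Type} [Group N] [TopologicalSpace N]
    (π ρ : UnitaryIrrep N) : Prop :=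
  ∃ T : π.H ≃ₗᵢ[ℂ] ρ.H, ∀ (g : N) (v : π.H), T (π.act g v) = ρ.act g (T v)

instance UnitaryIrrep.setoid (N : Type) [Group N] [TopologicalSpace N] :
    Setoid (UnitaryIrrep N) where
  r := UnitaryIrrep.Equivalent
  iseqv :=
    { refl := fun π => ⟨LinearIsometryEquiv.refl ℂ π.H, fun _ _ => rfl⟩
      symm := fun {π ρ} h => by
        obtain ⟨T, hT⟩ := h
        refine ⟨T.symm, fun g v => T.injective ?_⟩
        rw [hT]
        simp
      trans := fun {π ρ τ} h₁ h₂ => by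
        obtain ⟨T, hT⟩ := h₁
        obtain ⟨S, hS⟩ := h₂
        refine ⟨T.trans S, fun g v => ?_⟩
        simp [hT, hS] }

/-- The unitary dual of `N`. -/
abbrev UnitaryDual (N : Type) [Group N] [TopologicalSpace N] : Type 1 :=
  Quotient (UnitaryIrrep.setoid N)

/-- The basic set `𝒰(π, Ω, ε; v₁,…,v_k; w₁,…,w_k)` of the unitary dual.  The matrix coefficient
`⟨π(g)v, w⟩`, linear in `v`, is `inner ℂ w (π.act g v)` in Mathlib's convention. -/
def fellBasicSet {N : Type} [Group N] [TopologicalSpace N] (π : UnitaryIrrep N)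
    (Ω : Set N) (ε : ℝ) {k : ℕ} (v w : Fin k → π.H) : Set (UnitaryDual N) :=
  {x | ∃ σ : UnitaryIrrep N, (⟦σ⟧ : UnitaryDual N) = x ∧ ∃ v' w' : Fin k → σ.H,
    ∀ g ∈ Ω, ∀ i j : Fin k,
      ‖inner ℂ (w j) (π.act g (v i)) - inner ℂ (w' j) (σ.act g (v' i))‖ < ε}

/-- The Fell topology on the unitary dual. -/
@[reducible] def fellTopology (N : Type) [Group N] [TopologicalSpace N] :
    TopologicalSpace (UnitaryDual N) :=
  TopologicalSpace.generateFrom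
    {U | ∃ (π : UnitaryIrrep N) (Ω : Set N) (ε : ℝ) (k : ℕ) (v w : Fin k → π.H),
      IsCompact Ω ∧ 0 < ε ∧ U = fellBasicSet π Ω ε v w}

/-! ### Smooth representations, the smooth dual and the Gelfand–Kazhdan topology -/

/-- An (algebraically) irreducible smooth complex representation: every vector is fixed by some
compact open subgroup. -/
structure SmoothIrrep (N : Type) [Group N] [TopologicalSpace N] where
  /-- the underlying vector space -/
  V : Type
  [instAddCommGroup : AddCommGroup V]
  [instModule : Module ℂ V]
  /-- the action -/
  act : Representation ℂ N V
  smooth : ∀ v : V, ∃ K : Subgroup N,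
    IsOpen (K : Set N) ∧ IsCompact (K : Set N) ∧ ∀ g ∈ K, act g v = v
  irreducible : act.IsIrreducible

attribute [instance] SmoothIrrep.instAddCommGroup SmoothIrrep.instModule

instance SmoothIrrep.setoid (N : Type) [Group N] [TopologicalSpace N] :
    Setoid (SmoothIrrep N) where
  r := fun σ τ => Nonempty (σ.act.Equiv τ.act)
  iseqv :=
    { refl := fun σ => ⟨Representation.Equiv.refl σ.act⟩
      symm := fun ⟨e⟩ => ⟨e.symm⟩
      trans := fun ⟨e⟩ ⟨f⟩ => ⟨e.trans f⟩ }

/-- The smooth dual of `N`. -/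
abbrev SmoothDual (N : Type) [Group N] [TopologicalSpace N] : Type 1 :=
  Quotient (SmoothIrrep.setoid N)

/-- The basic set `𝒰(π, Ω, ε; v₁,…,v_k; l₁,…,l_k)` of the smooth dual; the `l i` are arbitrary
functionals in the algebraic dual. -/
def gelfandKazhdanBasicSet {N : Type} [Group N] [TopologicalSpace N] (π : SmoothIrrep N)
    (Ω : Set N) (ε : ℝ) {k : ℕ} (v : Fin k → π.V) (l : Fin k → Module.Dual ℂ π.V) :
    Set (SmoothDual N) :=
  {x | ∃ σ : SmoothIrrep N, (⟦σ⟧ : SmoothDual N) = x ∧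
    ∃ (v' : Fin k → σ.V) (l' : Fin k → Module.Dual ℂ σ.V),
      ∀ g ∈ Ω, ∀ i j : Fin k, ‖l i (π.act g (v j)) - l' i (σ.act g (v' j))‖ < ε}

/-- The Gelfand–Kazhdan topology on the smooth dual. -/
@[reducible] def gelfandKazhdanTopology (N : Type) [Group N] [TopologicalSpace N] :
    TopologicalSpace (SmoothDual N) :=
  TopologicalSpace.generateFrom
    {U | ∃ (π : SmoothIrrep N) (Ω : Set N) (ε : ℝ) (k : ℕ) (v : Fin k → π.V)
      (l : Fin k → Module.Dual ℂ π.V),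
      IsCompact Ω ∧ 0 < ε ∧ U = gelfandKazhdanBasicSet π Ω ε v l}

/-! ### The correspondence between the two duals -/

/-- `π` is (up to equivalence) the completion of `σ` with respect to some `N`-invariant positive
definite Hermitian form: there is an equivariant linear embedding `ι` of `σ` onto a dense subspace
of `π`.  The form on `σ` is `⟨ι v, ι w⟩`, and the Hilbert space of `π` is its completion. -/
def IsUnitaryCompletion {N : Type} [Group N] [TopologicalSpace N]
    (σ : SmoothIrrep N) (π : UnitaryIrrep N) : Prop :=
  ∃ ι : σ.V →ₗ[ℂ] π.H, Function.Injective ι ∧ DenseRange ι ∧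
    ∀ (g : N) (v : σ.V), ι (σ.act g v) = π.act g (ι v)

set_option linter.unusedSectionVars false

/-! ### Smooth characters of `ℚ_p` -/

section PadicCharacters

open Filter Topology

variable {p : ℕ} [Fact p.Prime]

/-! Only two properties of `N` matter in the end. It is locally elliptic: an increasing union of
compact open subgroups `K m`, with arbitrarily small compact open subgroups
(`IsUnipotentAlgebraic.isLocallyElliptic`). And its irreducible smooth representations are
admissible (`IsPowClosed.isAdmissible`).

Admissibility is an induction on dimension in the spirit of Kirillov. Unless the group acts by
scalars, it contains one-parameter subgroups `x`, `y` whose commutators act by a nontrivial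
character, while every commutator with `y` is scalar. The coinvariants of `y` form an irreducible
representation of a smaller group, the kernel of the pairing with `y`. The `x`-translates of these
coinvariants separate vectors, and finitely many of them suffice for vectors fixed by a given open
subgroup.

An irreducible smooth representation has an invariant inner product, obtained as an ultralimit of `K
m`-invariant forms. By admissibility the fixed vectors of compact open subgroups in the completion
already lie in the smooth representation. So the completion is irreducible, the smooth
representation is recovered as its space of smooth vectors, and Schur's lemma on a
finite-dimensional fixed space makes the form unique up to scale.

Surjectivity is the harder direction. A simple vector `v` for `K m` spans a simple `K m`-module, and
`subordinate` is the multiplicity space of that module. If the multiplicities could grow forever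
along a chain of types for larger and larger `K m`, the direct limit would be an irreducible smooth
representation that is not admissible (`not_exists_growing_simpleVectors`). So some type occurs at
most once in every larger type below it. In an irreducible unitary representation this forces its
multiplicity space to be a line (`subordinate_le_span`), and a vector on that line generates a dense
irreducible smooth subrepresentation.

For the topologies, a smooth vector has a finite orbit under a compact set, so there every algebraic
functional is an inner product with some vector. Conversely, vectors of a unitary representation are
approximated by smooth ones, uniformly in the group element. -/

theorem Padic.exists_natCast_norm_sub_le (z : ℚ_[p]) (hz : ‖z‖ ≤ 1) {ε : ℝ} (hε : 0 < ε) :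
    ∃ j : ℕ, ‖z - j‖ < ε := by
  let w : ℤ_[p] := ⟨z, hz⟩
  obtain ⟨j, hj⟩ := (PadicInt.denseRange_natCast (p := p)).exists_dist_lt w hε
  refine ⟨j, ?_⟩
  rw [dist_eq_norm, PadicInt.norm_def, PadicInt.coe_sub, PadicInt.coe_natCast] at hj
  exact hj

theorem Padic.prime_cast_ne_zero : (p : ℚ_[p]) ≠ 0 :=
  Nat.cast_ne_zero.mpr (Fact.out : p.Prime).ne_zero

theorem Padic.one_lt_prime_cast : (1 : ℝ) < p := by
  exact_mod_cast (Fact.out : p.Prime).one_lt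

/-- Every `p`-adic number is approximated by natural multiples of `p ^ (-r)`. -/
theorem Padic.exists_natCast_mul_norm_sub_lt (t : ℚ_[p]) (r : ℤ) (hr : ‖t‖ ≤ (p : ℝ) ^ r) {ε : ℝ}
    (hε : 0 < ε) : ∃ j : ℕ, ‖t - j * (p : ℚ_[p]) ^ (-r)‖ < ε := by
  have hp : (0 : ℝ) < p := zero_lt_one.trans Padic.one_lt_prime_cast
  have hr' : (0 : ℝ) < (p : ℝ) ^ r := zpow_pos hp r
  have hz : ‖t * (p : ℚ_[p]) ^ r‖ ≤ 1 := by
    rw [norm_mul, Padic.norm_p_zpow, zpow_neg]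
    rw [← div_eq_mul_inv]
    exact (div_le_one hr').mpr hr
  obtain ⟨j, hj⟩ := Padic.exists_natCast_norm_sub_le _ hz (div_pos hε hr')
  refine ⟨j, ?_⟩
  have : t - j * (p : ℚ_[p]) ^ (-r) = (t * (p : ℚ_[p]) ^ r - j) * (p : ℚ_[p]) ^ (-r) := by
    rw [sub_mul, mul_assoc, ← zpow_add₀ Padic.prime_cast_ne_zero]
    simp
  rw [this, norm_mul, Padic.norm_p_zpow, neg_neg]
  exact (lt_div_iff₀ hr').mp hj

theorem Padic.exists_norm_le_zpow (t : ℚ_[p]) : ∃ r : ℕ, ‖t‖ ≤ (p : ℝ) ^ (r : ℤ) := by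
  obtain ⟨r, hr⟩ := pow_unbounded_of_one_lt ‖t‖ (Padic.one_lt_prime_cast (p := p))
  exact ⟨r, by simpa using hr.le⟩

theorem Padic.eventually_nhds_zero_iff {P : ℚ_[p] → Prop} :
    (∀ᶠ t in 𝓝 (0 : ℚ_[p]), P t) ↔ ∃ M : ℕ, ∀ t : ℚ_[p], ‖t‖ ≤ (p : ℝ) ^ (-(M : ℤ)) → P t := by
  have hp : (0 : ℝ) < p := zero_lt_one.trans Padic.one_lt_prime_cast
  rw [Metric.eventually_nhds_iff]
  constructor
  · rintro ⟨ε, hε, h⟩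
    obtain ⟨M, hM⟩ := exists_pow_lt_of_lt_one hε
      (inv_lt_one_of_one_lt₀ (Padic.one_lt_prime_cast (p := p)))
    refine ⟨M, fun t ht => h ?_⟩
    rw [dist_zero_right]
    refine ht.trans_lt ?_
    simpa [zpow_neg, inv_pow] using hM
  · rintro ⟨M, h⟩
    exact ⟨(p : ℝ) ^ (-(M : ℤ)), zpow_pos hp _, fun t ht => h _ (by simpa using ht.le)⟩

/-- A character of `ℚ_p` is smooth if it is trivial near `0`. -/
def AddChar.IsSmooth (η : AddChar ℚ_[p] ℂ) : Prop := ∀ᶠ t in 𝓝 (0 : ℚ_[p]), η t = 1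

theorem AddChar.map_eq_of_map_sub_eq_one {η : AddChar ℚ_[p] ℂ} {s t : ℚ_[p]} (h : η (s - t) = 1) :
    η s = η t := by
  rw [← sub_add_cancel s t, η.map_add_eq_mul, h, one_mul]

theorem AddChar.map_sub_eq_one_iff {η : AddChar ℚ_[p] ℂ} {s t : ℚ_[p]} :
    η (s - t) = 1 ↔ η s = η t := by
  refine ⟨AddChar.map_eq_of_map_sub_eq_one, fun h => ?_⟩
  rw [AddChar.map_sub_eq_div, h]
  exact div_self (η.val_isUnit t).ne_zero

theorem AddChar.map_natCast_mul (η : AddChar ℚ_[p] ℂ) (j : ℕ) (t : ℚ_[p]) :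
    η (j * t) = η t ^ j := by
  rw [← nsmul_eq_mul, η.map_nsmul_eq_pow]

/-- The kernel is open and closed under natural multiples, and `ℕ` is dense in `ℤ_p`; so the kernel
is a `ℤ_p`-submodule. -/
theorem AddChar.IsSmooth.eq_one_of_norm_le_one {η : AddChar ℚ_[p] ℂ} (hη : η.IsSmooth) {u : ℚ_[p]}
    (hu : η u = 1) {z : ℚ_[p]} (hz : ‖z‖ ≤ 1) : η (u * z) = 1 := by
  obtain ⟨M, hM⟩ := Padic.eventually_nhds_zero_iff.mp hη
  have hp : (0 : ℝ) < p := zero_lt_one.trans Padic.one_lt_prime_cast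
  rcases eq_or_ne u 0 with rfl | hu0
  · simp
  have hu' : 0 < ‖u‖ := norm_pos_iff.mpr hu0
  obtain ⟨j, hj⟩ := Padic.exists_natCast_norm_sub_le z hz
    (div_pos (zpow_pos hp (-(M : ℤ))) hu')
  have h1 : η (u * z - j * u) = 1 := by
    apply hM
    rw [mul_comm (j : ℚ_[p]), ← mul_sub, norm_mul, mul_comm]
    exact ((lt_div_iff₀ hu').mp hj).le
  rw [AddChar.map_eq_of_map_sub_eq_one h1, AddChar.map_natCast_mul, hu, one_pow]

/-- The kernel is a proper `ℤ_p`-submodule, hence some `p ^ k ℤ_p`. Here `k` is the least exponent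
for which `p ^ k ℤ_p` lies in the kernel; an element of the kernel outside it would generate `p ^ (k
- 1) ℤ_p` as well. -/
theorem AddChar.IsSmooth.exists_normalized {η : AddChar ℚ_[p] ℂ} (hη : η.IsSmooth)
    (hne : ∃ t, η t ≠ 1) : ∃ c : ℚ_[p], c ≠ 0 ∧ ∀ t, η (c * t) = 1 ↔ ‖t‖ ≤ 1 := by
  have hp1 : (1 : ℝ) < p := Padic.one_lt_prime_cast
  have hp : (0 : ℝ) < p := zero_lt_one.trans hp1
  obtain ⟨M, hM⟩ := Padic.eventually_nhds_zero_iff.mp hη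
  obtain ⟨t₀, ht₀⟩ := hne
  have ht₀' : t₀ ≠ 0 := by rintro rfl; simp at ht₀
  obtain ⟨k, hk, hkmin⟩ := Int.exists_least_of_bdd
    (P := fun k : ℤ => ∀ t : ℚ_[p], ‖t‖ ≤ (p : ℝ) ^ (-k) → η t = 1)
    ⟨t₀.valuation, fun z hz => by
      by_contra hlt
      refine ht₀ (hz t₀ ?_)
      rw [Padic.norm_eq_zpow_neg_valuation ht₀']
      exact zpow_le_zpow_right₀ hp1.le (by omega)⟩ ⟨M, hM⟩
  obtain ⟨t₁, ht₁, ht₁'⟩ : ∃ t : ℚ_[p], ‖t‖ ≤ (p : ℝ) ^ (-(k - 1)) ∧ η t ≠ 1 := by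
    by_contra! h
    have := hkmin (k - 1) h
    omega
  have hc0 : (p : ℚ_[p]) ^ k ≠ 0 := zpow_ne_zero _ Padic.prime_cast_ne_zero
  refine ⟨(p : ℚ_[p]) ^ k, hc0, fun t => ⟨fun h => ?_, fun h => ?_⟩⟩
  · by_contra hlt
    push Not at hlt
    have ht : t ≠ 0 := by rintro rfl; simp at hlt; linarith
    have hpt : (p : ℝ) ≤ ‖t‖ := by
      rw [Padic.norm_eq_zpow_neg_valuation ht] at hlt ⊢
      have : 0 < -t.valuation := by
        by_contra hle
        exact absurd hlt (not_lt.mpr (zpow_le_one_of_nonpos₀ hp1.le (by omega)))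
      calc (p : ℝ) = (p : ℝ) ^ (1 : ℤ) := by simp
        _ ≤ _ := zpow_le_zpow_right₀ hp1.le (by omega)
    apply ht₁'
    have hct : (p : ℚ_[p]) ^ k * t ≠ 0 := mul_ne_zero hc0 ht
    have := hη.eq_one_of_norm_le_one h (z := t₁ / ((p : ℚ_[p]) ^ k * t)) ?_
    · rwa [mul_div_cancel₀ _ hct] at this
    · rw [norm_div, norm_mul, Padic.norm_p_zpow]
      have hk0 : (0 : ℝ) < (p : ℝ) ^ (-k) := zpow_pos hp _
      rw [div_le_one (mul_pos hk0 (hp.trans_le hpt))]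
      refine ht₁.trans ?_
      have : (p : ℝ) ^ (-(k - 1)) = (p : ℝ) ^ (-k) * p := by
        rw [show -(k - 1) = -k + 1 by ring, zpow_add_one₀ hp.ne']
      rw [this]
      gcongr
  · apply hk
    rw [norm_mul, Padic.norm_p_zpow]
    exact mul_le_of_le_one_right (zpow_pos hp _).le h

/-- A character of `ℚ_p` is normalized if its kernel is `ℤ_p`. -/
def AddChar.IsNormalized (χ : AddChar ℚ_[p] ℂ) : Prop := ∀ t, χ t = 1 ↔ ‖t‖ ≤ 1

theorem AddChar.IsNormalized.isPrimitiveRoot {χ : AddChar ℚ_[p] ℂ} (hχ : χ.IsNormalized) (k : ℕ) :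
    IsPrimitiveRoot (χ ((p : ℚ_[p]) ^ (-(k : ℤ)))) (p ^ k) := by
  have hp : (0 : ℝ) < p := zero_lt_one.trans Padic.one_lt_prime_cast
  have key : ∀ l : ℕ, χ ((p : ℚ_[p]) ^ (-(k : ℤ))) ^ l = 1 ↔ p ^ k ∣ l := fun l => by
    rw [← AddChar.map_natCast_mul, hχ, norm_mul, Padic.norm_p_zpow, neg_neg,
      ← le_div_iff₀ (zpow_pos hp _), one_div, ← zpow_neg, ← Int.cast_natCast,
      Padic.norm_int_le_pow_iff_dvd]
    exact_mod_cast Iff.rfl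
  exact ⟨(key _).mpr dvd_rfl, fun l hl => (key l).mp hl⟩

theorem AddChar.IsNormalized.exists_eq_of_pow_eq_one {χ : AddChar ℚ_[p] ℂ} (hχ : χ.IsNormalized)
    {k : ℕ} {ζ : ℂ} (hζ : ζ ^ p ^ k = 1) :
    ∃ i < p ^ k, χ (i * (p : ℚ_[p]) ^ (-(k : ℤ))) = ζ := by
  have : NeZero (p ^ k) := ⟨pow_ne_zero _ (Fact.out : p.Prime).ne_zero⟩
  obtain ⟨i, hi, h⟩ := (hχ.isPrimitiveRoot k).eq_pow_of_pow_eq_one hζ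
  exact ⟨i, hi, by rw [AddChar.map_natCast_mul, h]⟩

theorem AddChar.IsSmooth.exists_pow_eq_one {η : AddChar ℚ_[p] ℂ} (hη : η.IsSmooth) (t : ℚ_[p]) :
    ∃ k : ℕ, η t ^ p ^ k = 1 := by
  have h : Tendsto (fun k : ℕ => (p : ℚ_[p]) ^ k * t) atTop (𝓝 0) := by
    simpa using (tendsto_pow_atTop_nhds_zero_of_norm_lt_one
      (Padic.norm_p_lt_one (p := p))).mul_const t
  obtain ⟨k, hk⟩ := (h.eventually hη).exists
  refine ⟨k, ?_⟩
  rw [← AddChar.map_natCast_mul]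
  exact_mod_cast hk

theorem AddChar.IsNormalized.isSmooth {χ : AddChar ℚ_[p] ℂ} (hχ : χ.IsNormalized) :
    χ.IsSmooth :=
  Padic.eventually_nhds_zero_iff.mpr ⟨0, fun t ht => (hχ t).mpr (by simpa using ht)⟩

/-- Two smooth characters that agree at all `p ^ (-r)` are equal. -/
theorem AddChar.IsSmooth.ext {η θ : AddChar ℚ_[p] ℂ} (hη : η.IsSmooth) (hθ : θ.IsSmooth)
    (h : ∀ r : ℕ, η ((p : ℚ_[p]) ^ (-(r : ℤ))) = θ ((p : ℚ_[p]) ^ (-(r : ℤ)))) (t : ℚ_[p]) :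
    η t = θ t := by
  obtain ⟨ε, hε, hε'⟩ := Metric.eventually_nhds_iff.mp (hη.and hθ)
  obtain ⟨r, hr⟩ := Padic.exists_norm_le_zpow t
  obtain ⟨j, hj⟩ := Padic.exists_natCast_mul_norm_sub_lt t r hr hε
  obtain ⟨h1, h2⟩ := hε' (y := t - j * (p : ℚ_[p]) ^ (-(r : ℤ))) (by simpa using hj)
  rw [AddChar.map_eq_of_map_sub_eq_one h1, AddChar.map_eq_of_map_sub_eq_one h2,
    AddChar.map_natCast_mul, AddChar.map_natCast_mul, h]

/-- Every smooth character of `ℚ_p` is a dilate of a given normalized one. -/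
theorem AddChar.IsNormalized.exists_eq_mul {χ : AddChar ℚ_[p] ℂ} (hχ : χ.IsNormalized)
    {η : AddChar ℚ_[p] ℂ} (hη : η.IsSmooth) : ∃ s, ∀ t, η t = χ (s * t) := by
  have hp1 : (1 : ℝ) < p := Padic.one_lt_prime_cast
  have hp : (0 : ℝ) < p := zero_lt_one.trans hp1
  have hp0 : (p : ℚ_[p]) ≠ 0 := Padic.prime_cast_ne_zero
  have key : ∀ u : ℚ_[p], ∀ r : ℕ, χ (u * (p : ℚ_[p]) ^ (-(r : ℤ))) = 1 ↔
      ‖u‖ ≤ (p : ℝ) ^ (-(r : ℤ)) := fun u r => by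
    rw [hχ, norm_mul, Padic.norm_p_zpow, neg_neg, ← le_div_iff₀ (zpow_pos hp _), one_div,
      ← zpow_neg]
  -- The values of `η` are roots of unity of `p`-power order, all of which are values of `χ`. The
  -- number `s r` is determined modulo `p ^ r ℤ_p`, so the choices form a Cauchy sequence, whose
  -- limit is the dilation factor.
  have h1 : ∀ r : ℕ, ∃ s : ℚ_[p], χ (s * (p : ℚ_[p]) ^ (-(r : ℤ))) =
      η ((p : ℚ_[p]) ^ (-(r : ℤ))) := fun r => by
    obtain ⟨k, hk⟩ := hη.exists_pow_eq_one ((p : ℚ_[p]) ^ (-(r : ℤ)))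
    obtain ⟨i, -, hi⟩ := hχ.exists_eq_of_pow_eq_one hk
    refine ⟨i * (p : ℚ_[p]) ^ (-(k : ℤ)) * (p : ℚ_[p]) ^ (r : ℤ), ?_⟩
    rw [mul_assoc, ← zpow_add₀ hp0, add_neg_cancel, zpow_zero, mul_one, hi]
  choose s hs using h1
  have hstep : ∀ r, dist (s r) (s (r + 1)) ≤ 1 * ((p : ℝ)⁻¹) ^ r := fun r => by
    rw [dist_comm, dist_eq_norm, one_mul, inv_pow, ← zpow_natCast, ← zpow_neg, ← key, sub_mul,
      AddChar.map_sub_eq_one_iff, hs]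
    have e : ((p : ℚ_[p]) ^ (-(r : ℤ))) = p * (p : ℚ_[p]) ^ (-((r + 1 : ℕ) : ℤ)) := by
      rw [← zpow_one_add₀ hp0]; congr 1; push_cast; ring
    rw [e, mul_left_comm, AddChar.map_natCast_mul, AddChar.map_natCast_mul, hs]
  have hlt : (p : ℝ)⁻¹ < 1 := inv_lt_one_of_one_lt₀ hp1
  obtain ⟨S, hS⟩ := cauchySeq_tendsto_of_complete (cauchySeq_of_le_geometric _ _ hlt hstep)
  have hmono : ∀ r k : ℕ, ‖s (r + k) - s r‖ ≤ (p : ℝ) ^ (-(r : ℤ)) := fun r k => by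
    induction k with
    | zero => simp
    | succ k ih =>
      have e : s (r + (k + 1)) - s r = (s (r + k + 1) - s (r + k)) + (s (r + k) - s r) := by
        rw [add_assoc]; ring
      rw [e]
      refine (Padic.nonarchimedean _ _).trans (max_le ?_ ih)
      have := hstep (r + k)
      rw [dist_comm, dist_eq_norm, one_mul, inv_pow, ← zpow_natCast, ← zpow_neg] at this
      exact this.trans (zpow_le_zpow_right₀ hp1.le (by push_cast; omega))
  have hlim : ∀ r : ℕ, ‖S - s r‖ ≤ (p : ℝ) ^ (-(r : ℤ)) := fun r => by
    have h2 : Tendsto (fun k => ‖s (k + r) - s r‖) atTop (𝓝 ‖S - s r‖) :=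
      (((tendsto_add_atTop_iff_nat r).mpr hS).sub_const _).norm
    exact le_of_tendsto' h2 fun k => by rw [add_comm]; exact hmono r k
  let θ : AddChar ℚ_[p] ℂ :=
    { toFun := fun t => χ (S * t)
      map_zero_eq_one' := by simp
      map_add_eq_mul' := fun a b => by rw [mul_add, χ.map_add_eq_mul] }
  have hθ : θ.IsSmooth := by
    have : Tendsto (fun t => S * t) (𝓝 (0 : ℚ_[p])) (𝓝 0) := by
      simpa using (continuous_const_mul S).tendsto 0
    exact this.eventually hχ.isSmooth
  refine ⟨S, fun t => hη.ext hθ (fun r => ?_) t⟩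
  rw [← hs r]
  refine (AddChar.map_eq_of_map_sub_eq_one ?_).symm
  rw [← sub_mul, key]
  exact hlim r

end PadicCharacters

/-! ### Smooth representations -/

namespace Representation

variable {G V : Type*} [Group G] [AddCommGroup V] [Module ℂ V]

theorem isIrreducible_iff (ρ : Representation ℂ G V) :
    ρ.IsIrreducible ↔ Nontrivial V ∧
      ∀ W : Submodule ℂ V, (∀ g, ∀ w ∈ W, ρ g w ∈ W) → W = ⊥ ∨ W = ⊤ := by
  constructor
  · intro h
    refine ⟨?_, fun W hW => ?_⟩
    · by_contra hV
      rw [not_nontrivial_iff_subsingleton] at hV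
      exact bot_ne_top (α := Subrepresentation ρ)
        (Subrepresentation.toSubmodule_injective (Subsingleton.elim _ _))
    · rcases h.eq_bot_or_eq_top (⟨W, hW⟩ : Subrepresentation ρ) with h | h
      · exact Or.inl (congrArg Subrepresentation.toSubmodule h)
      · exact Or.inr (congrArg Subrepresentation.toSubmodule h)
  · rintro ⟨hV, h⟩
    have : Nontrivial (Subrepresentation ρ) :=
      ⟨⊥, ⊤, fun h => bot_ne_top (α := Submodule ℂ V) (congrArg Subrepresentation.toSubmodule h)⟩
    refine ⟨fun W => ?_⟩
    rcases h W.toSubmodule W.apply_mem_toSubmodule with h | h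
    · exact Or.inl (Subrepresentation.toSubmodule_injective h)
    · exact Or.inr (Subrepresentation.toSubmodule_injective h)

/-- The subspace of vectors fixed by a subgroup. -/
def fixedBy (ρ : Representation ℂ G V) (K : Subgroup G) : Submodule ℂ V where
  carrier := {v | ∀ k ∈ K, ρ k v = v}
  add_mem' hv hw k hk := by rw [map_add, hv k hk, hw k hk]
  zero_mem' k _ := map_zero _
  smul_mem' c v hv k hk := by rw [map_smul, hv k hk]

theorem apply_inv_self_apply (ρ : Representation ℂ G V) (g : G) (v : V) : ρ g⁻¹ (ρ g v) = v := by
  rw [← Module.End.mul_apply, ← map_mul, inv_mul_cancel, map_one, Module.End.one_apply]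

theorem apply_self_inv_apply (ρ : Representation ℂ G V) (g : G) (v : V) : ρ g (ρ g⁻¹ v) = v := by
  rw [← Module.End.mul_apply, ← map_mul, mul_inv_cancel, map_one, Module.End.one_apply]

theorem map_mul_apply (ρ : Representation ℂ G V) (g h : G) (v : V) : ρ (g * h) v = ρ g (ρ h v) := by
  rw [map_mul, Module.End.mul_apply]

variable [TopologicalSpace G]

/-- A representation is smooth if every vector has an open stabilizer. -/
def IsSmooth (ρ : Representation ℂ G V) : Prop :=
  ∀ v, ∃ K : Subgroup G, IsOpen (K : Set G) ∧ ∀ k ∈ K, ρ k v = v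

/-- A representation is admissible if every open subgroup has a finite-dimensional space of
fixed vectors. -/
def IsAdmissible (ρ : Representation ℂ G V) : Prop :=
  ∀ K : Subgroup G, IsOpen (K : Set G) → FiniteDimensional ℂ (ρ.fixedBy K)

theorem IsSmooth.eventually_eq [IsTopologicalGroup G] {ρ : Representation ℂ G V} (h : ρ.IsSmooth)
    (v : V) (g : G) : ∀ᶠ x in nhds g, ρ x v = ρ g v := by
  obtain ⟨K, hK, hKv⟩ := h v
  have hc : Filter.Tendsto (fun x => g⁻¹ * x) (nhds g) (nhds 1) := by
    simpa using (continuous_const_mul g⁻¹).tendsto g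
  filter_upwards [hc.eventually (hK.mem_nhds K.one_mem)] with x hx
  have h1 := map_mul_apply ρ g (g⁻¹ * x) v
  rwa [mul_inv_cancel_left, hKv _ hx] at h1

end Representation

open Polynomial in
/-- An operator that is locally of finite order and `M`-periodic at `v`: if `v` lies in the range
of `Y - ζ` for all `M`-th roots of unity `ζ`, then `v = 0`. -/
theorem Module.End.eq_zero_of_forall_mem_range {V : Type*} [AddCommGroup V] [Module ℂ V]
    (Y : Module.End ℂ V) (hY : ∀ u, ∃ M : ℕ, 0 < M ∧ (Y ^ M) u = u) {v : V} {M : ℕ} (hM : 0 < M)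
    (hv : (Y ^ M) v = v) (h : ∀ ζ : ℂ, ζ ^ M = 1 → ∃ u, Y u - ζ • u = v) : v = 0 := by
  -- No Jordan blocks: `Y ^ j u = ζ ^ j u + j ζ ^ (j - 1) w`, so periodicity of `u` forces a
  -- positive multiple of `w` to vanish. The formula `h2` is multiplied by `ζ` to avoid the exponent
  -- `j - 1`.
  have ker_inter : ∀ (ζ : ℂ) (u w : V), Y u - ζ • u = w → Y w = ζ • w → w = 0 := by
    intro ζ u w hu hw
    obtain ⟨m, hm, hmu⟩ := hY u
    have hmw : (Y ^ m) w = w := by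
      rw [← hu, map_sub, map_smul, ← Module.End.mul_apply, ← pow_succ, pow_succ',
        Module.End.mul_apply, hmu]
    have h1 : ∀ j : ℕ, (Y ^ j) w = ζ ^ j • w := fun j => by
      induction j with
      | zero => simp
      | succ j ih => rw [pow_succ', Module.End.mul_apply, ih, map_smul, hw, smul_smul, pow_succ]
    have h2 : ∀ j : ℕ, ζ • (Y ^ j) u = ζ ^ (j + 1) • u + ((j : ℂ) * ζ ^ j) • w := fun j => by
      induction j with
      | zero => simp
      | succ j ih =>
        rw [pow_succ', Module.End.mul_apply, ← map_smul, ih, map_add, map_smul, map_smul, hw,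
          sub_eq_iff_eq_add.mp hu]
        module
    by_contra hw0
    have h3 : ζ ^ m = 1 := by
      have := h1 m
      rw [hmw] at this
      have h4 : (1 - ζ ^ m) • w = 0 := by rw [sub_smul, one_smul, ← this, sub_self]
      have := (smul_eq_zero.mp h4).resolve_right hw0
      linear_combination -this
    have h5 := h2 m
    rw [hmu, pow_succ, h3, one_mul, mul_one, left_eq_add] at h5
    exact (smul_eq_zero.mp h5).elim (fun h => hm.ne' (by exact_mod_cast h)) hw0
  -- Peel off the roots one at a time: `Y w - a w` again lies in all the ranges and is killed by the
  -- remaining factors, so it vanishes, and then `ker_inter` gives `w = 0`.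
  have key : ∀ (s : Finset ℂ), (∀ ζ ∈ s, ζ ^ M = 1) → ∀ w,
      (∀ ζ : ℂ, ζ ^ M = 1 → ∃ u, Y u - ζ • u = w) →
      aeval Y (∏ ζ ∈ s, (X - C ζ)) w = 0 → w = 0 := by
    intro s
    induction s using Finset.induction_on with
    | empty => intro _ w _ h0; simpa using h0
    | insert a s ha ih =>
      intro hs w hw h0
      rw [Finset.prod_insert ha, mul_comm, map_mul, Module.End.mul_apply] at h0
      have e : ∀ u, aeval Y (X - C a) u = Y u - a • u := fun u => by simp
      rw [e] at h0
      have h1 := ih (fun ζ hζ => hs ζ (Finset.mem_insert_of_mem hζ)) (Y w - a • w)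
        (fun ζ hζ => by
          obtain ⟨u, rfl⟩ := hw ζ hζ
          exact ⟨Y u - a • u, by simp only [map_sub, map_smul]; module⟩) h0
      obtain ⟨u, hu⟩ := hw a (hs a (Finset.mem_insert_self _ _))
      exact ker_inter a u w hu (sub_eq_zero.mp h1)
  refine key (nthRootsFinset M 1) (fun ζ hζ => (mem_nthRootsFinset hM 1).mp hζ) v h ?_
  rw [← X_pow_sub_one_eq_prod hM (Complex.isPrimitiveRoot_exp M hM.ne')]
  simp [hv]

/-! ### Representations with a Heisenberg pair -/

open Filter Topology in
/-- One-parameter subgroups `x`, `y` whose commutators act by a normalized character, the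
commutators of `y` with any group element acting by scalars. -/
structure HeisenbergPair (p : ℕ) [Fact p.Prime] {G V : Type*} [Group G] [TopologicalSpace G]
    [AddCommGroup V] [Module ℂ V] (ρ : Representation ℂ G V) where
  x : AddChar ℚ_[p] G
  y : AddChar ℚ_[p] G
  continuous_x : Continuous x
  continuous_y : Continuous y
  χ : AddChar ℚ_[p] ℂ
  normalized : χ.IsNormalized
  b : G → AddChar ℚ_[p] ℂ
  comm : ∀ g t v, ρ g (ρ (y t) v) = b g t • ρ (y t) (ρ g v)
  b_x : ∀ s t, b (x s) t = χ (s * t)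

namespace HeisenbergPair

open Filter Topology

variable {p : ℕ} [Fact p.Prime] {G V : Type*} [Group G] [TopologicalSpace G]
  [IsTopologicalGroup G] [AddCommGroup V] [Module ℂ V] {ρ : Representation ℂ G V}

section

variable (D : HeisenbergPair p ρ)

theorem y_mul_natCast (j : ℕ) (t : ℚ_[p]) : ρ (D.y (j * t)) = ρ (D.y t) ^ j := by
  rw [← nsmul_eq_mul, D.y.map_nsmul_eq_pow, map_pow]

theorem ρ_y_zero : ρ (D.y 0) = 1 := by rw [D.y.map_zero_eq_one, map_one]

theorem eventually_y (hs : ρ.IsSmooth) (u : V) (t : ℚ_[p]) :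
    ∀ᶠ t' in 𝓝 t, ρ (D.y t') u = ρ (D.y t) u :=
  (D.continuous_y.tendsto t).eventually (hs.eventually_eq u _)

theorem eventually_x (hs : ρ.IsSmooth) (u : V) (t : ℚ_[p]) :
    ∀ᶠ t' in 𝓝 t, ρ (D.x t') u = ρ (D.x t) u :=
  (D.continuous_x.tendsto t).eventually (hs.eventually_eq u _)

theorem b_mul [Nontrivial V] (g h : G) (t : ℚ_[p]) : D.b (g * h) t = D.b g t * D.b h t := by
  obtain ⟨v, hv⟩ := exists_ne (0 : V)
  have h0 : ρ (D.y t) (ρ (g * h) v) ≠ 0 := by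
    rw [← ρ.map_mul_apply]
    intro h0
    exact hv (by rw [← ρ.apply_inv_self_apply (D.y t * (g * h)) v, h0, map_zero])
  have h1 := D.comm (g * h) t v
  rw [ρ.map_mul_apply, D.comm h, map_smul, D.comm g, smul_smul, ← ρ.map_mul_apply g h] at h1
  rw [mul_comm (D.b g t)]
  exact (smul_left_injective ℂ h0 h1).symm

theorem b_isSmooth [Nontrivial V] (hs : ρ.IsSmooth) (g : G) : (D.b g).IsSmooth := by
  obtain ⟨v, hv⟩ := exists_ne (0 : V)
  have h0 : ρ g v ≠ 0 := fun h0 => hv (by rw [← ρ.apply_inv_self_apply g v, h0, map_zero])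
  filter_upwards [D.eventually_y hs v 0, D.eventually_y hs (ρ g v) 0] with t h1 h2
  have h3 := D.comm g t v
  rw [h1, h2, D.ρ_y_zero, Module.End.one_apply, Module.End.one_apply] at h3
  exact (smul_left_injective ℂ h0 (show (1 : ℂ) • _ = _ by rw [one_smul]; exact h3)).symm

/-- The span of all `y(t) u - u`; the quotient is the space of coinvariants of `y`. -/
def null : Submodule ℂ V := Submodule.span ℂ {w | ∃ t u, ρ (D.y t) u - u = w}

theorem sub_mem_null (t : ℚ_[p]) (u : V) : ρ (D.y t) u - u ∈ D.null :=
  Submodule.subset_span ⟨t, u, rfl⟩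

theorem mkQ_sub (t : ℚ_[p]) (u : V) : D.null.mkQ (ρ (D.y t) u - u) = 0 :=
  (Submodule.Quotient.mk_eq_zero _).mpr (D.sub_mem_null t u)

theorem mem_null_of_eigen {t : ℚ_[p]} {u : V} {c : ℂ} (hc : c ≠ 1) (h : ρ (D.y t) u = c • u) :
    u ∈ D.null := by
  have h1 := D.sub_mem_null t u
  have h2 : ρ (D.y t) u - u = (c - 1) • u := by rw [h]; module
  rw [h2] at h1
  exact (Submodule.smul_mem_iff _ (sub_ne_zero.mpr hc)).mp h1

/-- On a given vector `y(t)` acts as a power of `Y = y(p ^ (-r))` once `r` is large, and `Y - 1`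
divides `Y ^ j - 1`. Having all large `r` available at once makes the property pass to sums. -/
theorem exists_of_mem_null (hs : ρ.IsSmooth) {v : V} (hv : v ∈ D.null) :
    ∃ a : ℕ, ∀ r : ℕ, a ≤ r → ∃ u, ρ (D.y ((p : ℚ_[p]) ^ (-(r : ℤ)))) u - u = v := by
  induction hv using Submodule.span_induction with
  | mem w hw =>
    obtain ⟨t, u, rfl⟩ := hw
    obtain ⟨ε, hε, h⟩ := Metric.eventually_nhds_iff.mp (D.eventually_y hs u t)
    obtain ⟨a, ha⟩ := Padic.exists_norm_le_zpow t
    refine ⟨a, fun r hr => ?_⟩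
    obtain ⟨j, hj⟩ := Padic.exists_natCast_mul_norm_sub_lt t r (ha.trans
      (zpow_le_zpow_right₀ (Padic.one_lt_prime_cast (p := p)).le (by exact_mod_cast hr))) hε
    refine ⟨(∑ i ∈ Finset.range j, ρ (D.y ((p : ℚ_[p]) ^ (-(r : ℤ)))) ^ i) u, ?_⟩
    rw [← h (y := j * (p : ℚ_[p]) ^ (-(r : ℤ))) (by rwa [dist_comm, dist_eq_norm]),
      D.y_mul_natCast]
    have := congrArg (fun f : Module.End ℂ V => f u)
      (mul_geom_sum (ρ (D.y ((p : ℚ_[p]) ^ (-(r : ℤ))))) j)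
    simpa [sub_mul] using this
  | zero => exact ⟨0, fun r _ => ⟨0, by simp⟩⟩
  | add v w _ _ hv hw =>
    obtain ⟨a, ha⟩ := hv
    obtain ⟨c, hc⟩ := hw
    refine ⟨max a c, fun r hr => ?_⟩
    obtain ⟨u, rfl⟩ := ha r (le_of_max_le_left hr)
    obtain ⟨u', rfl⟩ := hc r (le_of_max_le_right hr)
    exact ⟨u + u', by rw [map_add]; abel⟩
  | smul c v _ hv =>
    obtain ⟨a, ha⟩ := hv
    refine ⟨a, fun r hr => ?_⟩
    obtain ⟨u, rfl⟩ := ha r hr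
    exact ⟨c • u, by rw [map_smul, smul_sub]⟩

theorem comm_x (s t : ℚ_[p]) (v : V) :
    ρ (D.x s) (ρ (D.y t) v) = D.χ (s * t) • ρ (D.y t) (ρ (D.x s) v) := by
  rw [D.comm, D.b_x]

theorem ρ_x_neg_apply (s : ℚ_[p]) (v : V) : ρ (D.x (-s)) (ρ (D.x s) v) = v := by
  rw [← ρ.map_mul_apply, ← D.x.map_add_eq_mul, neg_add_cancel, D.x.map_zero_eq_one, map_one,
    Module.End.one_apply]

/-- The fibres of the coinvariants over all characters of `y` separate vectors. -/
theorem eq_zero_of_forall_mem_null (hs : ρ.IsSmooth) {v : V}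
    (hv : ∀ s, ρ (D.x s) v ∈ D.null) : v = 0 := by
  have hp1 : (1 : ℝ) < p := Padic.one_lt_prime_cast
  have hp : (0 : ℝ) < p := zero_lt_one.trans hp1
  have hp0 : (p : ℚ_[p]) ≠ 0 := Padic.prime_cast_ne_zero
  let Y : ℕ → Module.End ℂ V := fun r => ρ (D.y ((p : ℚ_[p]) ^ (-(r : ℤ))))
  have hpow : ∀ a k : ℕ, Y a = Y (a + k) ^ p ^ k := fun a k => by
    change ρ _ = ρ _ ^ p ^ k
    rw [← D.y_mul_natCast]
    congr 2
    rw [Nat.cast_pow, ← zpow_natCast, ← zpow_add₀ hp0]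
    congr 1; push_cast; ring
  -- Conjugation by `x(-s)` twists `y` by a character, so the hypothesis at `s` puts `v` in the
  -- range of `Y a - χ(s p ^ (-a))`.
  have h1 : ∀ s, ∃ a : ℕ, ∃ u, Y a u - D.χ (s * (p : ℚ_[p]) ^ (-(a : ℤ))) • u = v := fun s => by
    obtain ⟨a, ha⟩ := D.exists_of_mem_null hs (hv s)
    obtain ⟨u, hu⟩ := ha a le_rfl
    refine ⟨a, D.χ (-s * (p : ℚ_[p]) ^ (-(a : ℤ))) • ρ (D.x (-s)) u, ?_⟩
    have h2 := congrArg (ρ (D.x (-s))) hu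
    rw [D.ρ_x_neg_apply, map_sub, D.comm_x] at h2
    rw [← h2, map_smul, smul_smul, ← AddChar.map_add_eq_mul, ← add_mul, add_neg_cancel, zero_mul,
      AddChar.map_zero_eq_one, one_smul]
  choose a ha using h1
  -- `Y (a s)` is the `p ^ k`-th power of `Y r`, and `X - c` divides `X ^ (p ^ k) - c ^ (p ^ k)`.
  -- The range condition therefore passes to every larger `r`, and it depends on `s` only up to `p ^
  -- (a s) ℤ_p`.
  have h3 : ∀ s s' : ℚ_[p], ‖s' - s‖ ≤ (p : ℝ) ^ (-(a s : ℤ)) → ∀ r, a s ≤ r →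
      ∃ u, Y r u - D.χ (s' * (p : ℚ_[p]) ^ (-(r : ℤ))) • u = v := fun s s' hss r hr => by
    obtain ⟨k, rfl⟩ := Nat.exists_eq_add_of_le hr
    obtain ⟨u, hu⟩ := ha s
    have h4 : D.χ (s * (p : ℚ_[p]) ^ (-(a s : ℤ))) =
        D.χ (s' * (p : ℚ_[p]) ^ (-((a s + k : ℕ) : ℤ))) ^ p ^ k := by
      have h5 : D.χ (s' * (p : ℚ_[p]) ^ (-(a s : ℤ))) = D.χ (s * (p : ℚ_[p]) ^ (-(a s : ℤ))) := by
        apply AddChar.map_eq_of_map_sub_eq_one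
        rw [← sub_mul, D.normalized, norm_mul, Padic.norm_p_zpow, neg_neg,
          ← le_div_iff₀ (zpow_pos hp _), one_div, ← zpow_neg]
        exact hss
      rw [← h5, ← AddChar.map_natCast_mul]
      congr 1
      rw [mul_left_comm, Nat.cast_pow, ← zpow_natCast, ← zpow_add₀ hp0]
      congr 2; push_cast; ring
    rw [h4, hpow (a s) k] at hu
    set c := D.χ (s' * (p : ℚ_[p]) ^ (-((a s + k : ℕ) : ℤ)))
    have h6 := (Algebra.commutes c (Y (a s + k))).symm
    have h7 := congrArg (fun f : Module.End ℂ V => f u)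
      (Commute.mul_geom_sum₂ (show Commute (Y (a s + k)) (algebraMap ℂ _ c) from h6) (p ^ k))
    refine ⟨(∑ i ∈ Finset.range (p ^ k), Y (a s + k) ^ i *
      algebraMap ℂ (Module.End ℂ V) c ^ (p ^ k - 1 - i)) u, h7.trans ?_⟩
    rw [← hu, ← map_pow (algebraMap ℂ (Module.End ℂ V))]
    rfl
  have hR : ∃ R : ℕ, ρ (D.y ((p : ℚ_[p]) ^ (R : ℤ))) v = v := by
    obtain ⟨R, hR⟩ := Padic.eventually_nhds_zero_iff.mp (D.eventually_y hs v 0)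
    refine ⟨R, ?_⟩
    rw [hR _ (by rw [Padic.norm_p_zpow]), D.ρ_y_zero, Module.End.one_apply]
  obtain ⟨R, hR⟩ := hR
  -- Compactness yields one `r` for all `s'` in the ball of radius `p ^ R`. As `v` is fixed by `y(p
  -- ^ R)`, it has period `p ^ (r + R)` under `Y r`, and every root of unity of that order is `χ(s'
  -- p ^ (-r))` with `s' = i p ^ (-R)` in the ball.
  obtain ⟨F, -, hF⟩ := (isCompact_closedBall (0 : ℚ_[p]) ((p : ℝ) ^ (R : ℤ))).elim_nhds_subcover
    (fun s => Metric.closedBall s ((p : ℝ) ^ (-(a s : ℤ))))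
    (fun s _ => Metric.closedBall_mem_nhds s (zpow_pos hp _))
  let r := F.sup a
  refine Module.End.eq_zero_of_forall_mem_range (Y r) (fun u => ?_) (M := p ^ (r + R))
    (pow_pos (Fact.out : p.Prime).pos _) ?_ fun ζ hζ => ?_
  · obtain ⟨M, hM⟩ := Padic.eventually_nhds_zero_iff.mp (D.eventually_y hs u 0)
    refine ⟨p ^ (r + M), pow_pos (Fact.out : p.Prime).pos _, ?_⟩
    rw [← D.y_mul_natCast, hM, D.ρ_y_zero, Module.End.one_apply]
    rw [Nat.cast_pow, ← zpow_natCast, ← zpow_add₀ hp0, Padic.norm_p_zpow]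
    apply le_of_eq; congr 1; push_cast; ring
  · rw [← D.y_mul_natCast, Nat.cast_pow, ← zpow_natCast, ← zpow_add₀ hp0]
    rw [show ((r + R : ℕ) : ℤ) + -(r : ℤ) = R by push_cast; ring, hR]
  · obtain ⟨i, -, hi⟩ := D.normalized.exists_eq_of_pow_eq_one hζ
    have hmem : (i : ℚ_[p]) * (p : ℚ_[p]) ^ (-(R : ℤ)) ∈
        Metric.closedBall (0 : ℚ_[p]) ((p : ℝ) ^ (R : ℤ)) := by
      rw [mem_closedBall_zero_iff, norm_mul, Padic.norm_p_zpow, neg_neg]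
      refine mul_le_of_le_one_left (zpow_pos hp _).le ?_
      exact_mod_cast Padic.norm_int_le_one (p := p) i
    obtain ⟨s, hsF, hs'⟩ := Set.mem_iUnion₂.mp (hF hmem)
    rw [mem_closedBall_iff_norm] at hs'
    obtain ⟨u, hu⟩ := h3 s _ hs' r (Finset.le_sup hsF)
    refine ⟨u, ?_⟩
    rw [← hu, ← hi, mul_assoc, ← zpow_add₀ hp0]
    congr 4
    push_cast; ring_nf

theorem null_ne_top [Nontrivial V] (hs : ρ.IsSmooth) : D.null ≠ ⊤ := fun h => by
  obtain ⟨v, hv⟩ := exists_ne (0 : V)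
  exact hv (D.eq_zero_of_forall_mem_null hs fun s => by rw [h]; trivial)

theorem apply_mem_null {g : G} (hg : ∀ t, D.b g t = 1) {v : V} (hv : v ∈ D.null) :
    ρ g v ∈ D.null := by
  induction hv using Submodule.span_induction with
  | mem w hw =>
    obtain ⟨t, u, rfl⟩ := hw
    rw [map_sub, D.comm, hg, one_smul]
    exact D.sub_mem_null _ _
  | zero => rw [map_zero]; exact D.null.zero_mem
  | add v w _ _ hv hw => rw [map_add]; exact D.null.add_mem hv hw
  | smul c v _ hv => rw [map_smul]; exact D.null.smul_mem c hv

/-- Each vector is congruent to one fixed by `y(t)`. -/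
theorem exists_fixed_sub_mem (hs : ρ.IsSmooth) (t : ℚ_[p]) (v : V) :
    ∃ v' u, ρ (D.y t) v' = v' ∧ v = v' + (ρ (D.y t) u - u) := by
  have hp : (0 : ℝ) < p := zero_lt_one.trans Padic.one_lt_prime_cast
  have hM : ∃ M : ℕ, 0 < M ∧ (ρ (D.y t) ^ M) v = v := by
    have h : Tendsto (fun k : ℕ => (p : ℚ_[p]) ^ k * t) atTop (𝓝 0) := by
      simpa using (tendsto_pow_atTop_nhds_zero_of_norm_lt_one
        (Padic.norm_p_lt_one (p := p))).mul_const t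
    obtain ⟨k, hk⟩ := (h.eventually (D.eventually_y hs v 0)).exists
    refine ⟨p ^ k, pow_pos (Fact.out : p.Prime).pos _, ?_⟩
    rw [← D.y_mul_natCast, Nat.cast_pow, hk, D.ρ_y_zero, Module.End.one_apply]
  obtain ⟨M, hM, hMv⟩ := hM
  set Y := ρ (D.y t)
  have hM0 : (M : ℂ) ≠ 0 := by exact_mod_cast hM.ne'
  -- The average over one period; its difference from `v` lies in the range of `Y - 1` because `Y ^
  -- j - 1 = (Y - 1) ∑_{i < j} Y ^ i`.
  refine ⟨(M : ℂ)⁻¹ • ∑ j ∈ Finset.range M, (Y ^ j) v,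
    -(M : ℂ)⁻¹ • ∑ j ∈ Finset.range M, (∑ i ∈ Finset.range j, Y ^ i) v, ?_, ?_⟩
  · rw [map_smul, map_sum]
    congr 1
    have h1 : ∀ j, Y ((Y ^ j) v) = (Y ^ (j + 1)) v := fun j => by
      rw [pow_succ', Module.End.mul_apply]
    simp_rw [h1]
    have h2 := Finset.sum_range_succ' (fun j => (Y ^ j) v) M
    rw [Finset.sum_range_succ, hMv, pow_zero, Module.End.one_apply] at h2
    exact (add_right_cancel h2).symm
  · have h3 : ∀ j, Y ((∑ i ∈ Finset.range j, Y ^ i) v) - (∑ i ∈ Finset.range j, Y ^ i) v =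
        (Y ^ j) v - v := fun j => by
      have := congrArg (fun f : Module.End ℂ V => f v) (mul_geom_sum Y j)
      simpa [sub_mul] using this
    rw [map_smul, ← smul_sub, map_sum, ← Finset.sum_sub_distrib]
    simp_rw [h3]
    rw [Finset.sum_sub_distrib, Finset.sum_const, Finset.card_range, ← Nat.cast_smul_eq_nsmul ℂ,
      smul_sub, smul_smul, neg_mul, inv_mul_cancel₀ hM0]
    module

end

variable {N₀ : Type*} [Group N₀] [TopologicalSpace N₀]

/-- The representation on the coinvariants of `y` of a group mapping to the centralizer of `y`. -/
def coinvariants (D : HeisenbergPair p ρ) (φ : N₀ →* G) (hφ : ∀ n t, D.b (φ n) t = 1) :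
    Representation ℂ N₀ (V ⧸ D.null) where
  toFun n := D.null.mapQ D.null (ρ (φ n)) fun _ hv => D.apply_mem_null (hφ n) hv
  map_one' := by
    refine Submodule.linearMap_qext _ (LinearMap.ext fun v => ?_)
    simp
  map_mul' n m := by
    refine Submodule.linearMap_qext _ (LinearMap.ext fun v => ?_)
    simp

variable (D : HeisenbergPair p ρ) (φ : N₀ →* G) (hφ : ∀ n t, D.b (φ n) t = 1)

theorem coinvariants_apply_mk (n : N₀) (v : V) :
    D.coinvariants φ hφ n (D.null.mkQ v) = D.null.mkQ (ρ (φ n) v) := rfl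

theorem coinvariants_isSmooth (hs : ρ.IsSmooth) (hc : Continuous φ) :
    (D.coinvariants φ hφ).IsSmooth := by
  intro w
  obtain ⟨v, rfl⟩ := D.null.mkQ_surjective w
  obtain ⟨K, hK, hKv⟩ := hs v
  refine ⟨K.comap φ, hK.preimage hc, fun n hn => ?_⟩
  rw [coinvariants_apply_mk, hKv _ hn]

/-- A stable `W` is compared with the largest `G`-stable subspace `W'` of `V` whose image lies in
`W`. The point is that a nonzero class in `W` has a representative in `W'`, so that `W' = ⊥` forces
`W = ⊥`. -/
theorem coinvariants_isIrreducible (hs : ρ.IsSmooth) (hi : ρ.IsIrreducible)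
    (hφ' : ∀ g, (∀ t, D.b g t = 1) → ∃ n, φ n = g) : (D.coinvariants φ hφ).IsIrreducible := by
  have hp1 : (1 : ℝ) < p := Padic.one_lt_prime_cast
  have hp : (0 : ℝ) < p := zero_lt_one.trans hp1
  rw [Representation.isIrreducible_iff] at hi ⊢
  obtain ⟨hV, hi⟩ := hi
  refine ⟨Submodule.Quotient.nontrivial_iff.mpr (D.null_ne_top hs), fun W hW => ?_⟩
  let W' : Submodule ℂ V :=
    { carrier := {v | ∀ g, D.null.mkQ (ρ g v) ∈ W}
      add_mem' := fun hv hw g => by rw [map_add, map_add]; exact W.add_mem (hv g) (hw g)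
      zero_mem' := fun g => by rw [map_zero, map_zero]; exact W.zero_mem
      smul_mem' := fun c v hv g => by rw [map_smul, map_smul]; exact W.smul_mem c (hv g) }
  rcases hi W' (fun g v hv h => by rw [← ρ.map_mul_apply]; exact hv _) with h | h
  · left
    rw [eq_bot_iff]
    intro w hw
    obtain ⟨v, rfl⟩ := D.null.mkQ_surjective w
    obtain ⟨r, hr⟩ := Padic.eventually_nhds_zero_iff.mp (D.eventually_x hs v 0)
    obtain ⟨v', u, hv', hvu⟩ := D.exists_fixed_sub_mem hs ((p : ℚ_[p]) ^ (-(r : ℤ))) v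
    have hvv' : D.null.mkQ v = D.null.mkQ v' := by
      rw [hvu, map_add, D.mkQ_sub, add_zero]
    -- Here `v'` represents the same class as `v` and is fixed by `y(p ^ (-r))`. If `b g` is
    -- nontrivial at `p ^ (-r)`, then `g v'` is an eigenvector of `y(p ^ (-r))` with eigenvalue
    -- other than `1`, hence null. Otherwise `b g = χ(s ·)` with `s` so small that `x(s)` fixes `v`;
    -- then `g` is an element of the image of `φ` times `x(s)`, and the class of `v'` only moves
    -- inside `W`.
    have hmem : v' ∈ W' := by
      intro g
      by_cases hg : D.b g ((p : ℚ_[p]) ^ (-(r : ℤ))) = 1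
      · obtain ⟨s, hsg⟩ := D.normalized.exists_eq_mul (D.b_isSmooth hs g)
        have hχ := hg
        rw [hsg] at hχ
        have hs1 : ‖s‖ ≤ (p : ℝ) ^ (-(r : ℤ)) := by
          rwa [D.normalized, norm_mul, Padic.norm_p_zpow, neg_neg, ← le_div_iff₀ (zpow_pos hp _),
            one_div, ← zpow_neg] at hχ
        have hxv : ρ (D.x s) v = v := by
          rw [hr s hs1, D.x.map_zero_eq_one, map_one, Module.End.one_apply]
        have h1 : D.null.mkQ (ρ (D.x s) v') = D.null.mkQ v' := by
          have h2 := congrArg (ρ (D.x s)) hvu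
          rw [hxv, map_add, map_sub, D.comm_x, hχ, one_smul] at h2
          have h3 := congrArg D.null.mkQ h2
          rw [map_add, D.mkQ_sub, add_zero, hvv'] at h3
          exact h3.symm
        obtain ⟨n, hn⟩ := hφ' (g * D.x (-s)) fun t => by
          rw [D.b_mul, D.b_x, hsg, ← AddChar.map_add_eq_mul, neg_mul, add_neg_cancel,
            AddChar.map_zero_eq_one]
        have h4 : ρ g v' = ρ (φ n) (ρ (D.x s) v') := by
          rw [hn, ← ρ.map_mul_apply, mul_assoc, ← AddChar.map_add_eq_mul, neg_add_cancel,
            AddChar.map_zero_eq_one, mul_one]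
        rw [h4, ← coinvariants_apply_mk D φ hφ, h1, ← hvv']
        exact hW n _ hw
      · have h5 : ρ g v' ∈ D.null := by
          have h6 := D.comm g ((p : ℚ_[p]) ^ (-(r : ℤ))) v'
          rw [hv'] at h6
          have hb0 : D.b g ((p : ℚ_[p]) ^ (-(r : ℤ))) ≠ 0 := ((D.b g).val_isUnit _).ne_zero
          refine D.mem_null_of_eigen (t := (p : ℚ_[p]) ^ (-(r : ℤ)))
            (c := (D.b g ((p : ℚ_[p]) ^ (-(r : ℤ))))⁻¹) (by simpa using hg) ?_
          rw [h6, smul_smul, inv_mul_cancel₀ hb0, one_smul, ← h6]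
        rw [show D.null.mkQ (ρ g v') = 0 from (Submodule.Quotient.mk_eq_zero _).mpr h5]
        exact W.zero_mem
    rw [h, Submodule.mem_bot] at hmem
    rw [hvv', hmem, map_zero]
    exact Submodule.zero_mem _
  · right
    rw [eq_top_iff]
    intro w _
    obtain ⟨v, rfl⟩ := D.null.mkQ_surjective w
    have hv : v ∈ W' := by rw [h]; trivial
    simpa using hv 1

/-- A vector `v` fixed by `K` is determined by the classes of all `x(s) v` modulo `null`. For large
`s` the class is zero, because `x(s) v` is an eigenvector of some `y(t)` with `y(t) ∈ K`; for the
remaining bounded `s` it depends only on `s` modulo a small ball. Finitely many classes remain, each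
fixed by an open subgroup of `N₀`. -/
theorem isAdmissible_of_coinvariants (hs : ρ.IsSmooth) (hc : Continuous φ)
    (ha : (D.coinvariants φ hφ).IsAdmissible) : ρ.IsAdmissible := by
  have hp1 : (1 : ℝ) < p := Padic.one_lt_prime_cast
  have hp : (0 : ℝ) < p := zero_lt_one.trans hp1
  have hp0 : (p : ℚ_[p]) ≠ 0 := Padic.prime_cast_ne_zero
  intro K hK
  have hK1 : (K : Set G) ∈ 𝓝 (1 : G) := hK.mem_nhds K.one_mem
  obtain ⟨R, hR⟩ := Padic.eventually_nhds_zero_iff.mp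
    ((by simpa using D.continuous_y.tendsto 0 : Tendsto D.y (𝓝 0) (𝓝 1)).eventually hK1)
  obtain ⟨L, hL⟩ := Padic.eventually_nhds_zero_iff.mp
    ((by simpa using D.continuous_x.tendsto 0 : Tendsto D.x (𝓝 0) (𝓝 1)).eventually hK1)
  obtain ⟨F, -, hF⟩ := (isCompact_closedBall (0 : ℚ_[p]) ((p : ℝ) ^ (R : ℤ))).elim_nhds_subcover
    (fun s => Metric.closedBall s ((p : ℝ) ^ (-(L : ℤ))))
    (fun s _ => Metric.closedBall_mem_nhds s (zpow_pos hp _))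
  let K' : ℚ_[p] → Subgroup N₀ := fun s =>
    (K.comap (MulAut.conj (D.x (-s))).toMonoidHom).comap φ
  have hK' : ∀ s, IsOpen (K' s : Set N₀) := fun s => by
    refine IsOpen.preimage hc (IsOpen.preimage (f := fun g => D.x (-s) * g * (D.x (-s))⁻¹) ?_ hK)
    fun_prop
  let f : ρ.fixedBy K →ₗ[ℂ] (s : F) → (D.coinvariants φ hφ).fixedBy (K' s) :=
    LinearMap.pi fun s => LinearMap.codRestrict _
      (D.null.mkQ ∘ₗ ρ (D.x (s : ℚ_[p])) ∘ₗ (ρ.fixedBy K).subtype) fun v n hn => by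
        simp only [LinearMap.comp_apply, Submodule.subtype_apply]
        rw [coinvariants_apply_mk]
        congr 1
        have h1 : D.x (-s) * φ n * (D.x (-s))⁻¹ ∈ K := hn
        have h2 := v.2 _ h1
        rw [← ρ.map_mul_apply]
        have h3 : φ n * D.x s = D.x s * (D.x (-s) * φ n * (D.x (-s))⁻¹) := by
          rw [AddChar.map_neg_eq_inv]; group
        rw [h3, ρ.map_mul_apply, h2]
  have : ∀ s, FiniteDimensional ℂ ((D.coinvariants φ hφ).fixedBy (K' s)) := fun s =>
    ha _ (hK' s)
  refine FiniteDimensional.of_injective f ?_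
  rw [← LinearMap.ker_eq_bot, LinearMap.ker_eq_bot']
  intro v hv
  apply Subtype.ext
  refine D.eq_zero_of_forall_mem_null hs fun s => ?_
  by_cases hsR : s ∈ Metric.closedBall (0 : ℚ_[p]) ((p : ℝ) ^ (R : ℤ))
  · obtain ⟨s', hs'F, hs'⟩ := Set.mem_iUnion₂.mp (hF hsR)
    rw [mem_closedBall_iff_norm] at hs'
    have h1 : ρ (D.x s) (v : V) = ρ (D.x s') (v : V) := by
      rw [← add_sub_cancel s' s, D.x.map_add_eq_mul, ρ.map_mul_apply, v.2 _ (hL _ hs')]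
    rw [h1]
    have h2 := congrArg Subtype.val (congrFun hv ⟨s', hs'F⟩)
    exact (Submodule.Quotient.mk_eq_zero _).mp h2
  · rw [mem_closedBall_zero_iff, not_le] at hsR
    have h1 : ρ (D.y ((p : ℚ_[p]) ^ (R : ℤ))) (v : V) = v :=
      v.2 _ (hR _ (by rw [Padic.norm_p_zpow]))
    have h2 := D.comm_x s ((p : ℚ_[p]) ^ (R : ℤ)) v
    rw [h1] at h2
    have hχ : D.χ (s * (p : ℚ_[p]) ^ (R : ℤ)) ≠ 1 := fun h => by
      rw [D.normalized, norm_mul, Padic.norm_p_zpow, ← le_div_iff₀ (zpow_pos hp _), one_div,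
        ← zpow_neg, neg_neg] at h
      exact absurd h (not_le.mpr hsR)
    have hχ0 : D.χ (s * (p : ℚ_[p]) ^ (R : ℤ)) ≠ 0 := (D.χ.val_isUnit _).ne_zero
    refine D.mem_null_of_eigen (t := (p : ℚ_[p]) ^ (R : ℤ))
      (c := (D.χ (s * (p : ℚ_[p]) ^ (R : ℤ)))⁻¹) (by simpa using hχ) ?_
    conv_rhs => rw [h2]
    rw [smul_smul, inv_mul_cancel₀ hχ0, one_smul]

end HeisenbergPair

/-! ### One-parameter subgroups of unipotent groups -/

section UnipotentPowers

open Polynomial Matrix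

variable {F : Type*} [Field F] {n : ℕ}

/-- Matrices whose entries `(i, k)` vanish for `k < i + j`. -/
def upperLevel (F : Type*) [Field F] (n j : ℕ) : Submodule F (Matrix (Fin n) (Fin n) F) where
  carrier := {a | ∀ i k : Fin n, (k : ℕ) < i + j → a i k = 0}
  add_mem' ha hb i k h := by simp [ha i k h, hb i k h]
  zero_mem' _ _ _ := rfl
  smul_mem' c a ha i k h := by simp [ha i k h]

theorem upperLevel_antitone {i j : ℕ} (h : i ≤ j) : upperLevel F n j ≤ upperLevel F n i :=
  fun _ ha k l hkl => ha k l (by omega)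

theorem mul_mem_upperLevel {i j : ℕ} {a b : Matrix (Fin n) (Fin n) F} (ha : a ∈ upperLevel F n i)
    (hb : b ∈ upperLevel F n j) : a * b ∈ upperLevel F n (i + j) := by
  intro k l h
  rw [Matrix.mul_apply]
  refine Finset.sum_eq_zero fun m _ => ?_
  by_cases hm : (m : ℕ) < k + i
  · rw [ha k m hm, zero_mul]
  · rw [hb m l (by omega), mul_zero]

theorem one_mem_upperLevel : (1 : Matrix (Fin n) (Fin n) F) ∈ upperLevel F n 0 := by
  intro i k h
  exact Matrix.one_apply_ne (by rintro rfl; omega)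

theorem pow_mem_upperLevel {j : ℕ} {a : Matrix (Fin n) (Fin n) F} (ha : a ∈ upperLevel F n j)
    (k : ℕ) : a ^ k ∈ upperLevel F n (k * j) := by
  induction k with
  | zero => simpa using one_mem_upperLevel
  | succ k ih =>
    rw [pow_succ, add_mul, one_mul]
    exact mul_mem_upperLevel ih ha

theorem eq_zero_of_mem_upperLevel {a : Matrix (Fin n) (Fin n) F} (ha : a ∈ upperLevel F n n) :
    a = 0 := by
  ext i k
  exact ha i k (by omega)

variable [CharZero F]

/-- The polynomial `t ↦ t (t - 1) ⋯ (t - k + 1) / k!`. -/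
noncomputable def binomPoly (F : Type*) [Field F] (k : ℕ) : F[X] :=
  C (k.factorial : F)⁻¹ * descPochhammer F k

theorem binomPoly_eval_natCast (k m : ℕ) : (binomPoly F k).eval (m : F) = m.choose k := by
  rw [binomPoly, eval_mul, eval_C, descPochhammer_eval_eq_descFactorial,
    Nat.descFactorial_eq_factorial_mul_choose, Nat.cast_mul, inv_mul_cancel_left₀]
  exact_mod_cast k.factorial_ne_zero

/-- The power `g ^ t` of a unipotent matrix. -/
noncomputable def unipPow (g : Matrix (Fin n) (Fin n) F) (t : F) : Matrix (Fin n) (Fin n) F :=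
  ∑ k ∈ Finset.range (n + 2), (binomPoly F k).eval t • (g - 1) ^ k

theorem unipPow_natCast {g : Matrix (Fin n) (Fin n) F} (hg : g - 1 ∈ upperLevel F n 1) (m : ℕ) :
    unipPow g (m : F) = g ^ m := by
  have h0 : ∀ k, n ≤ k → (g - 1) ^ k = 0 := fun k hk =>
    eq_zero_of_mem_upperLevel (upperLevel_antitone (by omega) (pow_mem_upperLevel hg k))
  have h1 : g ^ m = ∑ k ∈ Finset.range (m + 1), ((m.choose k : ℕ) : F) • (g - 1) ^ k := by
    conv_lhs => rw [← sub_add_cancel g 1]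
    rw [(Commute.one_right _).add_pow]
    refine Finset.sum_congr rfl fun k _ => ?_
    rw [one_pow, mul_one, Nat.cast_smul_eq_nsmul, nsmul_eq_mul']
  rw [h1, unipPow]
  simp_rw [binomPoly_eval_natCast]
  refine (Finset.sum_subset (Finset.range_mono (le_max_left (n + 2) (m + 1)))
    fun k _ hk => ?_).trans (Finset.sum_subset (Finset.range_mono (le_max_right (n + 2) (m + 1)))
    fun k _ hk => ?_).symm
  · rw [h0 k (by simp at hk; omega), smul_zero]
  · rw [Nat.choose_eq_zero_of_lt (by simpa using hk), Nat.cast_zero, zero_smul]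

/-- A matrix-valued function with polynomial entries. -/
def IsPolyCurve (f : F → Matrix (Fin n) (Fin n) F) : Prop :=
  ∃ P : Matrix (Fin n) (Fin n) F[X], ∀ t, f t = P.map (eval t)

theorem IsPolyCurve.mul {f g : F → Matrix (Fin n) (Fin n) F} (hf : IsPolyCurve f)
    (hg : IsPolyCurve g) : IsPolyCurve fun t => f t * g t := by
  obtain ⟨P, hP⟩ := hf
  obtain ⟨Q, hQ⟩ := hg
  exact ⟨P * Q, fun t => by
    change f t * g t = _
    rw [hP, hQ]; exact (Matrix.map_mul (f := evalRingHom t)).symm⟩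

theorem IsPolyCurve.const (a : Matrix (Fin n) (Fin n) F) : IsPolyCurve fun _ : F => a :=
  ⟨a.map C, fun t => by ext; simp⟩

theorem isPolyCurve_unipPow (g : Matrix (Fin n) (Fin n) F) : IsPolyCurve (unipPow g) := by
  refine ⟨∑ k ∈ Finset.range (n + 2), binomPoly F k • ((g - 1) ^ k).map C, fun t => ?_⟩
  ext i j
  simp [unipPow, Matrix.sum_apply, eval_finsetSum]

theorem IsPolyCurve.comp_add {f : F → Matrix (Fin n) (Fin n) F} (hf : IsPolyCurve f) (s : F) :
    IsPolyCurve fun t => f (s + t) := by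
  obtain ⟨P, hP⟩ := hf
  exact ⟨P.map fun q => q.comp (C s + X), fun t => by ext; simp [hP]⟩

theorem IsPolyCurve.ext {f g : F → Matrix (Fin n) (Fin n) F} (hf : IsPolyCurve f)
    (hg : IsPolyCurve g) (h : ∀ m : ℕ, f m = g m) : f = g := by
  obtain ⟨P, hP⟩ := hf
  obtain ⟨Q, hQ⟩ := hg
  have hPQ : P = Q := by
    ext1 i j
    refine eq_of_infinite_eval_eq _ _ ((Set.infinite_range_of_injective
      (Nat.cast_injective (R := F))).mono ?_)
    rintro _ ⟨m, rfl⟩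
    have := congrFun (congrFun (h m) i) j
    rwa [hP, hQ] at this
  funext t
  rw [hP, hQ, hPQ]

/-- Both sides are polynomial in each variable and agree at natural numbers; density of `ℕ` is
applied first in `t`, then in `s`. -/
theorem unipPow_add {g : Matrix (Fin n) (Fin n) F} (hg : g - 1 ∈ upperLevel F n 1) (s t : F) :
    unipPow g (s + t) = unipPow g s * unipPow g t := by
  have h1 : ∀ (m : ℕ) (t : F), unipPow g (m + t) = unipPow g m * unipPow g t := fun m t => by
    refine congrFun (IsPolyCurve.ext ((isPolyCurve_unipPow g).comp_add (m : F))
      ((IsPolyCurve.const _).mul (isPolyCurve_unipPow g)) fun l => ?_) t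
    rw [← Nat.cast_add, unipPow_natCast hg, unipPow_natCast hg, unipPow_natCast hg, pow_add]
  rw [add_comm]
  refine congrFun (IsPolyCurve.ext ((isPolyCurve_unipPow g).comp_add t)
      ((isPolyCurve_unipPow g).mul (IsPolyCurve.const _)) fun l => ?_) s
  rw [add_comm, h1]

theorem unipPow_zero {g : Matrix (Fin n) (Fin n) F} (hg : g - 1 ∈ upperLevel F n 1) :
    unipPow g 0 = 1 := by
  simpa using unipPow_natCast hg 0

theorem unipPow_one {g : Matrix (Fin n) (Fin n) F} (hg : g - 1 ∈ upperLevel F n 1) :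
    unipPow g 1 = g := by
  simpa using unipPow_natCast hg 1

theorem unipPow_sub_one (g : Matrix (Fin n) (Fin n) F) {j : ℕ} (hj : 1 ≤ j)
    (hg : g - 1 ∈ upperLevel F n j) (t : F) :
    unipPow g t - 1 - t • (g - 1) ∈ upperLevel F n (j + 1) := by
  have h : unipPow g t - 1 - t • (g - 1) =
      ∑ k ∈ Finset.range n, (binomPoly F (k + 2)).eval t • (g - 1) ^ (k + 2) := by
    -- The summation range `n + 2` in `unipPow` lets the terms of degree `0` and `1` be split off
    -- for every `n`, even though terms of degree at least `n` vanish.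
    rw [unipPow, Finset.sum_range_succ', Finset.sum_range_succ']
    simp [binomPoly]
  rw [h]
  refine Submodule.sum_mem _ fun k _ => Submodule.smul_mem _ _
    (upperLevel_antitone ?_ (pow_mem_upperLevel hg _))
  nlinarith

theorem unipPow_sub_one_mem (g : Matrix (Fin n) (Fin n) F) {j : ℕ} (hj : 1 ≤ j)
    (hg : g - 1 ∈ upperLevel F n j) (t : F) : unipPow g t - 1 ∈ upperLevel F n j := by
  rw [← sub_add_cancel (unipPow g t - 1) (t • (g - 1))]
  exact Submodule.add_mem _ (upperLevel_antitone (Nat.le_succ j) (unipPow_sub_one g hj hg t))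
    (Submodule.smul_mem _ _ hg)

/-- The one-parameter subgroup through a unipotent matrix. -/
noncomputable def oneParam (g : GL (Fin n) F)
    (hg : (g : Matrix (Fin n) (Fin n) F) - 1 ∈ upperLevel F n 1) : AddChar F (GL (Fin n) F) where
  toFun t := ⟨unipPow g t, unipPow g (-t), by
      rw [← unipPow_add hg, add_neg_cancel, unipPow_zero hg], by
      rw [← unipPow_add hg, neg_add_cancel, unipPow_zero hg]⟩
  map_zero_eq_one' := Units.ext (unipPow_zero hg)
  map_add_eq_mul' s t := Units.ext (unipPow_add hg s t)

theorem oneParam_one (g : GL (Fin n) F)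
    (hg : (g : Matrix (Fin n) (Fin n) F) - 1 ∈ upperLevel F n 1) : oneParam g hg 1 = g :=
  Units.ext (unipPow_one hg)

/-- A group of unipotent upper triangular matrices closed under all powers `g ^ t`, `t ∈ F`. -/
structure IsPowClosed (G : Subgroup (GL (Fin n) F)) : Prop where
  sub_one_mem : ∀ g ∈ G, (g : Matrix (Fin n) (Fin n) F) - 1 ∈ upperLevel F n 1
  oneParam_mem : ∀ g (hg : g ∈ G) t, oneParam g (sub_one_mem g hg) t ∈ G

/-- The one-parameter subgroup of a power closed group through one of its elements. -/
noncomputable def IsPowClosed.oneParamHom {G : Subgroup (GL (Fin n) F)} (hG : IsPowClosed G)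
    (g : G) : AddChar F G where
  toFun t := ⟨oneParam (g : GL (Fin n) F) (hG.sub_one_mem (g : GL (Fin n) F) g.2) t,
    hG.oneParam_mem (g : GL (Fin n) F) g.2 t⟩
  map_zero_eq_one' := by
    apply Subtype.ext
    rw [Subgroup.coe_one]
    exact (oneParam (g : GL (Fin n) F) (hG.sub_one_mem g g.2)).map_zero_eq_one
  map_add_eq_mul' s t := by
    apply Subtype.ext
    rw [Subgroup.coe_mul]
    exact (oneParam (g : GL (Fin n) F) (hG.sub_one_mem g g.2)).map_add_eq_mul s t

/-- The associated graded pieces of a power closed group. -/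
def gradedPiece (G : Subgroup (GL (Fin n) F)) (j : ℕ) : Set (Matrix (Fin n) (Fin n) F) :=
  {a | ∃ g ∈ G, (g : Matrix (Fin n) (Fin n) F) - 1 ∈ upperLevel F n j ∧
    (g : Matrix (Fin n) (Fin n) F) - 1 - a ∈ upperLevel F n (j + 1)}

theorem gradedPiece_mono {G H : Subgroup (GL (Fin n) F)} (h : G ≤ H) (j : ℕ) :
    gradedPiece G j ⊆ gradedPiece H j := fun _ ⟨g, hg, hg'⟩ => ⟨g, h hg, hg'⟩

/-- Products of group elements add leading terms and powers `g ^ c` scale them, so a graded piece is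
already a subspace. -/
theorem IsPowClosed.mem_of_mem_span {G : Subgroup (GL (Fin n) F)} (hG : IsPowClosed G) {j : ℕ}
    (hj : 1 ≤ j) {a : Matrix (Fin n) (Fin n) F}
    (ha : a ∈ Submodule.span F (gradedPiece G j)) : a ∈ gradedPiece G j := by
  induction ha using Submodule.span_induction with
  | mem a ha => exact ha
  | zero => exact ⟨1, G.one_mem, by simp, by simp⟩
  | add a b _ _ ha hb =>
    obtain ⟨g, hg, hg1, hg2⟩ := ha
    obtain ⟨h, hh, hh1, hh2⟩ := hb
    have h3 := mul_mem_upperLevel hg1 hh1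
    have e : ((g * h : GL (Fin n) F) : Matrix (Fin n) (Fin n) F) - 1 =
        ((g : Matrix (Fin n) (Fin n) F) - 1) + ((h : Matrix (Fin n) (Fin n) F) - 1) +
          ((g : Matrix (Fin n) (Fin n) F) - 1) * ((h : Matrix (Fin n) (Fin n) F) - 1) := by
      rw [Units.val_mul]; noncomm_ring
    refine ⟨g * h, G.mul_mem hg hh, ?_, ?_⟩
    · rw [e]
      exact Submodule.add_mem _ (Submodule.add_mem _ hg1 hh1)
        (upperLevel_antitone (by omega) h3)
    · have e2 : ((g * h : GL (Fin n) F) : Matrix (Fin n) (Fin n) F) - 1 - (a + b) =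
          ((g : Matrix (Fin n) (Fin n) F) - 1 - a) + ((h : Matrix (Fin n) (Fin n) F) - 1 - b) +
          ((g : Matrix (Fin n) (Fin n) F) - 1) * ((h : Matrix (Fin n) (Fin n) F) - 1) := by
        rw [e]; abel
      rw [e2]
      exact Submodule.add_mem _ (Submodule.add_mem _ hg2 hh2)
        (upperLevel_antitone (by omega) h3)
  | smul c a _ ha =>
    obtain ⟨g, hg, hg1, hg2⟩ := ha
    refine ⟨oneParam g (hG.sub_one_mem g hg) c, hG.oneParam_mem g hg c,
      unipPow_sub_one_mem _ hj hg1 c, ?_⟩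
    have h1 := Submodule.add_mem _ (unipPow_sub_one _ hj hg1 c) (Submodule.smul_mem _ c hg2)
    convert h1 using 1
    change unipPow _ c - 1 - _ = _
    rw [smul_sub c ((g : Matrix (Fin n) (Fin n) F) - 1) a]
    abel

/-- The dimension of a power closed group. -/
noncomputable def unipRank (G : Subgroup (GL (Fin n) F)) : ℕ :=
  -- Leading terms are taken as matrices, not as classes, so each span also contains `upperLevel F n
  -- (j + 2)`. This adds a constant depending only on `n`, which is harmless since only strict
  -- monotonicity in the group is needed.
  ∑ j ∈ Finset.range n, Module.finrank F (Submodule.span F (gradedPiece G (j + 1)))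

/-- If all graded pieces agreed, an element of `G` could be corrected by elements of `H`, one level
at a time, until it becomes trivial; then `G ≤ H`. -/
theorem IsPowClosed.unipRank_lt {G H : Subgroup (GL (Fin n) F)} (hH : IsPowClosed H)
    (hG : IsPowClosed G) (h : H < G) : unipRank H < unipRank G := by
  have hle : ∀ j, Submodule.span F (gradedPiece H j) ≤ Submodule.span F (gradedPiece G j) :=
    fun j => Submodule.span_mono (gradedPiece_mono h.le j)
  refine Finset.sum_lt_sum (fun j _ => Submodule.finrank_mono (hle _)) ?_
  by_contra! hcon
  have heq : ∀ j < n, Submodule.span F (gradedPiece G (j + 1)) =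
      Submodule.span F (gradedPiece H (j + 1)) := fun j hj =>
    (Submodule.eq_of_le_of_finrank_le (hle _) (hcon j (Finset.mem_range.mpr hj))).symm
  refine h.not_ge ?_
  have key : ∀ d j, n ≤ j + d → 1 ≤ j → ∀ g ∈ G,
      (g : Matrix (Fin n) (Fin n) F) - 1 ∈ upperLevel F n j → g ∈ H := by
    intro d
    induction d with
    | zero =>
      intro j hj _ g _ hg
      have h1 := eq_zero_of_mem_upperLevel (upperLevel_antitone hj hg)
      rw [show g = 1 from Units.ext (sub_eq_zero.mp h1)]
      exact H.one_mem
    | succ d ih =>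
      intro j hj hj1 g hg hg1
      rcases Nat.lt_or_ge n j with hnj | hnj
      · exact ih j (by omega) hj1 g hg hg1
      have hmem : (g : Matrix (Fin n) (Fin n) F) - 1 ∈ Submodule.span F (gradedPiece G j) :=
        Submodule.subset_span ⟨g, hg, hg1, by simp⟩
      have h2 := heq (j - 1) (by omega)
      rw [Nat.sub_add_cancel hj1] at h2
      rw [h2] at hmem
      obtain ⟨k, hk, hk1, hk2⟩ := hH.mem_of_mem_span hj1 hmem
      have h3 : k⁻¹ * g ∈ H := by
        refine ih (j + 1) (by omega) (by omega) _ (G.mul_mem (G.inv_mem (h.le hk)) hg) ?_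
        have e : ((k⁻¹ * g : GL (Fin n) F) : Matrix (Fin n) (Fin n) F) - 1 =
            -(((k⁻¹ : GL (Fin n) F) : Matrix (Fin n) (Fin n) F) *
              ((k : Matrix (Fin n) (Fin n) F) - 1 - ((g : Matrix (Fin n) (Fin n) F) - 1))) := by
          rw [sub_sub_sub_cancel_right, mul_sub, Units.inv_mul, Units.val_mul, neg_sub]
        rw [e, ← zero_add (j + 1)]
        refine Submodule.neg_mem _ (mul_mem_upperLevel ?_ hk2)
        rw [← sub_add_cancel ((k⁻¹ : GL (Fin n) F) : Matrix (Fin n) (Fin n) F) 1]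
        exact Submodule.add_mem _ (upperLevel_antitone (Nat.zero_le 1)
          (hH.sub_one_mem _ (H.inv_mem hk))) one_mem_upperLevel
      have := H.mul_mem hk h3
      rwa [mul_inv_cancel_left] at this
  exact fun g hg => key n 1 (by omega) le_rfl g hg (hG.sub_one_mem g hg)

/-- This follows from `g y g⁻¹ y⁻¹ - 1 = ((g - 1)(y - 1) - (y - 1)(g - 1)) g⁻¹ y⁻¹`. -/
theorem commutator_sub_one_mem {G : Subgroup (GL (Fin n) F)} (hG : IsPowClosed G)
    {g y : GL (Fin n) F} (hg : g ∈ G) (hy : y ∈ G) {j : ℕ}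
    (hyj : (y : Matrix (Fin n) (Fin n) F) - 1 ∈ upperLevel F n j) :
    ((g * y * g⁻¹ * y⁻¹ : GL (Fin n) F) : Matrix (Fin n) (Fin n) F) - 1 ∈
      upperLevel F n (j + 1) := by
  have e : ((g * y * g⁻¹ * y⁻¹ : GL (Fin n) F) : Matrix (Fin n) (Fin n) F) - 1 =
      (((g : Matrix (Fin n) (Fin n) F) - 1) * ((y : Matrix (Fin n) (Fin n) F) - 1) -
        ((y : Matrix (Fin n) (Fin n) F) - 1) * ((g : Matrix (Fin n) (Fin n) F) - 1)) *
        ((g⁻¹ * y⁻¹ : GL (Fin n) F) : Matrix (Fin n) (Fin n) F) := by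
    have e1 : (((g : Matrix (Fin n) (Fin n) F) - 1) * ((y : Matrix (Fin n) (Fin n) F) - 1) -
        ((y : Matrix (Fin n) (Fin n) F) - 1) * ((g : Matrix (Fin n) (Fin n) F) - 1)) =
        ((g * y : GL (Fin n) F) : Matrix (Fin n) (Fin n) F) -
          ((y * g : GL (Fin n) F) : Matrix (Fin n) (Fin n) F) := by
      rw [Units.val_mul, Units.val_mul]; noncomm_ring
    rw [e1, sub_mul, ← Units.val_mul, ← Units.val_mul, ← Units.val_one]
    congr 2
    · simp only [mul_assoc]
    · group
  have h0 : ∀ h ∈ G, (h : Matrix (Fin n) (Fin n) F) ∈ upperLevel F n 0 := fun h hh => by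
    rw [← sub_add_cancel (h : Matrix (Fin n) (Fin n) F) 1]
    exact Submodule.add_mem _ (upperLevel_antitone (Nat.zero_le 1) (hG.sub_one_mem _ hh))
      one_mem_upperLevel
  rw [e]
  refine mul_mem_upperLevel (i := j + 1) (j := 0) (Submodule.sub_mem _ ?_
    (mul_mem_upperLevel hyj (hG.sub_one_mem g hg)))
    (h0 _ (G.mul_mem (G.inv_mem hg) (G.inv_mem hy)))
  rw [add_comm]
  exact mul_mem_upperLevel (hG.sub_one_mem g hg) hyj

end UnipotentPowers

/-! ### Powers in unipotent algebraic groups over `ℚ_p`. -/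

section PadicPowers

open Matrix Filter Topology

variable {p : ℕ} [Fact p.Prime] {n : ℕ}

theorem continuous_unipPow (g : Matrix (Fin n) (Fin n) ℚ_[p]) : Continuous (unipPow g) := by
  unfold unipPow
  exact continuous_finsetSum _ fun k _ => (Polynomial.continuous _).smul continuous_const

theorem continuous_oneParam (g : GL (Fin n) ℚ_[p])
    (hg : (g : Matrix (Fin n) (Fin n) ℚ_[p]) - 1 ∈ upperLevel ℚ_[p] n 1) :
    Continuous (oneParam g hg) := by
  rw [Units.continuous_iff]
  exact ⟨continuous_unipPow _, (continuous_unipPow _).comp continuous_neg⟩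

theorem IsPowClosed.continuous_oneParamHom {G : Subgroup (GL (Fin n) ℚ_[p])}
    (hG : IsPowClosed G) (g : G) : Continuous (hG.oneParamHom g) :=
  (continuous_oneParam (g : GL (Fin n) ℚ_[p]) (hG.sub_one_mem g g.2)).subtype_mk _

/-- Along `t ↦ g ^ t` each defining equation becomes a polynomial in `t` that vanishes at every
natural number, hence identically. -/
theorem IsUnipotentAlgebraic.isPowClosed {N : Subgroup (GL (Fin n) ℚ_[p])}
    (hN : IsUnipotentAlgebraic N) : IsPowClosed N where
  sub_one_mem g hg i k h := by
    rw [Matrix.sub_apply, hN.unitriangular g hg i k (by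
      rw [Fin.le_def]; omega), Matrix.one_apply, sub_self]
  oneParam_mem g hg t := by
    obtain ⟨S, hS⟩ := hN.zariskiClosed
    rw [hS]
    intro f hf
    obtain ⟨P, hP⟩ := isPolyCurve_unipPow (g : Matrix (Fin n) (Fin n) ℚ_[p])
    let q : Polynomial ℚ_[p] := MvPolynomial.aeval (fun ij : Fin n × Fin n => P ij.1 ij.2) f
    have hq : ∀ t, q.eval t = MvPolynomial.eval
        (fun ij : Fin n × Fin n => unipPow (g : Matrix (Fin n) (Fin n) ℚ_[p]) t ij.1 ij.2) f := by
      intro t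
      have h1 := MvPolynomial.map_aeval (fun ij : Fin n × Fin n => P ij.1 ij.2)
        (Polynomial.evalRingHom t) f
      refine h1.trans ?_
      have h2 : (Polynomial.evalRingHom t).comp (algebraMap ℚ_[p] (Polynomial ℚ_[p])) =
          RingHom.id _ := by ext; simp
      rw [h2, hP]
      rfl
    have hq0 : q = 0 := by
      refine Polynomial.eq_of_infinite_eval_eq _ _ ((Set.infinite_range_of_injective
        (Nat.cast_injective (R := ℚ_[p]))).mono ?_)
      rintro _ ⟨m, rfl⟩
      have h3 := (hS (g ^ m)).mp (N.pow_mem hg m) f hf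
      rw [Set.mem_ofPred_eq, hq, unipPow_natCast, Polynomial.eval_zero, ← Units.val_pow_eq_pow_val]
      · exact h3
      · exact fun i k h => by
          rw [Matrix.sub_apply, hN.unitriangular g hg i k (by
            rw [Fin.le_def]; omega), Matrix.one_apply, sub_self]
    have := hq t
    rw [hq0, Polynomial.eval_zero] at this
    exact this.symm

end PadicPowers

/-! ### Admissibility of irreducible smooth representations -/

section Admissibility

open Filter Topology

variable {p : ℕ} [Fact p.Prime]

/-- Schur's lemma for an element of a one-parameter subgroup. -/
theorem Representation.exists_eq_smul_of_commute {G V : Type*} [Group G] [TopologicalSpace G]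
    [IsTopologicalGroup G] [AddCommGroup V] [Module ℂ V] {ρ : Representation ℂ G V}
    (hi : ρ.IsIrreducible) (hs : ρ.IsSmooth) (y : AddChar ℚ_[p] G) (hy : Continuous y)
    (hc : ∀ g v, ρ g (ρ (y 1) v) = ρ (y 1) (ρ g v)) : ∃ c : ℂ, ∀ v, ρ (y 1) v = c • v := by
  rw [Representation.isIrreducible_iff] at hi
  obtain ⟨hV, hi⟩ := hi
  have hfin : ∀ u, ∃ M : ℕ, 0 < M ∧ (ρ (y 1) ^ M) u = u := fun u => by
    have h : Tendsto (fun k : ℕ => (p : ℚ_[p]) ^ k) atTop (𝓝 0) :=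
      tendsto_pow_atTop_nhds_zero_of_norm_lt_one Padic.norm_p_lt_one
    obtain ⟨k, hk⟩ := (h.eventually ((hy.tendsto 0).eventually (hs.eventually_eq u _))).exists
    refine ⟨p ^ k, pow_pos (Fact.out : p.Prime).pos _, ?_⟩
    rw [← map_pow, ← AddChar.map_nsmul_eq_pow, nsmul_eq_mul, mul_one, Nat.cast_pow, hk,
      AddChar.map_zero_eq_one, map_one, Module.End.one_apply]
  obtain ⟨v, hv⟩ := exists_ne (0 : V)
  obtain ⟨M, hM, hMv⟩ := hfin v
  -- Local finiteness of the order replaces any bound on the dimension of `V`: it produces `ζ` for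
  -- which `ρ (y 1) - ζ` is not surjective. The range of this operator is stable under `G`, so it is
  -- zero.
  have h1 : ∃ ζ : ℂ, ¬ ∃ u, ρ (y 1) u - ζ • u = v := by
    by_contra! h
    exact hv (Module.End.eq_zero_of_forall_mem_range (ρ (y 1)) hfin hM hMv fun ζ _ => h ζ)
  obtain ⟨ζ, hζ⟩ := h1
  refine ⟨ζ, ?_⟩
  rcases hi (LinearMap.range (ρ (y 1) - ζ • LinearMap.id)) (by
    rintro g _ ⟨u, rfl⟩
    exact ⟨ρ g u, by simp [hc]⟩) with h | h
  · intro u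
    have := LinearMap.congr_fun (LinearMap.range_eq_bot.mp h) u
    simpa [sub_eq_zero] using this
  · obtain ⟨u, hu⟩ := (show v ∈ LinearMap.range (ρ (y 1) - ζ • LinearMap.id) by rw [h]; trivial)
    exact absurd ⟨u, by simpa using hu⟩ hζ

/-- The commutator pairing of a group with a one-parameter subgroup, when the commutators act by
scalars. -/
theorem Representation.exists_commutator_pairing {G V : Type*} [Group G] [AddCommGroup V]
    [Module ℂ V] [Nontrivial V] {ρ : Representation ℂ G V} (y : AddChar ℚ_[p] G)
    (h : ∀ g t, ∃ c : ℂ, ∀ v, ρ (g * y t * g⁻¹ * (y t)⁻¹) v = c • v) :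
    ∃ b : G → AddChar ℚ_[p] ℂ, ∀ g t v, ρ g (ρ (y t) v) = b g t • ρ (y t) (ρ g v) := by
  choose c hc using h
  have comm : ∀ g t v, ρ g (ρ (y t) v) = c g t • ρ (y t) (ρ g v) := fun g t v => by
    rw [← hc, ← ρ.map_mul_apply, ← ρ.map_mul_apply, ← ρ.map_mul_apply]
    congr 2
    group
  obtain ⟨v, hv⟩ := exists_ne (0 : V)
  have hne : ∀ g, ρ g v ≠ 0 := fun g h0 => hv (by rw [← ρ.apply_inv_self_apply g v, h0, map_zero])
  refine ⟨fun g => ⟨c g, ?_, fun s t => ?_⟩, comm⟩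
  · have h1 := comm g 0 v
    rw [y.map_zero_eq_one, map_one, Module.End.one_apply, Module.End.one_apply] at h1
    exact (smul_left_injective ℂ (hne g) (show (1 : ℂ) • _ = _ by rw [one_smul]; exact h1)).symm
  · have h1 := comm g (s + t) v
    rw [y.map_add_eq_mul, ρ.map_mul_apply, comm, comm, map_smul, smul_smul, ρ.map_mul_apply (y s),
      ← ρ.map_mul_apply (y t), ← ρ.map_mul_apply (y s)] at h1
    exact (smul_left_injective ℂ (hne _) h1).symm

/-- For fixed `t` both sides are smooth characters of `s`, so it is enough to take `s = p ^ (-r)`.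
With `t = p ^ r u`, the factor `p ^ r` moves from the second argument to the first, where it turns
`x(p ^ (-r))` into `x(1)`. -/
theorem Representation.pairing_oneParam {G V : Type*} [Group G] [TopologicalSpace G]
    [IsTopologicalGroup G] [AddCommGroup V] [Module ℂ V] [Nontrivial V] {ρ : Representation ℂ G V}
    (hs : ρ.IsSmooth) (y : AddChar ℚ_[p] G) (hy : Continuous y) (b : G → AddChar ℚ_[p] ℂ)
    (comm : ∀ g t v, ρ g (ρ (y t) v) = b g t • ρ (y t) (ρ g v))
    (x : AddChar ℚ_[p] G) (hx : Continuous x) (s t : ℚ_[p]) : b (x s) t = b (x 1) (s * t) := by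
  obtain ⟨v, hv⟩ := exists_ne (0 : V)
  have hne : ∀ g, ρ g v ≠ 0 := fun g h0 => hv (by rw [← ρ.apply_inv_self_apply g v, h0, map_zero])
  have hmul : ∀ g h t, b (g * h) t = b g t * b h t := fun g h t => by
    have h1 := comm (g * h) t v
    rw [ρ.map_mul_apply, comm h, map_smul, comm g, smul_smul, ← ρ.map_mul_apply g h,
      ← ρ.map_mul_apply (y t)] at h1
    rw [mul_comm (b g t)]
    exact (smul_left_injective ℂ (hne _) h1).symm
  have hone : ∀ t, b 1 t = 1 := fun t => by
    have h1 := hmul 1 1 t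
    rw [one_mul] at h1
    exact (mul_eq_left₀ ((b 1).val_isUnit t).ne_zero).mp h1.symm
  have hy0 : ∀ u : V, ρ (y 0) u = u := fun u => by
    rw [y.map_zero_eq_one, map_one, Module.End.one_apply]
  have hx0 : ∀ u : V, ρ (x 0) u = u := fun u => by
    rw [x.map_zero_eq_one, map_one, Module.End.one_apply]
  have hb : (b (x 1)).IsSmooth := by
    filter_upwards [(hy.tendsto 0).eventually (hs.eventually_eq v _),
      (hy.tendsto 0).eventually (hs.eventually_eq (ρ (x 1) v) _)] with t h1 h2
    have h3 := comm (x 1) t v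
    rw [h1, h2, hy0, hy0] at h3
    exact (smul_left_injective ℂ (hne _) (show (1 : ℂ) • _ = _ by rw [one_smul]; exact h3)).symm
  let η : AddChar ℚ_[p] ℂ :=
    { toFun := fun s => b (x s) t
      map_zero_eq_one' := by rw [x.map_zero_eq_one, hone]
      map_add_eq_mul' := fun s s' => by rw [x.map_add_eq_mul, hmul] }
  have hη : η.IsSmooth := by
    filter_upwards [(hx.tendsto 0).eventually (hs.eventually_eq v _),
      (hx.tendsto 0).eventually (hs.eventually_eq (ρ (y t) v) _)] with s h1 h2
    have h3 := comm (x s) t v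
    rw [h1, h2, hx0, hx0] at h3
    exact (smul_left_injective ℂ (hne _) (show (1 : ℂ) • _ = _ by rw [one_smul]; exact h3)).symm
  let θ : AddChar ℚ_[p] ℂ :=
    { toFun := fun s => b (x 1) (s * t)
      map_zero_eq_one' := by simp
      map_add_eq_mul' := fun s s' => by rw [add_mul, AddChar.map_add_eq_mul] }
  have hθ : θ.IsSmooth := by
    have : Tendsto (fun s => s * t) (𝓝 (0 : ℚ_[p])) (𝓝 0) := by
      simpa using (continuous_mul_const t).tendsto 0
    exact this.eventually hb
  refine hη.ext hθ (fun r => ?_) s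
  change b (x _) t = b (x 1) (_ * t)
  set u := (p : ℚ_[p]) ^ (-(r : ℤ)) * t with hu
  have hp0 : (p : ℚ_[p]) ^ r ≠ 0 := pow_ne_zero _ Padic.prime_cast_ne_zero
  have ht : t = ((p ^ r : ℕ) : ℚ_[p]) * u := by
    rw [hu, Nat.cast_pow, zpow_neg, zpow_natCast, mul_inv_cancel_left₀ hp0]
  have hpow : ∀ (m : ℕ) (g : G), b (g ^ m) u = b g u ^ m := fun m g => by
    induction m with
    | zero => rw [pow_zero, pow_zero, hone]
    | succ m ih => rw [pow_succ, hmul, ih, pow_succ]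
  conv_lhs => rw [ht]
  rw [AddChar.map_natCast_mul, ← hpow, ← AddChar.map_nsmul_eq_pow, nsmul_eq_mul, Nat.cast_pow,
    zpow_neg, zpow_natCast, mul_inv_cancel₀ hp0]

/-- Irreducible smooth representations of unipotent `p`-adic groups are admissible. -/
theorem IsPowClosed.isAdmissible {n : ℕ} (r : ℕ) : ∀ (G : Subgroup (GL (Fin n) ℚ_[p])),
    IsPowClosed G → unipRank G = r → ∀ (V : Type) [AddCommGroup V] [Module ℂ V]
    (ρ : Representation ℂ G V), ρ.IsIrreducible → ρ.IsSmooth → ρ.IsAdmissible := by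
  induction r using Nat.strong_induction_on with
  | _ r ih =>
  intro G hG hr V _ _ ρ hi hs
  have hi' := hi
  rw [Representation.isIrreducible_iff] at hi'
  obtain ⟨hV, hirr⟩ := hi'
  by_cases hsc : ∀ g : G, ((g : GL (Fin n) ℚ_[p]) : Matrix (Fin n) (Fin n) ℚ_[p]) - 1 ∈
      upperLevel ℚ_[p] n 1 → ∃ c : ℂ, ∀ v, ρ g v = c • v
  · obtain ⟨v, hv⟩ := exists_ne (0 : V)
    have h : Submodule.span ℂ {v} = ⊤ := by
      refine (hirr _ fun g w hw => ?_).resolve_left fun h => hv (by simpa using h)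
      obtain ⟨c, hc⟩ := hsc g (hG.sub_one_mem _ g.2)
      rw [hc]
      exact Submodule.smul_mem _ _ hw
    have : FiniteDimensional ℂ V := ⟨⟨{v}, by simpa using h⟩⟩
    exact fun K _ => inferInstance
  have hex : ∃ j, ∀ g : G, ((g : GL (Fin n) ℚ_[p]) : Matrix (Fin n) (Fin n) ℚ_[p]) - 1 ∈
      upperLevel ℚ_[p] n j → ∃ c : ℂ, ∀ v, ρ g v = c • v := by
    refine ⟨n, fun g hg => ⟨1, fun v => ?_⟩⟩
    have h1 : g = 1 := Subtype.ext (Units.ext (sub_eq_zero.mp (eq_zero_of_mem_upperLevel hg)))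
    rw [h1, map_one, Module.End.one_apply, one_smul]
  classical
  -- Take the deepest level containing an element `y₀` that is not scalar. Commutators with its
  -- one-parameter subgroup lie one level deeper, so they are scalar.
  obtain ⟨j, hj1, hj2, hj3⟩ : ∃ j, 1 ≤ j ∧
      (∀ g : G, ((g : GL (Fin n) ℚ_[p]) : Matrix (Fin n) (Fin n) ℚ_[p]) - 1 ∈
        upperLevel ℚ_[p] n (j + 1) → ∃ c : ℂ, ∀ v, ρ g v = c • v) ∧
      ¬ (∀ g : G, ((g : GL (Fin n) ℚ_[p]) : Matrix (Fin n) (Fin n) ℚ_[p]) - 1 ∈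
        upperLevel ℚ_[p] n j → ∃ c : ℂ, ∀ v, ρ g v = c • v) := by
    have h2 : 1 < Nat.find hex := by
      by_contra! h
      exact hsc fun g hg => Nat.find_spec hex g (upperLevel_antitone h hg)
    refine ⟨Nat.find hex - 1, by omega, ?_, Nat.find_min hex (by omega)⟩
    rw [Nat.sub_add_cancel h2.le]
    exact Nat.find_spec hex
  push Not at hj3
  obtain ⟨y₀, hy₀, hy₀'⟩ := hj3
  let opar : G → AddChar ℚ_[p] G := hG.oneParamHom
  have hopar : ∀ g, Continuous (opar g) := hG.continuous_oneParamHom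
  have hopar1 : ∀ g, opar g 1 = g := fun g => Subtype.ext (oneParam_one _ _)
  let y := opar y₀
  obtain ⟨b, hb⟩ := Representation.exists_commutator_pairing (ρ := ρ) y fun g t =>
    hj2 _ (commutator_sub_one_mem hG g.2 (y t).2 (unipPow_sub_one_mem _ hj1 hy₀ t))
  have hbx : ∀ g s t, b (opar g s) t = b g (s * t) := fun g s t => by
    rw [Representation.pairing_oneParam hs y (hopar _) b hb _ (hopar g), hopar1]
  -- If the pairing were trivial, `y₀` would commute with the whole action and be scalar by Schur's
  -- lemma.
  obtain ⟨x₀, t₀, hxt⟩ : ∃ x₀ t₀, b x₀ t₀ ≠ 1 := by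
    by_contra! h
    obtain ⟨c, hc⟩ := Representation.exists_eq_smul_of_commute hi hs y (hopar _) fun g v => by
      rw [hb, h, one_smul]
    obtain ⟨v, hv⟩ := hy₀' c
    rw [hopar1] at hc
    exact hv (hc v)
  have hsm : (b x₀).IsSmooth := by
    obtain ⟨v, hv⟩ := exists_ne (0 : V)
    have h0 : ρ x₀ v ≠ 0 := fun h0 => hv (by rw [← ρ.apply_inv_self_apply x₀ v, h0, map_zero])
    filter_upwards [((hopar y₀).tendsto 0).eventually (hs.eventually_eq v _),
      ((hopar y₀).tendsto 0).eventually (hs.eventually_eq (ρ x₀ v) _)] with t h1 h2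
    have h3 := hb x₀ t v
    rw [h1, h2, (opar y₀).map_zero_eq_one, map_one, Module.End.one_apply,
      Module.End.one_apply] at h3
    exact (smul_left_injective ℂ h0 (show (1 : ℂ) • _ = _ by rw [one_smul]; exact h3)).symm
  obtain ⟨c, hc0, hc⟩ := hsm.exists_normalized ⟨t₀, hxt⟩
  -- Reparametrizing `y` by `c` rescales every `b g` in the same way and makes `b x₀` normalized.
  let scale : ∀ {M : Type} [Monoid M], AddChar ℚ_[p] M → AddChar ℚ_[p] M := fun {M} _ η =>
    { toFun := fun t => η (c * t)
      map_zero_eq_one' := by rw [mul_zero, η.map_zero_eq_one]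
      map_add_eq_mul' := fun s t => by rw [mul_add, η.map_add_eq_mul] }
  let D : HeisenbergPair p ρ :=
    { x := opar x₀
      y := scale y
      continuous_x := hopar x₀
      continuous_y := (hopar y₀).comp (continuous_const_mul c)
      χ := scale (b x₀)
      normalized := hc
      b := fun g => scale (b g)
      comm := fun g t v => hb g (c * t) v
      b_x := fun s t => by
        change b (opar x₀ s) (c * t) = b x₀ (c * (s * t))
        rw [hbx]
        congr 1
        ring }
  have hD : ∀ g, (∀ t, D.b g t = 1) ↔ ∀ t, b g t = 1 := fun g =>
    ⟨fun h t => by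
      have := h (c⁻¹ * t)
      change b g (c * (c⁻¹ * t)) = 1 at this
      rwa [mul_inv_cancel_left₀ hc0] at this, fun h t => h (c * t)⟩
  -- The kernel of the pairing with `y`. It is power closed because `b (g ^ s) t = b g (s t)`, and
  -- it is proper because it misses `x₀`; the induction hypothesis applies to it.
  let N' : Subgroup G :=
    { carrier := {g | ∀ t, b g t = 1}
      one_mem' := (hD 1).mp fun t => by
        have h1 := D.b_mul 1 1 t
        rw [one_mul] at h1
        exact (mul_eq_left₀ ((D.b 1).val_isUnit t).ne_zero).mp h1.symm
      mul_mem' := fun {g h} hg hh => (hD _).mp fun t => by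
        rw [D.b_mul, (hD g).mpr hg, (hD h).mpr hh, one_mul]
      inv_mem' := fun {g} hg => (hD _).mp fun t => by
        have h0 := D.b_mul g g⁻¹ t
        have h1 := D.b_mul 1 1 t
        rw [one_mul] at h1
        rwa [mul_inv_cancel, (mul_eq_left₀ ((D.b 1).val_isUnit t).ne_zero).mp h1.symm,
          (hD g).mpr hg, one_mul, eq_comm] at h0 }
  let N₀ : Subgroup (GL (Fin n) ℚ_[p]) := N'.map G.subtype
  have hN₀G : N₀ ≤ G := by
    rintro _ ⟨g, -, rfl⟩
    exact g.2
  have hN₀ : IsPowClosed N₀ :=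
    { sub_one_mem := fun g hg => hG.sub_one_mem g (hN₀G hg)
      oneParam_mem := by
        rintro _ ⟨g, hg, rfl⟩ s
        refine ⟨opar g s, fun t => ?_, rfl⟩
        rw [hbx]
        exact hg _ }
  have hlt : N₀ < G := by
    refine lt_of_le_of_ne hN₀G fun h => hxt ?_
    have h1 : (x₀ : GL (Fin n) ℚ_[p]) ∈ N₀ := by rw [h]; exact x₀.2
    obtain ⟨g, hg, hgx⟩ := h1
    rw [← Subtype.ext hgx]
    exact hg t₀
  let φ : N₀ →* G := Subgroup.inclusion hN₀G
  have hφ : ∀ m t, D.b (φ m) t = 1 := by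
    rintro ⟨_, g, hg, rfl⟩
    exact (hD _).mpr hg
  have hφc : Continuous φ := continuous_subtype_val.subtype_mk _
  refine D.isAdmissible_of_coinvariants φ hφ hs hφc ?_
  refine ih _ (hr ▸ hN₀.unipRank_lt hG hlt) N₀ hN₀ rfl _ _
    (D.coinvariants_isIrreducible φ hφ hs hi fun g hg => ?_) (D.coinvariants_isSmooth φ hφ hs hφc)
  exact ⟨⟨g, g, (hD g).mp hg, rfl⟩, rfl⟩

end Admissibility

/-! ### Locally elliptic totally disconnected groups -/

/-- A group that is an increasing union of compact open subgroups, with arbitrarily small compact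
open subgroups. -/
structure IsLocallyElliptic (G : Type*) [Group G] [TopologicalSpace G] : Prop where
  exhaust : ∃ K : ℕ → Subgroup G, Monotone K ∧ (∀ m, IsOpen (K m : Set G)) ∧
    (∀ m, IsCompact (K m : Set G)) ∧ ∀ g, ∃ m, g ∈ K m
  small : ∀ U ∈ nhds (1 : G), ∃ K : Subgroup G, IsOpen (K : Set G) ∧ IsCompact (K : Set G) ∧
    (K : Set G) ⊆ U

section

open Topology Matrix

theorem Units.isClosedEmbedding_embedProduct_of_t1 (M : Type*) [Monoid M] [TopologicalSpace M]
    [ContinuousMul M] [T1Space M] : IsClosedEmbedding (Units.embedProduct M) := by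
  refine ⟨Units.isEmbedding_embedProduct, ?_⟩
  have h : Set.range (Units.embedProduct M) =
      (fun x : M × Mᵐᵒᵖ => x.1 * x.2.unop) ⁻¹' {1} ∩
        (fun x : M × Mᵐᵒᵖ => x.2.unop * x.1) ⁻¹' {1} := by
    ext ⟨a, b⟩
    constructor
    · rintro ⟨u, hu⟩
      rw [← hu]
      simp
    · rintro ⟨h1, h2⟩
      exact ⟨⟨a, b.unop, h1, h2⟩, rfl⟩
  rw [h]
  exact (isClosed_singleton.preimage (by fun_prop)).inter (isClosed_singleton.preimage (by fun_prop))

theorem TotallyDisconnectedSpace.of_injective {X Y : Type*} [TopologicalSpace X]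
    [TopologicalSpace Y] [TotallyDisconnectedSpace Y] {f : X → Y} (hf : Continuous f)
    (hi : Function.Injective f) : TotallyDisconnectedSpace X := by
  refine ⟨fun t _ ht x hx y hy => hi ?_⟩
  exact (ht.image f hf.continuousOn).subsingleton (Set.mem_image_of_mem f hx)
    (Set.mem_image_of_mem f hy)

variable {p : ℕ} [Fact p.Prime] {n : ℕ}

/-- The invertible matrices `g` such that the entries of `g` and `g⁻¹` at `(i, j)` have norm at
most `p ^ (m (j - i))`. -/
def ballSubgroup (p : ℕ) [Fact p.Prime] (n m : ℕ) : Subgroup (GL (Fin n) ℚ_[p]) where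
  carrier := {g | (∀ i j : Fin n, ‖(g : Matrix (Fin n) (Fin n) ℚ_[p]) i j‖ ≤
      (p : ℝ) ^ ((m : ℤ) * ((j : ℤ) - (i : ℤ)))) ∧
    ∀ i j : Fin n, ‖((g⁻¹ : GL (Fin n) ℚ_[p]) : Matrix (Fin n) (Fin n) ℚ_[p]) i j‖ ≤
      (p : ℝ) ^ ((m : ℤ) * ((j : ℤ) - (i : ℤ)))}
  mul_mem' := by
    have hp : (0 : ℝ) < p := zero_lt_one.trans Padic.one_lt_prime_cast
    have key : ∀ a b : Matrix (Fin n) (Fin n) ℚ_[p],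
        (∀ i j : Fin n, ‖a i j‖ ≤ (p : ℝ) ^ ((m : ℤ) * ((j : ℤ) - (i : ℤ)))) →
        (∀ i j : Fin n, ‖b i j‖ ≤ (p : ℝ) ^ ((m : ℤ) * ((j : ℤ) - (i : ℤ)))) →
        ∀ i j : Fin n, ‖(a * b) i j‖ ≤ (p : ℝ) ^ ((m : ℤ) * ((j : ℤ) - (i : ℤ))) := by
      intro a b ha hb i j
      rw [Matrix.mul_apply]
      refine IsUltrametricDist.norm_sum_le_of_forall_le_of_nonneg (zpow_pos hp _).le fun k _ => ?_
      rw [norm_mul]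
      refine (mul_le_mul (ha i k) (hb k j) (norm_nonneg _) (zpow_pos hp _).le).trans ?_
      rw [← zpow_add₀ hp.ne']
      apply le_of_eq; congr 1; ring
    rintro g h ⟨hg, hg'⟩ ⟨hh, hh'⟩
    refine ⟨fun i j => ?_, fun i j => ?_⟩
    · rw [Units.val_mul]; exact key _ _ hg hh i j
    · rw [_root_.mul_inv_rev, Units.val_mul]; exact key _ _ hh' hg' i j
  one_mem' := by
    have hp : (0 : ℝ) < p := zero_lt_one.trans Padic.one_lt_prime_cast
    have key : ∀ i j : Fin n, ‖(1 : Matrix (Fin n) (Fin n) ℚ_[p]) i j‖ ≤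
        (p : ℝ) ^ ((m : ℤ) * ((j : ℤ) - (i : ℤ))) := fun i j => by
      by_cases h : i = j
      · subst h; simp
      · rw [Matrix.one_apply_ne h, norm_zero]; exact (zpow_pos hp _).le
    refine ⟨key, ?_⟩
    rw [inv_one]
    exact key
  inv_mem' := by
    rintro g ⟨hg, hg'⟩
    exact ⟨hg', by rwa [inv_inv]⟩

theorem isOpen_ballSubgroup (m : ℕ) : IsOpen (ballSubgroup p n m : Set (GL (Fin n) ℚ_[p])) := by
  have hp : (0 : ℝ) < p := zero_lt_one.trans Padic.one_lt_prime_cast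
  have key : IsOpen {a : Matrix (Fin n) (Fin n) ℚ_[p] | ∀ i j : Fin n, ‖a i j‖ ≤
      (p : ℝ) ^ ((m : ℤ) * ((j : ℤ) - (i : ℤ)))} := by
    simp only [Set.ofPred_forall]
    refine isOpen_iInter_of_finite fun i => isOpen_iInter_of_finite fun j => ?_
    have h1 := IsUltrametricDist.isOpen_closedBall (0 : ℚ_[p])
      (zpow_pos hp ((m : ℤ) * ((j : ℤ) - (i : ℤ)))).ne'
    convert h1.preimage (f := fun a : Matrix (Fin n) (Fin n) ℚ_[p] => a i j) (by fun_prop) using 1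
    ext a
    simp
  exact (key.preimage Units.continuous_val).inter (key.preimage
    (Units.continuous_val.comp continuous_inv))

theorem isCompact_ballSubgroup (m : ℕ) :
    IsCompact (ballSubgroup p n m : Set (GL (Fin n) ℚ_[p])) := by
  have key : IsCompact {a : Matrix (Fin n) (Fin n) ℚ_[p] | ∀ i j : Fin n, ‖a i j‖ ≤
      (p : ℝ) ^ ((m : ℤ) * ((j : ℤ) - (i : ℤ)))} := by
    have h1 : IsCompact {a : Fin n → Fin n → ℚ_[p] | ∀ i : Fin n, a i ∈
        {b : Fin n → ℚ_[p] | ∀ j : Fin n, b j ∈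
        Metric.closedBall (0 : ℚ_[p]) ((p : ℝ) ^ ((m : ℤ) * ((j : ℤ) - (i : ℤ))))}} :=
      isCompact_pi_infinite fun i => isCompact_pi_infinite fun j => isCompact_closedBall _ _
    simp only [mem_closedBall_zero_iff, Set.mem_ofPred_eq] at h1
    exact h1
  have h2 := (Units.isClosedEmbedding_embedProduct_of_t1
    (Matrix (Fin n) (Fin n) ℚ_[p])).isCompact_preimage
    (key.prod (key.image MulOpposite.continuous_op))
  convert h2 using 1
  ext g
  refine and_congr Iff.rfl ⟨fun h => ⟨_, h, rfl⟩, ?_⟩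
  rintro ⟨x, hx, hxg⟩
  rwa [MulOpposite.op_injective hxg] at hx

theorem IsUnipotentAlgebraic.isClosed {N : Subgroup (GL (Fin n) ℚ_[p])}
    (hN : IsUnipotentAlgebraic N) : IsClosed (N : Set (GL (Fin n) ℚ_[p])) := by
  obtain ⟨S, hS⟩ := hN.zariskiClosed
  have h : (N : Set (GL (Fin n) ℚ_[p])) = ⋂ f ∈ S, (fun g : GL (Fin n) ℚ_[p] => MvPolynomial.eval
      (fun ij : Fin n × Fin n => (g : Matrix (Fin n) (Fin n) ℚ_[p]) ij.1 ij.2) f) ⁻¹' {0} := by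
    ext g
    simp [hS]
  rw [h]
  refine isClosed_biInter fun f _ => isClosed_singleton.preimage ?_
  refine (MvPolynomial.continuous_eval f).comp (continuous_pi fun ij => ?_)
  have h1 : Continuous fun g : GL (Fin n) ℚ_[p] => (g : Matrix (Fin n) (Fin n) ℚ_[p]) :=
    Units.continuous_val
  exact h1.matrix_elem ij.1 ij.2

/-- On unitriangular matrices only the entries with `i < j` are constrained by `ballSubgroup p n m`,
and there the bounds `p ^ (m (j - i))` grow with `m` without limit. Small subgroups come from the
profinite group cut out by `ballSubgroup p n 0`. -/
theorem IsUnipotentAlgebraic.isLocallyElliptic {N : Subgroup (GL (Fin n) ℚ_[p])}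
    (hN : IsUnipotentAlgebraic N) : IsLocallyElliptic N := by
  have hp1 : (1 : ℝ) < p := Padic.one_lt_prime_cast
  have hp : (0 : ℝ) < p := zero_lt_one.trans hp1
  have hopen : ∀ m, IsOpen ((ballSubgroup p n m).subgroupOf N : Set N) := fun m =>
    (isOpen_ballSubgroup m).preimage continuous_subtype_val
  have hcomp : ∀ m, IsCompact ((ballSubgroup p n m).subgroupOf N : Set N) := fun m =>
    hN.isClosed.isClosedEmbedding_subtypeVal.isCompact_preimage (isCompact_ballSubgroup m)
  refine ⟨⟨fun m => (ballSubgroup p n m).subgroupOf N, ?_, hopen, hcomp, ?_⟩, ?_⟩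
  · intro a b hab g hg
    have key : ∀ h ∈ N, (∀ i j : Fin n, ‖(h : Matrix (Fin n) (Fin n) ℚ_[p]) i j‖ ≤
        (p : ℝ) ^ ((a : ℤ) * ((j : ℤ) - (i : ℤ)))) →
        (∀ i j : Fin n, ‖(h : Matrix (Fin n) (Fin n) ℚ_[p]) i j‖ ≤
        (p : ℝ) ^ ((b : ℤ) * ((j : ℤ) - (i : ℤ)))) := fun h hh hb i j => by
      rcases lt_or_ge j i with hij | hij
      · rw [hN.unitriangular h hh i j hij.le, if_neg hij.ne', norm_zero]
        exact (zpow_pos hp _).le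
      · refine (hb i j).trans (zpow_le_zpow_right₀ hp1.le ?_)
        rw [Fin.le_def] at hij
        exact mul_le_mul_of_nonneg_right (by exact_mod_cast hab) (by omega)
    exact ⟨key _ g.2 hg.1, key _ (N.inv_mem g.2) hg.2⟩
  · intro g
    have key : ∀ h ∈ N, ∃ a : ℕ, ∀ m, a ≤ m →
        ∀ i j : Fin n, ‖(h : Matrix (Fin n) (Fin n) ℚ_[p]) i j‖ ≤
        (p : ℝ) ^ ((m : ℤ) * ((j : ℤ) - (i : ℤ))) := fun h hh => by
      choose a ha using fun i j : Fin n =>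
        Padic.exists_norm_le_zpow ((h : Matrix (Fin n) (Fin n) ℚ_[p]) i j)
      refine ⟨Finset.univ.sup fun i => Finset.univ.sup fun j => a i j, fun m hm i j => ?_⟩
      rcases lt_or_ge i j with hij | hij
      · refine (ha i j).trans (zpow_le_zpow_right₀ hp1.le ?_)
        have h1 : a i j ≤ m := (Finset.le_sup (f := fun j => a i j) (Finset.mem_univ j)).trans
          ((Finset.le_sup (f := fun i => Finset.univ.sup fun j => a i j)
            (Finset.mem_univ i)).trans hm)
        rw [Fin.lt_def] at hij
        have h2 : (1 : ℤ) ≤ (j : ℤ) - (i : ℤ) := by omega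
        have h3 : (a i j : ℤ) ≤ m := by exact_mod_cast h1
        nlinarith
      · rw [hN.unitriangular h hh i j hij]
        split_ifs with h
        · subst h; simp
        · rw [norm_zero]; exact (zpow_pos hp _).le
    obtain ⟨a, ha⟩ := key g g.2
    obtain ⟨b, hb⟩ := key _ (N.inv_mem g.2)
    exact ⟨max a b, ha _ (le_max_left _ _), hb _ (le_max_right _ _)⟩
  · intro U hU
    have : CompactSpace ((ballSubgroup p n 0).subgroupOf N) :=
      isCompact_iff_compactSpace.mp (hcomp 0)
    have : TotallyDisconnectedSpace (Matrix (Fin n) (Fin n) ℚ_[p]) :=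
      inferInstanceAs (TotallyDisconnectedSpace (Fin n → Fin n → ℚ_[p]))
    have : TotallyDisconnectedSpace ((ballSubgroup p n 0).subgroupOf N) :=
      TotallyDisconnectedSpace.of_injective
        (f := fun g => ((g : N) : GL (Fin n) ℚ_[p]).val)
        (Units.continuous_val.comp (continuous_subtype_val.comp continuous_subtype_val))
        (fun g h e => Subtype.ext (Subtype.ext (Units.ext e)))
    obtain ⟨W, hWU, hW, h1⟩ := mem_nhds_iff.mp hU
    obtain ⟨H, hH⟩ := ProfiniteGrp.exist_openNormalSubgroup_sub_open_nhds_of_one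
      (hW.preimage (continuous_subtype_val (p := (· ∈ (ballSubgroup p n 0).subgroupOf N)))) h1
    refine ⟨H.toSubgroup.map ((ballSubgroup p n 0).subgroupOf N).subtype, ?_, ?_, ?_⟩
    · rw [Subgroup.coe_map]
      exact (hopen 0).isOpenMap_subtype_val _ H.isOpen
    · rw [Subgroup.coe_map]
      exact (H.toOpenSubgroup.isClosed.isCompact).image continuous_subtype_val
    · rintro _ ⟨g, hg, rfl⟩
      exact hWU (hH hg)

end

/-! ### Averaging over compact subgroups -/

namespace Representation

open Filter Topology

variable {G V : Type*} [Group G] [TopologicalSpace G] [IsTopologicalGroup G] [AddCommGroup V]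
  [Module ℂ V] {ρ : Representation ℂ G V}

/-- With the discrete topology on `V` the orbit map is continuous, and compact subsets of a discrete
space are finite. -/
theorem finite_image_of_isCompact {v : V} (hs : ∀ g, ∀ᶠ x in 𝓝 g, ρ x v = ρ g v) {Ω : Set G}
    (hΩ : IsCompact Ω) : ((fun g => ρ g v) '' Ω).Finite := by
  let _ : TopologicalSpace V := ⊥
  have : DiscreteTopology V := ⟨rfl⟩
  have hc : Continuous fun g => ρ g v := by
    refine continuous_iff_continuousAt.mpr fun g => ?_
    rw [ContinuousAt, nhds_discrete V, tendsto_pure]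
    exact hs g
  exact (hΩ.image hc).finite_of_discrete

/-- Averaging a smooth vector over a compact subgroup. -/
theorem exists_fixed_average {v : V} (hs : ∀ g, ∀ᶠ x in 𝓝 g, ρ x v = ρ g v) (K : Subgroup G)
    (hK : IsCompact (K : Set G)) : ∃ v' ∈ ρ.fixedBy K,
      ∀ l : V →ₗ[ℂ] ℂ, (∀ k ∈ K, l (ρ k v) = l v) → l v' = l v := by
  classical
  have hfin := finite_image_of_isCompact hs hK
  -- The orbit of `v` under `K` is finite and permuted by `K`, so its mean replaces a Haar integral.
  let O := hfin.toFinset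
  have hO : ∀ o, o ∈ O ↔ ∃ k ∈ K, ρ k v = o := fun o => by simp [O]
  have hv : v ∈ O := (hO v).mpr ⟨1, K.one_mem, by simp⟩
  have hcard : (O.card : ℂ) ≠ 0 := by
    exact_mod_cast (Finset.card_pos.mpr ⟨v, hv⟩).ne'
  refine ⟨(O.card : ℂ)⁻¹ • ∑ o ∈ O, o, fun k hk => ?_, fun l hl => ?_⟩
  · rw [map_smul, map_sum]
    congr 1
    refine Finset.sum_bij' (fun o _ => ρ k o) (fun o _ => ρ k⁻¹ o) ?_ ?_
      (fun o _ => ρ.apply_inv_self_apply k o) (fun o _ => ρ.apply_self_inv_apply k o)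
      (fun o _ => rfl)
    · intro o ho
      obtain ⟨k', hk', rfl⟩ := (hO o).mp ho
      exact (hO _).mpr ⟨k * k', K.mul_mem hk hk', ρ.map_mul_apply _ _ _⟩
    · intro o ho
      obtain ⟨k', hk', rfl⟩ := (hO o).mp ho
      exact (hO _).mpr ⟨k⁻¹ * k', K.mul_mem (K.inv_mem hk) hk', ρ.map_mul_apply _ _ _⟩
  · rw [map_smul, map_sum, Finset.sum_congr rfl (g := fun _ => l v), Finset.sum_const,
      ← Nat.cast_smul_eq_nsmul ℂ, smul_smul, inv_mul_cancel₀ hcard, one_smul]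
    intro o ho
    obtain ⟨k, hk, rfl⟩ := (hO o).mp ho
    exact hl k hk

open MeasureTheory in
/-- An invariant positive semidefinite form for a compact subgroup. -/
theorem exists_invariant_core (hs : ρ.IsSmooth) (K : Subgroup G) (hK : IsCompact (K : Set G))
    {v₀ : V} (hv₀ : v₀ ≠ 0) : ∃ c : PreInnerProductSpace.Core ℂ V,
      (∀ k ∈ K, ∀ u w, c.inner (ρ k u) (ρ k w) = c.inner u w) ∧ c.inner v₀ v₀ = 1 := by
  have : CompactSpace K := isCompact_iff_compactSpace.mp hK
  let _ : MeasurableSpace K := borel K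
  have : BorelSpace K := ⟨rfl⟩
  let μ : Measure K := Measure.haar
  obtain ⟨l, hl⟩ : ∃ l : Module.Dual ℂ V, l v₀ ≠ 0 := by
    by_contra! h
    exact hv₀ ((Module.forall_dual_apply_eq_zero_iff ℂ v₀).mp h)
  have hcont : ∀ u, Continuous fun k : K => l (ρ (k : G)⁻¹ u) := fun u => by
    refine continuous_iff_continuousAt.mpr fun k => ?_
    refine Tendsto.congr' (f₁ := fun _ => l (ρ (k : G)⁻¹ u)) ?_ tendsto_const_nhds
    have h1 : Tendsto (fun k : K => (k : G)⁻¹) (𝓝 k) (𝓝 (k : G)⁻¹) :=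
      (continuous_subtype_val.inv).tendsto k
    filter_upwards [h1.eventually (hs.eventually_eq u _)] with x hx
    rw [hx]
  have hint : ∀ u w, Integrable (fun k : K => starRingEnd ℂ (l (ρ (k : G)⁻¹ u)) *
      l (ρ (k : G)⁻¹ w)) μ := fun u w =>
    ((Complex.continuous_conj.comp (hcont u)).mul (hcont w)).integrable_of_hasCompactSupport
      (HasCompactSupport.of_compactSpace _)
  -- The rank one form of a functional `l` with `l v₀ ≠ 0`, averaged over `K`. It may be degenerate,
  -- but it is positive at `v₀`, which allows the normalization.
  let B : V → V → ℂ := fun u w => ∫ k : K, starRingEnd ℂ (l (ρ (k : G)⁻¹ u)) *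
      l (ρ (k : G)⁻¹ w) ∂μ
  have hBsq : ∀ u, B u u = ((∫ k : K, ‖l (ρ (k : G)⁻¹ u)‖ ^ 2 ∂μ : ℝ) : ℂ) := fun u => by
    rw [← integral_complex_ofReal]
    refine integral_congr_ae (Eventually.of_forall fun k => ?_)
    simp only [Complex.ofReal_pow]
    exact Complex.conj_mul' _
  have hpos : 0 < ∫ k : K, ‖l (ρ (k : G)⁻¹ v₀)‖ ^ 2 ∂μ := by
    refine ((hcont v₀).norm.pow 2).integral_pos_of_hasCompactSupport_nonneg_nonzero
      (HasCompactSupport.of_compactSpace _) (fun k => by positivity) (x := 1) ?_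
    simpa using hl
  set r := ∫ k : K, ‖l (ρ (k : G)⁻¹ v₀)‖ ^ 2 ∂μ with hr
  refine ⟨{ inner := fun u w => (r : ℂ)⁻¹ * B u w
            conj_inner_symm := fun u w => ?_
            re_inner_nonneg := fun u => ?_
            add_left := fun u w z => ?_
            smul_left := fun u w a => ?_ }, fun k hk u w => ?_, ?_⟩
  · rw [map_mul, map_inv₀, Complex.conj_ofReal]
    congr 1
    change starRingEnd ℂ (∫ k : K, _ ∂μ) = _
    rw [← integral_conj]
    refine integral_congr_ae (Eventually.of_forall fun k => ?_)
    simp only [map_mul, Complex.conj_conj]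
    ring
  · rw [hBsq, ← Complex.ofReal_inv, ← Complex.ofReal_mul]
    simp only [RCLike.re_to_complex, Complex.ofReal_re]
    exact mul_nonneg (inv_nonneg.mpr hpos.le) (integral_nonneg fun k => by positivity)
  · rw [← mul_add]
    congr 1
    change (∫ k : K, _ ∂μ) = (∫ k : K, _ ∂μ) + ∫ k : K, _ ∂μ
    rw [← integral_add (hint _ _) (hint _ _)]
    refine integral_congr_ae (Eventually.of_forall fun k => ?_)
    simp only [map_add, add_mul]
  · rw [mul_left_comm]
    congr 1
    change (∫ k : K, _ ∂μ) = _ * ∫ k : K, _ ∂μ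
    rw [← integral_const_mul]
    refine integral_congr_ae (Eventually.of_forall fun k => ?_)
    simp only [map_smul, smul_eq_mul, map_mul, mul_assoc]
  · change _ * B _ _ = _ * B _ _
    congr 1
    have h1 := integral_mul_left_eq_self (μ := μ) (fun x : K => starRingEnd ℂ (l (ρ (x : G)⁻¹ u)) *
      l (ρ (x : G)⁻¹ w)) (⟨k, hk⟩⁻¹ : K)
    refine Eq.trans (integral_congr_ae (Eventually.of_forall fun x => ?_)) h1
    simp only [← ρ.map_mul_apply, Subgroup.coe_mul, Subgroup.coe_inv, mul_inv_rev, inv_inv]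
  · change (r : ℂ)⁻¹ * B v₀ v₀ = 1
    rw [hBsq]
    exact inv_mul_cancel₀ (by exact_mod_cast hpos.ne')

/-- Irreducible smooth representations of locally elliptic groups are unitarizable. -/
theorem exists_invariant_inner (hG : IsLocallyElliptic G) (hi : ρ.IsIrreducible)
    (hs : ρ.IsSmooth) : ∃ c : InnerProductSpace.Core ℂ V,
      ∀ g u w, c.inner (ρ g u) (ρ g w) = c.inner u w := by
  rw [isIrreducible_iff] at hi
  obtain ⟨hV, hi⟩ := hi
  obtain ⟨v₀, hv₀⟩ := exists_ne (0 : V)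
  obtain ⟨K, hmono, -, hcomp, hex⟩ := hG.exhaust
  choose c hinv hone using fun m => exists_invariant_core hs (K m) (hcomp m) hv₀
  have hspan : Submodule.span ℂ (Set.range fun g => ρ g v₀) = ⊤ := by
    refine (hi _ fun g w hw => ?_).resolve_left fun h => hv₀ ?_
    · induction hw using Submodule.span_induction with
      | mem w hw =>
        obtain ⟨h, rfl⟩ := hw
        exact Submodule.subset_span ⟨g * h, ρ.map_mul_apply _ _ _⟩
      | zero => rw [map_zero]; exact Submodule.zero_mem _
      | add u w _ _ hu hw => rw [map_add]; exact Submodule.add_mem _ hu hw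
      | smul a u _ hu => rw [map_smul]; exact Submodule.smul_mem _ _ hu
    · have h1 : v₀ ∈ Submodule.span ℂ (Set.range fun g => ρ g v₀) :=
        Submodule.subset_span ⟨1, by simp⟩
      rwa [h, Submodule.mem_bot] at h1
  have hev : ∀ g, ∀ᶠ m in atTop, g ∈ K m := fun g => by
    obtain ⟨m, hm⟩ := hex g
    exact (eventually_ge_atTop m).mono fun k hk => hmono hk hm
  -- The seminorm of `ρ g v₀` is eventually `1`, because `g` eventually lies in `K m`. Vectors of
  -- this kind span `V`, and the triangle inequality does the rest.
  have hbdd : ∀ u, ∃ C : ℝ, ∀ᶠ m in atTop, √(RCLike.re ((c m).inner u u)) ≤ C := fun u => by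
    have hu : u ∈ Submodule.span ℂ (Set.range fun g => ρ g v₀) := by rw [hspan]; trivial
    induction hu using Submodule.span_induction with
    | mem w hw =>
      obtain ⟨g, rfl⟩ := hw
      refine ⟨1, (hev g).mono fun m hm => ?_⟩
      rw [hinv m g hm, hone]
      simp
    | zero =>
      refine ⟨0, Eventually.of_forall fun m => ?_⟩
      let _ := c m
      let _ : SeminormedAddCommGroup V :=
        InnerProductSpace.Core.toSeminormedAddCommGroup (𝕜 := ℂ) (F := V)
      exact (norm_zero (E := V)).le
    | add u w _ _ hu hw =>
      obtain ⟨C, hC⟩ := hu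
      obtain ⟨C', hC'⟩ := hw
      refine ⟨C + C', (hC.and hC').mono fun m ⟨h1, h2⟩ => ?_⟩
      let _ := c m
      let _ : SeminormedAddCommGroup V :=
        InnerProductSpace.Core.toSeminormedAddCommGroup (𝕜 := ℂ) (F := V)
      exact (norm_add_le (E := V) u w).trans (add_le_add h1 h2)
    | smul a u _ hu =>
      obtain ⟨C, hC⟩ := hu
      refine ⟨‖a‖ * C, hC.mono fun m h1 => ?_⟩
      let _ := c m
      let _ : SeminormedAddCommGroup V :=
        InnerProductSpace.Core.toSeminormedAddCommGroup (𝕜 := ℂ) (F := V)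
      let _ : NormedSpace ℂ V := InnerProductSpace.Core.toNormedSpace
      exact (norm_smul (β := V) a u).le.trans (mul_le_mul_of_nonneg_left h1 (norm_nonneg a))
  have hCS : ∀ m u w, ‖(c m).inner u w‖ ≤
      √(RCLike.re ((c m).inner u u)) * √(RCLike.re ((c m).inner w w)) := fun m u w => by
    let _ := c m
    exact InnerProductSpace.Core.norm_inner_le_norm (𝕜 := ℂ) (F := V) u w
  -- By Cauchy–Schwarz the values of the forms stay bounded, so they converge along a nonprincipal
  -- ultrafilter; the limit is invariant under every `g`.
  let 𝒰 : Ultrafilter ℕ := hyperfilter ℕ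
  have h𝒰 : (𝒰 : Filter ℕ) ≤ atTop := Nat.hyperfilter_le_atTop
  have hlim : ∀ u w, ∃ L : ℂ, Tendsto (fun m => (c m).inner u w) 𝒰 (𝓝 L) := fun u w => by
    obtain ⟨C, hC⟩ := hbdd u
    obtain ⟨C', hC'⟩ := hbdd w
    have h1 : ∀ᶠ m in (𝒰 : Filter ℕ), (c m).inner u w ∈ Metric.closedBall (0 : ℂ) (C * C') := by
      filter_upwards [h𝒰 hC, h𝒰 hC'] with m h1 h2
      rw [mem_closedBall_zero_iff]
      exact (hCS m u w).trans (mul_le_mul h1 h2 (Real.sqrt_nonneg _)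
        ((Real.sqrt_nonneg _).trans h1))
    obtain ⟨L, -, hL⟩ := (isCompact_closedBall (0 : ℂ) (C * C')).ultrafilter_le_nhds'
      (𝒰.map fun m => (c m).inner u w) h1
    exact ⟨L, hL⟩
  choose B hB using hlim
  have hinvB : ∀ g u w, B (ρ g u) (ρ g w) = B u w := fun g u w =>
    tendsto_nhds_unique ((hB _ _).congr' (((hev g).filter_mono h𝒰).mono fun m hm => hinv m g hm u w)) (hB u w)
  let c' : PreInnerProductSpace.Core ℂ V :=
    { inner := B
      conj_inner_symm := fun u w => tendsto_nhds_unique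
        ((((Complex.continuous_conj.tendsto _).comp (hB w u))).congr fun m =>
          (c m).conj_inner_symm u w) (hB u w)
      re_inner_nonneg := fun u => ge_of_tendsto'
        ((Complex.continuous_re.tendsto _).comp (hB u u)) fun m => (c m).re_inner_nonneg u
      add_left := fun u w z => tendsto_nhds_unique
        ((hB _ _).congr fun m => (c m).add_left u w z) ((hB u z).add (hB w z))
      smul_left := fun u w a => tendsto_nhds_unique
        ((hB _ _).congr fun m => (c m).smul_left u w a) ((hB u w).const_mul _) }
  have hCS' : ∀ u w, ‖B u w‖ ≤ √(RCLike.re (B u u)) * √(RCLike.re (B w w)) := fun u w => by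
    let _ := c'
    exact InnerProductSpace.Core.norm_inner_le_norm (𝕜 := ℂ) (F := V) u w
  -- The radical of the limit form is an invariant subspace that does not contain `v₀`;
  -- irreducibility makes it zero and the form definite.
  let R : Submodule ℂ V :=
    { carrier := {u | ∀ w, B u w = 0}
      add_mem' := fun {u u'} hu hu' w => by
        rw [show B (u + u') w = B u w + B u' w from c'.add_left u u' w, hu, hu', add_zero]
      zero_mem' := fun w => by
        have h := c'.smul_left 0 w 0
        rw [zero_smul] at h
        refine Eq.trans h ?_
        rw [map_zero, zero_mul]
      smul_mem' := fun a u hu w => by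
        rw [show B (a • u) w = starRingEnd ℂ a * B u w from c'.smul_left u w a, hu, mul_zero] }
  have hR : R = ⊥ := by
    refine (hi R fun g u hu w => ?_).resolve_right fun h => ?_
    · rw [← ρ.apply_self_inv_apply g w, hinvB]
      exact hu _
    · have h1 : v₀ ∈ R := by rw [h]; trivial
      have h2 : B v₀ v₀ = 1 := tendsto_nhds_unique ((hB _ _).congr hone) tendsto_const_nhds
      exact one_ne_zero (h2.symm.trans (h1 v₀))
  refine ⟨{ c' with
    definite := fun u hu => ?_ }, hinvB⟩
  have h1 : u ∈ R := fun w => by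
    have h2 := hCS' u w
    rw [show B u u = 0 from hu] at h2
    simpa using h2
  rwa [hR, Submodule.mem_bot] at h1

end Representation

/-! ### Unitary representations and completions -/

section Completions

open Filter Topology

variable {G : Type} [Group G] [TopologicalSpace G] [IsTopologicalGroup G]

/-- The linear representation underlying an action by linear isometries. -/
def isometryRep {H : Type*} [NormedAddCommGroup H] [InnerProductSpace ℂ H]
    (act : G →* (H ≃ₗᵢ[ℂ] H)) : Representation ℂ G H where
  toFun g := (act g).toLinearEquiv.toLinearMap
  map_one' := by ext; simp
  map_mul' g h := by ext; simp

section

variable {H : Type*} [NormedAddCommGroup H] [InnerProductSpace ℂ H] {act : G →* (H ≃ₗᵢ[ℂ] H)}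

theorem act_mul_apply (g h : G) (v : H) : act (g * h) v = act g (act h v) := by
  rw [map_mul]; rfl

theorem act_inv_apply_self (g : G) (v : H) : act g⁻¹ (act g v) = v := by
  rw [← act_mul_apply, inv_mul_cancel, map_one]; rfl

theorem inner_act_left (g : G) (u v : H) : inner ℂ (act g u) v = inner ℂ u (act g⁻¹ v) := by
  rw [← (act g⁻¹).inner_map_map, act_inv_apply_self]

theorem continuous_act_of_dense {V : Type*} [AddCommGroup V] [Module ℂ V]
    {ρ : Representation ℂ G V} (hs : ρ.IsSmooth) (ι : V →ₗ[ℂ] H) (hd : DenseRange ι)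
    (hι : ∀ g v, ι (ρ g v) = act g (ι v)) (v : H) : Continuous fun g => act g v := by
  refine continuous_iff_continuousAt.mpr fun g => ?_
  rw [ContinuousAt, Metric.tendsto_nhds]
  intro ε hε
  obtain ⟨u, hu⟩ := hd.exists_dist_lt v (half_pos hε)
  filter_upwards [hs.eventually_eq u g] with x hx
  calc dist (act x v) (act g v) ≤ dist (act x v) (act x (ι u)) + dist (act x (ι u)) (act g v) :=
        dist_triangle _ _ _
    _ = dist v (ι u) + dist v (ι u) := by
        rw [(act x).dist_map, ← hι, hx, hι, (act g).dist_map, dist_comm (ι u)]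
    _ < ε := by linarith

/-- Fixed vectors of a completion are fixed vectors of the smooth representation, if there are
only finitely many of them. -/
theorem fixedBy_isometryRep_le {V : Type*} [AddCommGroup V] [Module ℂ V]
    {ρ : Representation ℂ G V} (hs : ρ.IsSmooth) (ι : V →ₗ[ℂ] H) (hd : DenseRange ι)
    (hι : ∀ g v, ι (ρ g v) = act g (ι v)) (K : Subgroup G) (hK : IsCompact (K : Set G))
    [FiniteDimensional ℂ (ρ.fixedBy K)] :
    (isometryRep act).fixedBy K ≤ (ρ.fixedBy K).map ι := by
  intro u hu
  let W := (ρ.fixedBy K).map ι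
  have hWfix : ∀ w ∈ W, ∀ k ∈ K, act k w = w := by
    rintro _ ⟨v, hv, rfl⟩ k hk
    rw [← hι, hv k hk]
  -- The component of `u` orthogonal to `ι(V^K)` is still fixed by `K`. Its inner product with `ι v`
  -- is unchanged when `v` is replaced by its average over `K`, hence zero, and density of `ι` gives
  -- `z = 0`.
  set z := u - W.starProjection u with hz
  have hzW : ∀ w ∈ W, inner ℂ z w = 0 := fun w hw =>
    Submodule.starProjection_inner_eq_zero u w hw
  have hzfix : ∀ k ∈ K, act k z = z := fun k hk => by
    rw [hz, map_sub, hWfix _ (Submodule.starProjection_apply_mem W u) k hk]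
    congr 1
    exact hu k hk
  have hz0 : z = 0 := by
    refine hd.eq_zero_of_inner_left ℂ fun v => ?_
    obtain ⟨v', hv', hl⟩ := Representation.exists_fixed_average (hs.eventually_eq v) K hK
    have h1 := hl ((innerSL ℂ z).toLinearMap ∘ₗ ι) fun k hk => by
      change inner ℂ z (ι (ρ k v)) = inner ℂ z (ι v)
      rw [hι, ← hzfix k hk, LinearIsometryEquiv.inner_map_map, hzfix k hk]
    change inner ℂ z (ι v') = inner ℂ z (ι v) at h1
    rw [← h1]
    exact hzW _ ⟨v', hv', rfl⟩
  rw [show u = W.starProjection u from sub_eq_zero.mp hz0]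
  exact Submodule.starProjection_apply_mem W u

open MeasureTheory in
/-- Smooth vectors are dense in closed invariant subspaces of unitary representations. -/
theorem exists_fixed_near [CompleteSpace H] (hG : IsLocallyElliptic G)
    (hc : ∀ v, Continuous fun g => act g v) (W : Submodule ℂ H) (hW : IsClosed (W : Set H))
    (hinv : ∀ g, ∀ w ∈ W, act g w ∈ W) {w : H} (hw : w ∈ W) {ε : ℝ} (hε : 0 < ε) :
    ∃ K : Subgroup G, IsOpen (K : Set G) ∧ IsCompact (K : Set G) ∧
      ∃ u ∈ W, u ∈ (isometryRep act).fixedBy K ∧ ‖u - w‖ ≤ ε := by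
  have hU : {g : G | ‖act g w - w‖ < ε} ∈ 𝓝 (1 : G) := by
    refine (isOpen_lt (((hc w).sub continuous_const).norm) continuous_const).mem_nhds ?_
    change ‖act 1 w - w‖ < ε
    rw [map_one]
    simpa using hε
  obtain ⟨K, hKo, hKc, hKU⟩ := hG.small _ hU
  refine ⟨K, hKo, hKc, ?_⟩
  have : CompactSpace K := isCompact_iff_compactSpace.mp hKc
  let _ : MeasurableSpace K := borel K
  have : BorelSpace K := ⟨rfl⟩
  -- Total mass one, so that the integral is a mean of vectors at distance less than `ε` from `w`.
  let μ : Measure K := Measure.haarMeasure ⊤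
  have : IsProbabilityMeasure μ := ⟨Measure.haarMeasure_self (K₀ := (⊤ : TopologicalSpace.PositiveCompacts K))⟩
  have hcont : Continuous fun k : K => act (k : G) w := (hc w).comp continuous_subtype_val
  have hint : Integrable (fun k : K => act (k : G) w) μ :=
    hcont.integrable_of_hasCompactSupport (HasCompactSupport.of_compactSpace _)
  refine ⟨∫ k : K, act (k : G) w ∂μ, ?_, ?_, ?_⟩
  · exact (W.restrictScalars ℝ).convex.integral_mem hW
      (Eventually.of_forall fun k => hinv _ _ hw) hint
  · intro k hk
    have h1 := integral_mul_left_eq_self (μ := μ) (fun x : K => act (x : G) w) ⟨k, hk⟩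
    have h2 := (act k).toContinuousLinearEquiv.toContinuousLinearMap.integral_comp_comm hint
    refine (h2.symm.trans ?_).trans h1
    refine integral_congr_ae (Eventually.of_forall fun x => ?_)
    exact (act_mul_apply _ _ _).symm
  · have h1 : (∫ k : K, act (k : G) w ∂μ) - w = ∫ k : K, (act (k : G) w - w) ∂μ := by
      rw [integral_sub hint (integrable_const _)]
      simp
    rw [h1]
    have h2 := norm_integral_le_of_norm_le_const (μ := μ) (f := fun k : K => act (k : G) w - w)
      (C := ε) (Eventually.of_forall fun k => le_of_lt (hKU k.2))
    simpa using h2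

end

theorem SmoothIrrep.isSmooth (σ : SmoothIrrep G) : σ.act.IsSmooth := fun v => by
  obtain ⟨K, hK, -, hKv⟩ := σ.smooth v
  exact ⟨K, hK, hKv⟩

/-- The completion of a representation with respect to an invariant inner product. -/
theorem exists_completion {V : Type} [AddCommGroup V] [Module ℂ V] (ρ : Representation ℂ G V)
    (c : InnerProductSpace.Core ℂ V) (hc : ∀ g u w, c.inner (ρ g u) (ρ g w) = c.inner u w) :
    ∃ (H : Type) (_ : NormedAddCommGroup H) (_ : InnerProductSpace ℂ H) (_ : CompleteSpace H)
      (act : G →* (H ≃ₗᵢ[ℂ] H)) (ι : V →ₗ[ℂ] H), Function.Injective ι ∧ DenseRange ι ∧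
        ∀ g v, ι (ρ g v) = act g (ι v) := by
  let _ : NormedAddCommGroup V := c.toNormedAddCommGroup
  let _ : InnerProductSpace ℂ V := InnerProductSpace.ofCore c.toCore
  let ι : V →ₗ[ℂ] UniformSpace.Completion V :=
    (UniformSpace.Completion.toComplₗᵢ (𝕜 := ℂ) (E := V)).toLinearMap
  have hι : DenseRange ι := UniformSpace.Completion.denseRange_coe
  let e : G → (V ≃ₗ[ℂ] V) := fun g =>
    LinearEquiv.ofLinearMap (ρ g) (ρ g⁻¹) (by rw [← Module.End.mul_eq_comp, ← map_mul]; simp; rfl)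
      (by rw [← Module.End.mul_eq_comp, ← map_mul]; simp; rfl)
  have hnorm : ∀ g v, ‖ι (e g v)‖ = ‖ι v‖ := fun g v => by
    have h1 : ∀ v, ‖ι v‖ = ‖v‖ := fun v => UniformSpace.Completion.norm_coe v
    rw [h1, h1, @norm_eq_sqrt_re_inner ℂ, @norm_eq_sqrt_re_inner ℂ]
    congr 2
    exact hc g v v
  let T : G → (UniformSpace.Completion V ≃ₗᵢ[ℂ] UniformSpace.Completion V) := fun g =>
    (e g).extendOfIsometry ι ι hι hι (hnorm g)
  have hT : ∀ g v, T g (ι v) = ι (ρ g v) := fun g v =>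
    LinearEquiv.extendOfIsometry_eq _ _ _ _ _ _ _
  refine ⟨UniformSpace.Completion V, inferInstance, inferInstance, inferInstance,
    { toFun := T
      map_one' := ?_
      map_mul' := fun g h => ?_ }, ι, ?_, hι, fun g v => (hT g v).symm⟩
  · apply LinearIsometryEquiv.ext
    refine congrFun (hι.equalizer (T 1).continuous continuous_id (funext fun v => ?_))
    simp [hT]
  · apply LinearIsometryEquiv.ext
    refine congrFun (hι.equalizer (T (g * h)).continuous
      ((T g).continuous.comp (T h).continuous) (funext fun v => ?_))
    simp [hT]
  · exact (UniformSpace.Completion.toComplₗᵢ (𝕜 := ℂ) (E := V)).injective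

/-- All irreducible smooth representations are admissible. -/
def SmoothAdmissible (G : Type) [Group G] [TopologicalSpace G] : Prop :=
  ∀ σ : SmoothIrrep G, σ.act.IsAdmissible

/-- A nonzero closed invariant subspace contains a nonzero vector fixed by a compact open subgroup.
By admissibility that vector comes from `σ`, so irreducibility of `σ` puts the whole dense image of
`σ` into the subspace. -/
theorem exists_isUnitaryCompletion (hG : IsLocallyElliptic G) (hA : SmoothAdmissible G)
    (σ : SmoothIrrep G) : ∃ π : UnitaryIrrep G, IsUnitaryCompletion σ π := by
  obtain ⟨c, hc⟩ := Representation.exists_invariant_inner hG σ.irreducible σ.isSmooth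
  obtain ⟨H, _, _, _, act, ι, hi, hd, hι⟩ := exists_completion σ.act c hc
  have hirr := (Representation.isIrreducible_iff _).mp σ.irreducible
  obtain ⟨hV, hirr⟩ := hirr
  have hcont := continuous_act_of_dense σ.isSmooth ι hd hι
  refine ⟨⟨H, act, hcont, hi.nontrivial, fun W hW hWinv => ?_⟩, ι, hi, hd, hι⟩
  rw [or_iff_not_imp_left]
  intro hW0
  obtain ⟨w, hw, hw0⟩ := Submodule.exists_mem_ne_zero_of_ne_bot hW0
  obtain ⟨K, hKo, hKc, u, huW, hu, huw⟩ := exists_fixed_near hG hcont W hW hWinv hw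
    (half_pos (norm_pos_iff.mpr hw0))
  have := hA σ K hKo
  obtain ⟨v, hv, rfl⟩ := fixedBy_isometryRep_le σ.isSmooth ι hd hι K hKc hu
  have hv0 : v ≠ 0 := by
    rintro rfl
    rw [map_zero, zero_sub, norm_neg] at huw
    linarith [norm_pos_iff.mpr hw0]
  have htop : W.comap ι = ⊤ := by
    refine (hirr _ fun g v hv => ?_).resolve_left fun h => hv0 ?_
    · rw [Submodule.mem_comap, hι]
      exact hWinv g _ hv
    · rwa [← Submodule.mem_bot ℂ, ← h]
  rw [eq_top_iff]
  intro x _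
  refine hd.induction_on (p := fun x => x ∈ W) x hW fun v => ?_
  have : v ∈ W.comap ι := by rw [htop]; trivial
  exact this

/-- The completion of an irreducible smooth representation is unique up to equivalence. -/
theorem IsUnitaryCompletion.equivalent (hA : SmoothAdmissible G)
    {σ : SmoothIrrep G} {π₁ π₂ : UnitaryIrrep G} (h₁ : IsUnitaryCompletion σ π₁)
    (h₂ : IsUnitaryCompletion σ π₂) : π₁.Equivalent π₂ := by
  obtain ⟨ι₁, hi₁, hd₁, hι₁⟩ := h₁
  obtain ⟨ι₂, hi₂, hd₂, hι₂⟩ := h₂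
  obtain ⟨hV, hirr⟩ := (Representation.isIrreducible_iff _).mp σ.irreducible
  obtain ⟨v₀, hv₀⟩ := exists_ne (0 : σ.V)
  obtain ⟨K, hKo, hKc, hKv⟩ := σ.smooth v₀
  have hfd := hA σ K hKo
  let F := σ.act.fixedBy K
  have : Nontrivial F := ⟨⟨v₀, hKv⟩, 0, fun h => hv₀ (congrArg Subtype.val h)⟩
  let W₁ := F.map ι₁
  let W₂ := F.map ι₂
  let f₁ : F ≃ₗ[ℂ] W₁ := F.equivMapOfInjective ι₁ hi₁
  let f₂ : F ≃ₗ[ℂ] W₂ := F.equivMapOfInjective ι₂ hi₂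
  let T : W₁ →ₗ[ℂ] W₂ := f₂.toLinearMap ∘ₗ f₁.symm.toLinearMap
  -- `A` expresses the second form through the first on the finite-dimensional space of `K`-fixed
  -- vectors; an eigenvector `u` exists there.
  let A : Module.End ℂ W₁ := LinearMap.adjoint T ∘ₗ T
  have hA' : ∀ u w : F, inner ℂ (ι₂ u) (ι₂ w) = inner ℂ (A (f₁ u)) (f₁ w) := fun u w => by
    simp only [A, LinearMap.comp_apply]
    rw [LinearMap.adjoint_inner_left]
    simp only [T, LinearMap.comp_apply, LinearEquiv.coe_coe, LinearEquiv.symm_apply_apply]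
    rfl
  have : Nontrivial W₁ := f₁.symm.toEquiv.nontrivial
  obtain ⟨μ, hμ⟩ := Module.End.exists_eigenvalue A
  obtain ⟨w, hw⟩ := hμ.exists_hasEigenvector
  obtain ⟨u, rfl⟩ := f₁.surjective w
  have hu0 : (u : σ.V) ≠ 0 := fun h => hw.2 (by rw [show u = 0 from Subtype.ext h, map_zero])
  set c := starRingEnd ℂ μ with hc
  have hF : ∀ v : F, inner ℂ (ι₂ u) (ι₂ v) = c * inner ℂ (ι₁ u) (ι₁ v) := fun v => by
    rw [hA', hw.apply_eq_smul, inner_smul_left]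
    rfl
  -- As `u` is fixed by `K`, both forms paired with `u` see only the average of `v` over `K`.
  have hV' : ∀ v, inner ℂ (ι₂ u) (ι₂ v) = c * inner ℂ (ι₁ u) (ι₁ v) := fun v => by
    obtain ⟨v', hv', hl⟩ := Representation.exists_fixed_average (σ.isSmooth.eventually_eq v) K hKc
    have hfix₁ : ∀ k ∈ K, π₁.act k (ι₁ u) = ι₁ u := fun k hk => by rw [← hι₁, u.2 k hk]
    have hfix₂ : ∀ k ∈ K, π₂.act k (ι₂ u) = ι₂ u := fun k hk => by rw [← hι₂, u.2 k hk]
    have h1 := hl ((innerSL ℂ (ι₁ u)).toLinearMap ∘ₗ ι₁) fun k hk => by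
      change inner ℂ (ι₁ u) (ι₁ (σ.act k v)) = inner ℂ (ι₁ u) (ι₁ v)
      conv_lhs => rw [hι₁, ← hfix₁ k hk, LinearIsometryEquiv.inner_map_map]
    have h2 := hl ((innerSL ℂ (ι₂ u)).toLinearMap ∘ₗ ι₂) fun k hk => by
      change inner ℂ (ι₂ u) (ι₂ (σ.act k v)) = inner ℂ (ι₂ u) (ι₂ v)
      conv_lhs => rw [hι₂, ← hfix₂ k hk, LinearIsometryEquiv.inner_map_map]
    change inner ℂ (ι₁ u) (ι₁ v') = inner ℂ (ι₁ u) (ι₁ v) at h1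
    change inner ℂ (ι₂ u) (ι₂ v') = inner ℂ (ι₂ u) (ι₂ v) at h2
    rw [← h1, ← h2]
    exact hF ⟨v', hv'⟩
  -- The vectors against which the two forms are proportional with factor `c` form an invariant
  -- subspace containing `u`, hence everything.
  let R : Submodule ℂ σ.V :=
    { carrier := {x | ∀ v, inner ℂ (ι₂ x) (ι₂ v) = c * inner ℂ (ι₁ x) (ι₁ v)}
      add_mem' := fun {x y} hx hy v => by
        rw [map_add, map_add, inner_add_left, inner_add_left, hx, hy, mul_add]
      zero_mem' := fun v => by simp
      smul_mem' := fun a x hx v => by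
        rw [map_smul, map_smul, inner_smul_left, inner_smul_left, hx, mul_left_comm] }
  have hR : R = ⊤ := by
    refine (hirr R fun g x hx v => ?_).resolve_left fun h => hu0 ?_
    · rw [hι₁, hι₂, inner_act_left, inner_act_left, ← hι₁, ← hι₂]
      exact hx _
    · rw [← Submodule.mem_bot ℂ, ← h]
      exact hV'
  have hall : ∀ x v, inner ℂ (ι₂ x) (ι₂ v) = c * inner ℂ (ι₁ x) (ι₁ v) := fun x => by
    have : x ∈ R := by rw [hR]; trivial
    exact this
  have hn₁ : 0 < ‖ι₁ u‖ := norm_pos_iff.mpr fun h => hu0 (hi₁ (by rw [h, map_zero]))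
  have hn₂ : 0 < ‖ι₂ u‖ := norm_pos_iff.mpr fun h => hu0 (hi₂ (by rw [h, map_zero]))
  set s := ‖ι₂ u‖ / ‖ι₁ u‖ with hs
  have hs0 : 0 < s := div_pos hn₂ hn₁
  have hcs : c = ((s ^ 2 : ℝ) : ℂ) := by
    have h1 := hall u u
    rw [inner_self_eq_norm_sq_to_K, inner_self_eq_norm_sq_to_K] at h1
    have h2 : ((‖ι₁ u‖ : ℝ) : ℂ) ≠ 0 := by exact_mod_cast hn₁.ne'
    rw [hs]
    push_cast
    rw [div_pow, eq_div_iff (pow_ne_zero 2 h2)]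
    exact h1.symm
  have hnorm : ∀ x, ‖ι₂ x‖ = s * ‖ι₁ x‖ := fun x => by
    have h1 := hall x x
    rw [inner_self_eq_norm_sq_to_K, inner_self_eq_norm_sq_to_K, hcs] at h1
    have h2 : ‖ι₂ x‖ ^ 2 = s ^ 2 * ‖ι₁ x‖ ^ 2 := by
      apply Complex.ofReal_injective
      push_cast at h1 ⊢
      exact h1
    rw [← mul_pow] at h2
    exact (pow_left_inj₀ (norm_nonneg _) (mul_nonneg hs0.le (norm_nonneg _)) two_ne_zero).mp h2
  have hsC : ((s⁻¹ : ℝ) : ℂ) ≠ 0 := by exact_mod_cast (inv_pos.mpr hs0).ne'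
  let f : σ.V ≃ₗ[ℂ] σ.V := LinearEquiv.smulOfNeZero ℂ σ.V _ hsC
  have hf : ∀ x, f x = ((s⁻¹ : ℝ) : ℂ) • x := fun x => rfl
  let E : π₁.H ≃ₗᵢ[ℂ] π₂.H := f.extendOfIsometry ι₁ ι₂ hd₁ hd₂ fun x => by
    rw [hf, map_smul, norm_smul, hnorm, Complex.norm_real, Real.norm_eq_abs,
      abs_of_pos (inv_pos.mpr hs0), inv_mul_cancel_left₀ hs0.ne']
  have hE : ∀ x, E (ι₁ x) = ι₂ (f x) := fun x => LinearEquiv.extendOfIsometry_eq _ _ _ _ _ _ _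
  refine ⟨E, fun g v => ?_⟩
  refine congrFun (hd₁.equalizer (E.continuous.comp (π₁.act g).continuous)
    ((π₂.act g).continuous.comp E.continuous) (funext fun x => ?_)) v
  simp only [Function.comp_apply]
  rw [← hι₁, hE, hE, hf, hf, map_smul, map_smul, map_smul, hι₂]

theorem IsUnitaryCompletion.congr_right {σ : SmoothIrrep G} {π₁ π₂ : UnitaryIrrep G}
    (h : IsUnitaryCompletion σ π₁) (e : π₁.Equivalent π₂) : IsUnitaryCompletion σ π₂ := by
  obtain ⟨ι, hi, hd, hι⟩ := h
  obtain ⟨T, hT⟩ := e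
  refine ⟨T.toLinearEquiv.toLinearMap ∘ₗ ι, T.injective.comp hi,
    T.surjective.denseRange.comp hd T.continuous, fun g v => ?_⟩
  change T (ι (σ.act g v)) = π₂.act g (T (ι v))
  rw [hι, hT]

theorem IsUnitaryCompletion.congr_left {σ₁ σ₂ : SmoothIrrep G} {π : UnitaryIrrep G}
    (h : IsUnitaryCompletion σ₁ π) (e : σ₂.act.Equiv σ₁.act) : IsUnitaryCompletion σ₂ π := by
  obtain ⟨ι, hi, hd, hι⟩ := h
  refine ⟨ι ∘ₗ e.toLinearEquiv.toLinearMap, hi.comp e.toLinearEquiv.injective,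
    ?_, fun g v => ?_⟩
  · rw [DenseRange, LinearMap.coe_comp]
    exact (e.toLinearEquiv.surjective.range_comp ι).symm ▸ hd
  · rw [LinearMap.comp_apply, LinearMap.comp_apply, ← hι]
    exact congrArg ι (Representation.IntertwiningMap.isIntertwining _ _ e.toIntertwiningMap g v)

/-- The image of an irreducible smooth representation in its completion is the space of smooth
vectors. -/
theorem mem_range_iff_of_completion (hA : SmoothAdmissible G)
    {σ : SmoothIrrep G} {π : UnitaryIrrep G} {ι : σ.V →ₗ[ℂ] π.H} (hd : DenseRange ι)
    (hι : ∀ g v, ι (σ.act g v) = π.act g (ι v)) (u : π.H) : u ∈ LinearMap.range ι ↔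
      ∃ K : Subgroup G, IsOpen (K : Set G) ∧ IsCompact (K : Set G) ∧ ∀ k ∈ K, π.act k u = u := by
  constructor
  · rintro ⟨v, rfl⟩
    obtain ⟨K, hKo, hKc, hK⟩ := σ.smooth v
    exact ⟨K, hKo, hKc, fun k hk => by rw [← hι, hK k hk]⟩
  · rintro ⟨K, hKo, hKc, hK⟩
    have := hA σ K hKo
    obtain ⟨v, -, rfl⟩ := fixedBy_isometryRep_le σ.isSmooth ι hd hι K hKc hK
    exact ⟨v, rfl⟩

/-- Both images equal the space of smooth vectors of `π`, which does not depend on the embedding. -/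
theorem IsUnitaryCompletion.nonempty_equiv (hA : SmoothAdmissible G)
    {σ₁ σ₂ : SmoothIrrep G} {π : UnitaryIrrep G} (h₁ : IsUnitaryCompletion σ₁ π)
    (h₂ : IsUnitaryCompletion σ₂ π) : Nonempty (σ₁.act.Equiv σ₂.act) := by
  obtain ⟨ι₁, hi₁, hd₁, hι₁⟩ := h₁
  obtain ⟨ι₂, hi₂, hd₂, hι₂⟩ := h₂
  have hr : LinearMap.range ι₁ = LinearMap.range ι₂ := by
    ext u
    rw [mem_range_iff_of_completion hA hd₁ hι₁, mem_range_iff_of_completion hA hd₂ hι₂]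
  let e : σ₁.V ≃ₗ[ℂ] σ₂.V := (LinearEquiv.ofInjective ι₁ hi₁).trans
    ((LinearEquiv.ofEq _ _ hr).trans (LinearEquiv.ofInjective ι₂ hi₂).symm)
  have he : ∀ v, ι₂ (e v) = ι₁ v := fun v => by
    have h1 := (LinearEquiv.ofInjective ι₂ hi₂).apply_symm_apply
      ((LinearEquiv.ofEq _ _ hr) (LinearEquiv.ofInjective ι₁ hi₁ v))
    exact congrArg Subtype.val h1
  refine ⟨Representation.Equiv.mk e fun g => LinearMap.ext fun v => hi₂ ?_⟩
  change ι₂ (e (σ₁.act g v)) = ι₂ (σ₂.act g (e v))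
  rw [he, hι₁, hι₂, he]

end Completions

/-! ### Simple vectors for increasing families of subgroups -/

section GroupAlgebra

open Filter Topology

variable {G : Type} [Group G]

/-- The group algebra of a subgroup, inside the group algebra of the whole group. -/
noncomputable def groupSubalgebra (K : Subgroup G) : Subalgebra ℂ (MonoidAlgebra ℂ G) :=
  Algebra.adjoin ℂ (MonoidAlgebra.of ℂ G '' (K : Set G))

theorem of_mem_groupSubalgebra {K : Subgroup G} {k : G} (hk : k ∈ K) :
    MonoidAlgebra.of ℂ G k ∈ groupSubalgebra K :=
  Algebra.subset_adjoin (Set.mem_image_of_mem _ hk)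

theorem groupSubalgebra_mono {K K' : Subgroup G} (h : K ≤ K') :
    groupSubalgebra K ≤ groupSubalgebra K' :=
  Algebra.adjoin_mono (Set.image_mono h)

theorem exists_mem_groupSubalgebra {K : ℕ → Subgroup G} (hmono : Monotone K)
    (hex : ∀ g, ∃ m, g ∈ K m) (a : MonoidAlgebra ℂ G) : ∃ m, a ∈ groupSubalgebra (K m) := by
  induction a using MonoidAlgebra.induction_on with
  | of g =>
    obtain ⟨m, hm⟩ := hex g
    exact ⟨m, of_mem_groupSubalgebra hm⟩
  | add a b ha hb =>
    obtain ⟨m, hm⟩ := ha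
    obtain ⟨m', hm'⟩ := hb
    exact ⟨max m m', add_mem (groupSubalgebra_mono (hmono (le_max_left _ _)) hm)
      (groupSubalgebra_mono (hmono (le_max_right _ _)) hm')⟩
  | smul c a ha =>
    obtain ⟨m, hm⟩ := ha
    exact ⟨m, Subalgebra.smul_mem _ hm c⟩

/-- An irreducible smooth representation from a maximal left ideal of the group algebra. -/
theorem exists_smoothIrrep_of_leftIdeal [TopologicalSpace G] [IsTopologicalGroup G]
    (hG : IsLocallyElliptic G) (L : Submodule ℂ (MonoidAlgebra ℂ G))
    (hL : ∀ a, ∀ b ∈ L, a * b ∈ L) (h1 : 1 ∉ L) (hmax : ∀ a ∉ L, ∃ b, b * a - 1 ∈ L)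
    (K : Subgroup G) (hKo : IsOpen (K : Set G)) (hK : ∀ k ∈ K, MonoidAlgebra.of ℂ G k - 1 ∈ L) :
    ∃ (σ : SmoothIrrep G) (f : MonoidAlgebra ℂ G →ₗ[ℂ] σ.V), Function.Surjective f ∧
      LinearMap.ker f = L ∧ ∀ g a, f (MonoidAlgebra.of ℂ G g * a) = σ.act g (f a) := by
  let Q := MonoidAlgebra ℂ G ⧸ L
  let ρ : Representation ℂ G Q :=
    { toFun := fun g => L.mapQ L (LinearMap.mulLeft ℂ (MonoidAlgebra.of ℂ G g)) fun b hb => hL _ b hb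
      map_one' := by
        refine Submodule.linearMap_qext _ (LinearMap.ext fun a => ?_)
        change L.mkQ (MonoidAlgebra.of ℂ G 1 * a) = L.mkQ a
        rw [map_one (MonoidAlgebra.of ℂ G), one_mul]
      map_mul' := fun g h => by
        refine Submodule.linearMap_qext _ (LinearMap.ext fun a => ?_)
        change L.mkQ (MonoidAlgebra.of ℂ G (g * h) * a) =
          L.mkQ (MonoidAlgebra.of ℂ G g * (MonoidAlgebra.of ℂ G h * a))
        rw [map_mul (MonoidAlgebra.of ℂ G), mul_assoc] }
  have hρ : ∀ g a, ρ g (L.mkQ a) = L.mkQ (MonoidAlgebra.of ℂ G g * a) := fun g a => rfl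
  have hsm : ∀ a : MonoidAlgebra ℂ G, ∃ K' : Subgroup G, IsOpen (K' : Set G) ∧
      ∀ k ∈ K', ρ k (L.mkQ a) = L.mkQ a := fun a => by
    induction a using MonoidAlgebra.induction_on with
    | of g =>
      refine ⟨K.comap (MulAut.conj g⁻¹).toMonoidHom, ?_, fun k hk => ?_⟩
      · exact hKo.preimage (show Continuous fun x => g⁻¹ * x * (g⁻¹)⁻¹ by fun_prop)
      · rw [hρ, ← sub_eq_zero, ← map_sub]
        refine (Submodule.Quotient.mk_eq_zero L).mpr ?_
        have h2 := hL (MonoidAlgebra.of ℂ G g) _ (hK _ hk)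
        have h3 : g * (MulAut.conj g⁻¹) k = k * g := by simp [mul_assoc]
        change MonoidAlgebra.of ℂ G g * (MonoidAlgebra.of ℂ G ((MulAut.conj g⁻¹) k) - 1) ∈ L at h2
        rwa [mul_sub, ← map_mul, h3, mul_one, map_mul] at h2
    | add a b ha hb =>
      obtain ⟨K₁, ho₁, h₁⟩ := ha
      obtain ⟨K₂, ho₂, h₂⟩ := hb
      refine ⟨K₁ ⊓ K₂, ho₁.inter ho₂, fun k hk => ?_⟩
      rw [map_add, map_add, h₁ k hk.1, h₂ k hk.2]
    | smul c a ha =>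
      obtain ⟨K₁, ho₁, h₁⟩ := ha
      exact ⟨K₁, ho₁, fun k hk => by rw [map_smul, map_smul, h₁ k hk]⟩
  have hirr : ρ.IsIrreducible := by
    refine (Representation.isIrreducible_iff ρ).mpr ⟨⟨L.mkQ 1, 0, fun h => h1 ?_⟩, fun W hW => ?_⟩
    · exact (Submodule.Quotient.mk_eq_zero L).mp h
    · have hWL : ∀ a b, L.mkQ b ∈ W → L.mkQ (a * b) ∈ W := fun a b hb => by
        induction a using MonoidAlgebra.induction_on with
        | of g => exact hW g _ hb
        | add a a' ha ha' => rw [add_mul, map_add]; exact add_mem ha ha'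
        | smul c a ha => rw [smul_mul_assoc, map_smul]; exact W.smul_mem c ha
      rw [or_iff_not_imp_left]
      intro hW0
      obtain ⟨w, hw, hw0⟩ := Submodule.exists_mem_ne_zero_of_ne_bot hW0
      obtain ⟨a, rfl⟩ := L.mkQ_surjective w
      obtain ⟨b, hb⟩ := hmax a fun h => hw0 ((Submodule.Quotient.mk_eq_zero L).mpr h)
      have h2 : L.mkQ 1 ∈ W := by
        have h3 : L.mkQ (b * a) = L.mkQ 1 := by
          rw [← sub_eq_zero, ← map_sub]
          exact (Submodule.Quotient.mk_eq_zero L).mpr hb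
        rw [← h3]
        exact hWL b a hw
      rw [eq_top_iff]
      rintro x -
      obtain ⟨c, rfl⟩ := L.mkQ_surjective x
      simpa using hWL c 1 h2
  refine ⟨⟨Q, ρ, fun v => ?_, hirr⟩, L.mkQ, L.mkQ_surjective, L.ker_mkQ, fun g a => rfl⟩
  obtain ⟨a, rfl⟩ := L.mkQ_surjective v
  obtain ⟨K₁, ho₁, h₁⟩ := hsm a
  obtain ⟨K₂, ho₂, hc₂, h₂⟩ := hG.small _ (ho₁.mem_nhds K₁.one_mem)
  exact ⟨K₂, ho₂, hc₂, fun k hk => h₁ k (h₂ hk)⟩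

variable {V : Type*} [AddCommGroup V] [Module ℂ V] (Φ : MonoidAlgebra ℂ G →ₐ[ℂ] Module.End ℂ V)

/-- The vector `v` generates a simple module over the group algebra of `K`. -/
def IsSimpleVector (K : Subgroup G) (v : V) : Prop :=
  v ≠ 0 ∧ ∀ a ∈ groupSubalgebra K, Φ a v ≠ 0 → ∃ b ∈ groupSubalgebra K, Φ (b * a) v = v

/-- The vectors annihilated by the annihilator of `v` in the group algebra of `K`. -/
noncomputable def subordinate (K : Subgroup G) (v : V) : Submodule ℂ V where
  carrier := {u | ∀ a ∈ groupSubalgebra K, Φ a v = 0 → Φ a u = 0}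
  add_mem' hu hw a ha h := by rw [map_add, hu a ha h, hw a ha h, add_zero]
  zero_mem' a _ _ := map_zero _
  smul_mem' c u hu a ha h := by rw [map_smul, hu a ha h, smul_zero]

/-- The submodule generated by `v` over the group algebra of `K`. -/
noncomputable def orbitSpan (K : Subgroup G) (v : V) : Submodule ℂ V :=
  (Subalgebra.toSubmodule (groupSubalgebra K)).map (LinearMap.applyₗ v ∘ₗ Φ.toLinearMap)

variable {Φ} {K K' : Subgroup G} {u v w : V}

theorem self_mem_subordinate : v ∈ subordinate Φ K v := fun _ _ h => h

theorem self_mem_orbitSpan : v ∈ orbitSpan Φ K v := ⟨1, one_mem (groupSubalgebra K), by simp⟩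

theorem apply_mem_orbitSpan {a : MonoidAlgebra ℂ G} (ha : a ∈ groupSubalgebra K)
    (hw : w ∈ orbitSpan Φ K v) : Φ a w ∈ orbitSpan Φ K v := by
  obtain ⟨b, hb, rfl⟩ := hw
  refine ⟨a * b, (groupSubalgebra K).mul_mem ha hb, ?_⟩
  simp

theorem sub_apply_eq_zero {a b : MonoidAlgebra ℂ G} : Φ (a - b) v = 0 ↔ Φ a v = Φ b v := by
  rw [map_sub, LinearMap.sub_apply, sub_eq_zero]

theorem of_apply_eq_of_mem_subordinate (h : u ∈ subordinate Φ K v) {k : G} (hk : k ∈ K)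
    (hv : Φ (MonoidAlgebra.of ℂ G k) v = v) : Φ (MonoidAlgebra.of ℂ G k) u = u := by
  have h1 := h (MonoidAlgebra.of ℂ G k - 1) (sub_mem (of_mem_groupSubalgebra hk) (one_mem _))
    (sub_apply_eq_zero.mpr (by simpa using hv))
  simpa using sub_apply_eq_zero.mp h1

namespace IsSimpleVector

/-- A vector `u` subordinate to `v` is the image of `v` under a homomorphism from the module
generated by `v`. That module is simple, so the homomorphism is injective when `u ≠ 0` and the
annihilators coincide. -/
theorem mem_subordinate_symm (hv : IsSimpleVector Φ K v) (hu : u ∈ subordinate Φ K v)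
    (hu0 : u ≠ 0) : v ∈ subordinate Φ K u := fun a ha hau => by
  by_contra h
  obtain ⟨b, hb, hba⟩ := hv.2 a ha h
  have h1 := hu (b * a - 1) (sub_mem (mul_mem hb ha) (one_mem _))
    (sub_apply_eq_zero.mpr (by simpa using hba))
  have h2 := sub_apply_eq_zero.mp h1
  rw [map_mul, Module.End.mul_apply, hau, map_zero, map_one, Module.End.one_apply] at h2
  exact hu0 h2.symm

theorem of_mem_subordinate (hv : IsSimpleVector Φ K v) (hu : u ∈ subordinate Φ K v)
    (hu0 : u ≠ 0) : IsSimpleVector Φ K u := by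
  refine ⟨hu0, fun a ha hau => ?_⟩
  obtain ⟨b, hb, hba⟩ := hv.2 a ha fun h => hau (hu a ha h)
  have h1 := hu (b * a - 1) (sub_mem (mul_mem hb ha) (one_mem _))
    (sub_apply_eq_zero.mpr (by simpa using hba))
  exact ⟨b, hb, by simpa using sub_apply_eq_zero.mp h1⟩

/-- Schur's lemma for simple vectors. -/
theorem mem_span_of_mem_subordinate (hv : IsSimpleVector Φ K v)
    [FiniteDimensional ℂ (orbitSpan Φ K v)] (hw : w ∈ subordinate Φ K v)
    (hwv : w ∈ orbitSpan Φ K v) : w ∈ Submodule.span ℂ {v} := by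
  let A := Subalgebra.toSubmodule (groupSubalgebra K)
  let e : A →ₗ[ℂ] orbitSpan Φ K v :=
    (LinearMap.applyₗ v ∘ₗ Φ.toLinearMap).submoduleMap A
  have he : Function.Surjective e := LinearMap.submoduleMap_surjective _ _
  let f : A →ₗ[ℂ] orbitSpan Φ K v :=
    ((LinearMap.applyₗ w ∘ₗ Φ.toLinearMap) ∘ₗ A.subtype).codRestrict _ fun a =>
      apply_mem_orbitSpan a.2 hwv
  have hef : LinearMap.ker e ≤ LinearMap.ker f := fun a ha => by
    have h1 : Φ a v = 0 := congrArg Subtype.val ha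
    exact Subtype.ext (hw a a.2 h1)
  -- `T` is the endomorphism `a v ↦ a w` of the module generated by `v`. An eigenvector of it
  -- generates `v` again, so `w` is a multiple of `v`.
  obtain ⟨T, hT⟩ : ∃ T : Module.End ℂ (orbitSpan Φ K v), ∀ a, T (e a) = f a := by
    refine ⟨(LinearMap.ker e).liftQ f hef ∘ₗ (e.quotKerEquivOfSurjective he).symm.toLinearMap,
      fun a => ?_⟩
    have h1 : (e.quotKerEquivOfSurjective he).symm (e a) = (LinearMap.ker e).mkQ a :=
      (LinearEquiv.symm_apply_eq _).mpr rfl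
    rw [LinearMap.comp_apply, LinearEquiv.coe_coe, h1]
    rfl
  have : Nontrivial (orbitSpan Φ K v) :=
    ⟨⟨v, self_mem_orbitSpan⟩, 0, fun h => hv.1 (congrArg Subtype.val h)⟩
  obtain ⟨μ, hμ⟩ := Module.End.exists_eigenvalue T
  obtain ⟨x, hx⟩ := hμ.exists_hasEigenvector
  obtain ⟨⟨a, ha⟩, rfl⟩ := he x
  have h1 : Φ a w = μ • Φ a v := by
    have h2 := hx.apply_eq_smul
    rw [hT] at h2
    exact congrArg Subtype.val h2
  obtain ⟨b, hb, hba⟩ := hv.2 a ha fun h => hx.2 (Subtype.ext h)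
  have h2 := sub_apply_eq_zero.mp (hw (b * a - 1) (sub_mem (mul_mem hb ha) (one_mem _))
    (sub_apply_eq_zero.mpr (by simpa using hba)))
  rw [map_one, Module.End.one_apply, map_mul, Module.End.mul_apply, h1, map_smul,
    ← Module.End.mul_apply, ← map_mul, hba] at h2
  exact Submodule.mem_span_singleton.mpr ⟨μ, h2⟩

end IsSimpleVector

theorem finiteDimensional_orbitSpan [TopologicalSpace G] [IsTopologicalGroup G]
    (hK : IsCompact (K : Set G)) {K₀ : Subgroup G} (hK₀ : IsOpen (K₀ : Set G))
    (hv : ∀ k ∈ K₀, Φ (MonoidAlgebra.of ℂ G k) v = v) :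
    FiniteDimensional ℂ (orbitSpan Φ K v) := by
  let ρ : Representation ℂ G V := (Φ : MonoidAlgebra ℂ G →* Module.End ℂ V).comp (MonoidAlgebra.of ℂ G)
  have hs : ∀ g, ∀ᶠ x in 𝓝 g, ρ x v = ρ g v := fun g => by
    have hc : Tendsto (fun x => g⁻¹ * x) (𝓝 g) (𝓝 1) := by
      simpa using (continuous_const_mul g⁻¹).tendsto g
    filter_upwards [hc.eventually (hK₀.mem_nhds K₀.one_mem)] with x hx
    have h1 := ρ.map_mul_apply g (g⁻¹ * x) v
    rw [mul_inv_cancel_left] at h1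
    exact h1.trans (congrArg (ρ g) (hv _ hx))
  have hfin := Representation.finite_image_of_isCompact hs hK
  have h1 : FiniteDimensional ℂ (Submodule.span ℂ ((fun g => ρ g v) '' (K : Set G))) :=
    FiniteDimensional.span_of_finite ℂ hfin
  refine Submodule.finiteDimensional_of_le (S₂ := Submodule.span ℂ ((fun g => ρ g v) '' (K : Set G))) ?_
  rintro _ ⟨a, ha, rfl⟩
  have ha' : a ∈ Submodule.span ℂ (MonoidAlgebra.of ℂ G '' (K : Set G)) := by
    have h2 : a ∈ Subalgebra.toSubmodule (groupSubalgebra K) := ha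
    rw [groupSubalgebra, Algebra.adjoin_eq_span] at h2
    have h3 : (Submonoid.closure (MonoidAlgebra.of ℂ G '' (K : Set G)) : Set _) =
        MonoidAlgebra.of ℂ G '' (K : Set G) := by
      have h4 := Submonoid.closure_eq (K.toSubmonoid.map (MonoidAlgebra.of ℂ G))
      exact congrArg SetLike.coe h4
    rwa [h3] at h2
  have h2 := Submodule.mem_map_of_mem (f := LinearMap.applyₗ v ∘ₗ Φ.toLinearMap) ha'
  rw [Submodule.map_span, Set.image_image] at h2
  exact h2

end GroupAlgebra

/-! ### Chains of simple vectors and their stabilization. -/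

section StableVectors

open Filter Topology

variable {G : Type} [Group G] [TopologicalSpace G] [IsTopologicalGroup G]
  {V : Type*} [AddCommGroup V] [Module ℂ V] {Φ : MonoidAlgebra ℂ G →ₐ[ℂ] Module.End ℂ V}

theorem subordinate_anti {K K' : Subgroup G} (h : K ≤ K') {v : V} :
    subordinate Φ K' v ≤ subordinate Φ K v :=
  fun _ hu a ha hav => hu a (groupSubalgebra_mono h ha) hav

theorem mem_subordinate_trans {K : Subgroup G} {u v w : V} (huv : u ∈ subordinate Φ K v)
    (hvw : v ∈ subordinate Φ K w) : u ∈ subordinate Φ K w :=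
  fun a ha haw => huv a ha (hvw a ha haw)

/-- If all irreducible smooth representations are admissible, then there is no infinite sequence
of simple vectors, each of which is subordinate to the previous one, such that the spaces of fixed
vectors grow. -/
theorem not_exists_growing_simpleVectors (hG : IsLocallyElliptic G) (hA : SmoothAdmissible G)
    {K : ℕ → Subgroup G} (hmono : Monotone K) (hex : ∀ g, ∃ m, g ∈ K m) {K₀ : Subgroup G}
    (hK₀ : IsOpen (K₀ : Set G)) {m : ℕ → ℕ} (hm : StrictMono m) {v : ℕ → V}
    (hKm : ∀ i, K₀ ≤ K (m i)) (hfix : ∀ i, ∀ k ∈ K₀, Φ (MonoidAlgebra.of ℂ G k) (v i) = v i)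
    (hsimple : ∀ i, IsSimpleVector Φ (K (m i)) (v i))
    (hsub : ∀ i, v (i + 1) ∈ subordinate Φ (K (m i)) (v i))
    (hgrow : ∀ i, ∃ w ∈ orbitSpan Φ (K (m (i + 1))) (v (i + 1)),
      w ∈ subordinate Φ (K (m i)) (v i) ∧ w ∉ orbitSpan Φ (K (m i)) (v (i + 1))) : False := by
  have hKmono : ∀ i j, i ≤ j → K (m i) ≤ K (m j) := fun i j h => hmono (hm.monotone h)
  have hsub' : ∀ i j, i ≤ j → v j ∈ subordinate Φ (K (m i)) (v i) := fun i j h => by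
    induction j, h using Nat.le_induction with
    | base => exact self_mem_subordinate
    | succ j h ih =>
      exact mem_subordinate_trans (subordinate_anti (hKmono i j h) (hsub j)) ih
  have hiff : ∀ i j, i ≤ j → ∀ a ∈ groupSubalgebra (K (m i)), Φ a (v j) = 0 ↔ Φ a (v i) = 0 :=
    fun i j h a ha => ⟨(hsimple i).mem_subordinate_symm (hsub' i j h) (hsimple j).1 a ha,
      hsub' i j h a ha⟩
  have hexA : ∀ a, ∃ i, a ∈ groupSubalgebra (K (m i)) := fun a => by
    obtain ⟨i, hi⟩ := exists_mem_groupSubalgebra hmono hex a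
    exact ⟨i, groupSubalgebra_mono (hmono (hm.id_le i)) hi⟩
  -- By `hiff` the annihilators of the `v i` in the growing group algebras are compatible. Their
  -- union `L` is a maximal left ideal, and the quotient is the direct limit of the simple modules.
  let L : Submodule ℂ (MonoidAlgebra ℂ G) :=
    { carrier := {a | ∀ᶠ i in atTop, Φ a (v i) = 0}
      add_mem' := fun ha hb => (ha.and hb).mono fun i h => by
        rw [map_add, LinearMap.add_apply, h.1, h.2, add_zero]
      zero_mem' := Eventually.of_forall fun i => by rw [map_zero, LinearMap.zero_apply]
      smul_mem' := fun c a ha => ha.mono fun i h => by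
        rw [map_smul, LinearMap.smul_apply, h, smul_zero] }
  have hLiff : ∀ i, ∀ a ∈ groupSubalgebra (K (m i)), a ∈ L ↔ Φ a (v i) = 0 := fun i a ha => by
    constructor
    · intro h
      obtain ⟨j, hj, hij⟩ := (Eventually.and h (eventually_ge_atTop i)).exists
      exact (hiff i j hij a ha).mp hj
    · intro h
      exact (eventually_ge_atTop i).mono fun j hij => (hiff i j hij a ha).mpr h
  obtain ⟨σ, f, hf, hker, hσ⟩ := exists_smoothIrrep_of_leftIdeal hG L
    (fun a b hb => hb.mono fun i h => by
      rw [map_mul, Module.End.mul_apply, h, map_zero])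
    (fun h => (hsimple 0).1 (by simpa using (hLiff 0 1 (one_mem _)).mp h))
    (fun a ha => by
      obtain ⟨i, hi⟩ := hexA a
      obtain ⟨b, hb, hba⟩ := (hsimple i).2 a hi fun h => ha ((hLiff i a hi).mpr h)
      refine ⟨b, (hLiff i _ (sub_mem (mul_mem hb hi) (one_mem _))).mpr ?_⟩
      exact sub_apply_eq_zero.mpr (by simpa using hba))
    K₀ hK₀ (fun k hk => Eventually.of_forall fun i => sub_apply_eq_zero.mpr (by
      rw [hfix i k hk, map_one, Module.End.one_apply]))
  have hfL : ∀ a b, f a = f b ↔ a - b ∈ L := fun a b => by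
    rw [← hker, LinearMap.mem_ker, map_sub, sub_eq_zero]
  have hfd := hA σ K₀ hK₀
  have hkA : ∀ i, ∀ k ∈ K₀, MonoidAlgebra.of ℂ G k ∈ groupSubalgebra (K (m i)) := fun i k hk =>
    of_mem_groupSubalgebra (hKm i hk)
  -- The elements of the `i`-th group algebra whose classes are fixed by `K₀`. By admissibility
  -- their images stabilize, whereas each `w` from `hgrow` contributes a fixed class that the
  -- previous stage does not reach.
  let D : ℕ → Submodule ℂ (MonoidAlgebra ℂ G) := fun i =>
    { carrier := {a | a ∈ groupSubalgebra (K (m i)) ∧ ∀ k ∈ K₀,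
        Φ (MonoidAlgebra.of ℂ G k * a) (v i) = Φ a (v i)}
      add_mem' := fun {a b} ha hb => ⟨add_mem ha.1 hb.1, fun k hk => by
        rw [mul_add, map_add, map_add, LinearMap.add_apply, LinearMap.add_apply, ha.2 k hk,
          hb.2 k hk]⟩
      zero_mem' := ⟨zero_mem _, fun k hk => by rw [mul_zero]⟩
      smul_mem' := fun c a ha => ⟨Subalgebra.smul_mem _ ha.1 c, fun k hk => by
        rw [mul_smul_comm, map_smul, map_smul, LinearMap.smul_apply, LinearMap.smul_apply,
          ha.2 k hk]⟩ }
  have hDmono : Monotone D := fun i j hij a ha => by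
    refine ⟨groupSubalgebra_mono (hKmono i j hij) ha.1, fun k hk => sub_apply_eq_zero.mp ?_⟩
    exact (hiff i j hij _ (sub_mem (mul_mem (hkA i k hk) ha.1) ha.1)).mpr
      (sub_apply_eq_zero.mpr (ha.2 k hk))
  have hDfix : ∀ i, ∀ a ∈ D i, f a ∈ σ.act.fixedBy K₀ := fun i a ha k hk => by
    rw [← hσ, hfL]
    exact (hLiff i _ (sub_mem (mul_mem (hkA i k hk) ha.1) ha.1)).mpr
      (sub_apply_eq_zero.mpr (ha.2 k hk))
  let F : ℕ →o Submodule ℂ (σ.act.fixedBy K₀) :=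
    ⟨fun i => ((D i).map f).comap (σ.act.fixedBy K₀).subtype,
      fun i j hij => Submodule.comap_mono (Submodule.map_mono (hDmono hij))⟩
  obtain ⟨i, hi⟩ := monotone_stabilizes_iff_noetherian.mpr (inferInstance :
    IsNoetherian ℂ (σ.act.fixedBy K₀)) F
  obtain ⟨w, ⟨b, hb, hbw⟩, hw, hwn⟩ := hgrow i
  have hbw' : Φ b (v (i + 1)) = w := hbw
  have hbD : b ∈ D (i + 1) := ⟨hb, fun k hk => by
    rw [map_mul, Module.End.mul_apply, hbw']
    exact of_apply_eq_of_mem_subordinate hw (hKm i hk) (hfix i k hk)⟩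
  have h1 : (⟨f b, hDfix _ b hbD⟩ : σ.act.fixedBy K₀) ∈ F i := by
    rw [hi (i + 1) (Nat.le_succ i)]
    exact ⟨b, hbD, rfl⟩
  obtain ⟨a, ha, hab⟩ := h1
  have h2 := (hfL a b).mp hab
  rw [hLiff (i + 1) _ (sub_mem (groupSubalgebra_mono (hKmono i _ (Nat.le_succ i)) ha.1) hb),
    sub_apply_eq_zero, hbw'] at h2
  exact hwn ⟨a, ha.1, h2⟩

/-- Failure of stability at every simple vector would build, step by step, the chain excluded by
`not_exists_growing_simpleVectors`. -/
theorem exists_stable_simpleVector (hG : IsLocallyElliptic G) (hA : SmoothAdmissible G)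
    {K : ℕ → Subgroup G} (hmono : Monotone K) (hcomp : ∀ m, IsCompact (K m : Set G))
    (hex : ∀ g, ∃ m, g ∈ K m) {K₀ : Subgroup G} (hK₀ : IsOpen (K₀ : Set G)) {m₀ : ℕ} {v₀ : V}
    (hKm₀ : K₀ ≤ K m₀) (hfix₀ : ∀ k ∈ K₀, Φ (MonoidAlgebra.of ℂ G k) v₀ = v₀)
    (hv₀ : IsSimpleVector Φ (K m₀) v₀) :
    ∃ m v, K₀ ≤ K m ∧ (∀ k ∈ K₀, Φ (MonoidAlgebra.of ℂ G k) v = v) ∧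
      IsSimpleVector Φ (K m) v ∧ ∀ m' ≥ m, ∀ v', IsSimpleVector Φ (K m') v' →
        v' ∈ subordinate Φ (K m) v → ∀ w ∈ orbitSpan Φ (K m') v', w ∈ subordinate Φ (K m) v →
          w ∈ Submodule.span ℂ {v'} := by
  by_contra! hcon
  let S := {x : ℕ × V // K₀ ≤ K x.1 ∧ (∀ k ∈ K₀, Φ (MonoidAlgebra.of ℂ G k) x.2 = x.2) ∧
    IsSimpleVector Φ (K x.1) x.2}
  have hstep : ∀ x : S, ∃ y : S, x.1.1 < y.1.1 ∧ y.1.2 ∈ subordinate Φ (K x.1.1) x.1.2 ∧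
      ∃ w ∈ orbitSpan Φ (K y.1.1) y.1.2, w ∈ subordinate Φ (K x.1.1) x.1.2 ∧
        w ∉ orbitSpan Φ (K x.1.1) y.1.2 := by
    rintro ⟨⟨m, v⟩, hKm, hfix, hv⟩
    obtain ⟨m', hm', v', hv', hsub, w, hw, hwsub, hwn⟩ := hcon m v hKm hfix hv
    have hfix' : ∀ k ∈ K₀, Φ (MonoidAlgebra.of ℂ G k) v' = v' := fun k hk =>
      of_apply_eq_of_mem_subordinate hsub (hKm hk) (hfix k hk)
    -- By Schur's lemma the only vectors subordinate to `v` in the `K m`-module of `v'` are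
    -- multiples of `v'`. So `w` is new, and this also rules out `m' = m`.
    have hwn' : w ∉ orbitSpan Φ (K m) v' := fun h => by
      have := finiteDimensional_orbitSpan (Φ := Φ) (hcomp m) hK₀ hfix'
      exact hwn ((hv.of_mem_subordinate hsub hv'.1).mem_span_of_mem_subordinate
        (mem_subordinate_trans hwsub (hv.mem_subordinate_symm hsub hv'.1)) h)
    refine ⟨⟨⟨m', v'⟩, hKm.trans (hmono hm'), hfix', hv'⟩, lt_of_le_of_ne hm' ?_, hsub, w, hw,
      hwsub, hwn'⟩
    rintro rfl
    exact hwn' hw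
  choose next hnext using hstep
  let s : ℕ → S := fun i => next^[i] ⟨⟨m₀, v₀⟩, hKm₀, hfix₀, hv₀⟩
  have hs : ∀ i, s (i + 1) = next (s i) := fun i => Function.iterate_succ_apply' _ _ _
  refine not_exists_growing_simpleVectors (Φ := Φ) hG hA hmono hex hK₀ (m := fun i => (s i).1.1)
    (v := fun i => (s i).1.2) (strictMono_nat_of_lt_succ fun i => ?_) (fun i => (s i).2.1)
    (fun i => (s i).2.2.1) (fun i => (s i).2.2.2) (fun i => ?_) (fun i => ?_)
  · rw [hs]; exact (hnext (s i)).1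
  · simp only [hs]; exact (hnext (s i)).2.1
  · simp only [hs]; exact (hnext (s i)).2.2

end StableVectors

/-! ### Irreducible unitary representations are completions of smooth representations -/

section SmoothVectors

open Filter Topology

variable {G : Type} [Group G] [TopologicalSpace G] [IsTopologicalGroup G] {H : Type*} [NormedAddCommGroup H] [InnerProductSpace ℂ H]
  {act : G →* (H ≃ₗᵢ[ℂ] H)}

theorem asAlgebraHom_isometryRep_of (g : G) (v : H) :
    (isometryRep act).asAlgebraHom (MonoidAlgebra.of ℂ G g) v = act g v := by
  rw [Representation.asAlgebraHom_of]
  rfl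

theorem continuous_asAlgebraHom_isometryRep (a : MonoidAlgebra ℂ G) :
    Continuous ((isometryRep act).asAlgebraHom a) := by
  induction a using MonoidAlgebra.induction_on with
  | of g =>
    rw [Representation.asAlgebraHom_of]
    exact (act g).continuous
  | add a b ha hb =>
    rw [map_add]
    exact ha.add hb
  | smul c a ha =>
    rw [map_smul]
    exact ha.const_smul c

theorem isClosed_subordinate (K : Subgroup G) (v : H) :
    IsClosed (subordinate (isometryRep act).asAlgebraHom K v : Set H) := by
  have h : (subordinate (isometryRep act).asAlgebraHom K v : Set H) =
      ⋂ a ∈ groupSubalgebra K, ⋂ _ : (isometryRep act).asAlgebraHom a v = 0,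
        {u | (isometryRep act).asAlgebraHom a u = 0} := by
    ext u
    simp only [Set.mem_iInter]
    rfl
  rw [h]
  exact isClosed_biInter fun a _ => isClosed_iInter fun _ =>
    isClosed_eq (continuous_asAlgebraHom_isometryRep a) continuous_const

/-- A subspace that is stable under the action of a subgroup. -/
def IsStable (act : G →* (H ≃ₗᵢ[ℂ] H)) (K : Subgroup G) (E : Submodule ℂ H) : Prop :=
  ∀ k ∈ K, ∀ x ∈ E, act k x ∈ E

theorem IsStable.asAlgebraHom_mem {K : Subgroup G} {E : Submodule ℂ H} (hE : IsStable act K E)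
    {a : MonoidAlgebra ℂ G} (ha : a ∈ groupSubalgebra K) {x : H} (hx : x ∈ E) :
    (isometryRep act).asAlgebraHom a x ∈ E := by
  induction ha using Algebra.adjoin_induction generalizing x with
  | mem a ha =>
    obtain ⟨k, hk, rfl⟩ := ha
    rw [asAlgebraHom_isometryRep_of]
    exact hE k hk x hx
  | algebraMap r =>
    rw [AlgHom.commutes, Module.algebraMap_end_apply]
    exact E.smul_mem r hx
  | add a b _ _ ha hb =>
    rw [map_add]
    exact E.add_mem (ha hx) (hb hx)
  | mul a b _ _ ha hb =>
    rw [map_mul]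
    exact ha (hb hx)

theorem isStable_orbitSpan (K : Subgroup G) (v : H) :
    IsStable act K (orbitSpan (isometryRep act).asAlgebraHom K v) := fun k hk x hx => by
  rw [← asAlgebraHom_isometryRep_of]
  exact apply_mem_orbitSpan (of_mem_groupSubalgebra hk) hx

theorem IsStable.starProjection_act {K : Subgroup G} {E : Submodule ℂ H} (hE : IsStable act K E)
    [E.HasOrthogonalProjection] {k : G} (hk : k ∈ K) (x : H) :
    E.starProjection (act k x) = act k (E.starProjection x) := by
  refine Submodule.eq_starProjection_of_mem_of_inner_eq_zero
    (hE k hk _ (Submodule.starProjection_apply_mem E x)) fun w hw => ?_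
  rw [← map_sub, inner_act_left]
  exact Submodule.starProjection_inner_eq_zero x _ (hE _ (K.inv_mem hk) w hw)

theorem IsStable.starProjection_asAlgebraHom {K : Subgroup G} {E : Submodule ℂ H}
    (hE : IsStable act K E) [E.HasOrthogonalProjection] {a : MonoidAlgebra ℂ G}
    (ha : a ∈ groupSubalgebra K) (x : H) :
    E.starProjection ((isometryRep act).asAlgebraHom a x) =
      (isometryRep act).asAlgebraHom a (E.starProjection x) := by
  induction ha using Algebra.adjoin_induction generalizing x with
  | mem a ha =>
    obtain ⟨k, hk, rfl⟩ := ha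
    rw [asAlgebraHom_isometryRep_of, asAlgebraHom_isometryRep_of, hE.starProjection_act hk]
  | algebraMap r =>
    rw [AlgHom.commutes, Module.algebraMap_end_apply, Module.algebraMap_end_apply, map_smul]
  | add a b _ _ ha hb =>
    rw [map_add, LinearMap.add_apply, LinearMap.add_apply, map_add, ha, hb]
  | mul a b _ _ ha hb =>
    rw [map_mul, Module.End.mul_apply, Module.End.mul_apply, ha, hb]

/-- A minimal nonzero subspace that is stable under the action of a subgroup. -/
def IsMinimalStable (act : G →* (H ≃ₗᵢ[ℂ] H)) (K : Subgroup G) (E : Submodule ℂ H) : Prop :=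
  IsStable act K E ∧ ∀ F ≤ E, IsStable act K F → F = ⊥ ∨ F = E

theorem IsMinimalStable.le_orbitSpan {K : Subgroup G} {E : Submodule ℂ H}
    (hE : IsMinimalStable act K E) {x : H} (hx : x ∈ E) (hx0 : x ≠ 0) :
    E ≤ orbitSpan (isometryRep act).asAlgebraHom K x := by
  refine ((hE.2 _ ?_ (isStable_orbitSpan K x)).resolve_left fun h => hx0 ?_).ge
  · rintro _ ⟨a, ha, rfl⟩
    exact hE.1.asAlgebraHom_mem ha hx
  · rw [← Submodule.mem_bot ℂ, ← h]
    exact self_mem_orbitSpan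

theorem IsMinimalStable.isSimpleVector {K : Subgroup G} {E : Submodule ℂ H}
    (hE : IsMinimalStable act K E) {x : H} (hx : x ∈ E) (hx0 : x ≠ 0) :
    IsSimpleVector (isometryRep act).asAlgebraHom K x := by
  refine ⟨hx0, fun a ha hax => ?_⟩
  obtain ⟨b, hb, hba⟩ := hE.le_orbitSpan (hE.1.asAlgebraHom_mem ha hx) hax hx
  refine ⟨b, hb, ?_⟩
  rw [map_mul]
  exact hba

/-- Induction on the dimension: a stable proper subspace `F` and its orthogonal complement in `U`
are both stable, and `x` is not orthogonal to at least one of the two components of `e`. -/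
theorem exists_isMinimalStable {K : Subgroup G} {U : Submodule ℂ H} [FiniteDimensional ℂ U]
    (hU : IsStable act K U) {x e : H} (he : e ∈ U) (hxe : inner ℂ x e ≠ 0) :
    ∃ E ≤ U, IsMinimalStable act K E ∧ ∃ e ∈ E, inner ℂ x e ≠ 0 := by
  induction hd : Module.finrank ℂ U using Nat.strong_induction_on generalizing U e with
  | _ d ih =>
  subst hd
  by_cases hmin : ∀ F ≤ U, IsStable act K F → F = ⊥ ∨ F = U
  · exact ⟨U, le_rfl, ⟨hU, hmin⟩, e, he, hxe⟩
  push Not at hmin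
  obtain ⟨F, hFU, hF, hF0, hF1⟩ := hmin
  have key : ∀ F' ≤ U, IsStable act K F' → F' ≠ U → ∀ f ∈ F', inner ℂ x f ≠ 0 →
      ∃ E ≤ U, IsMinimalStable act K E ∧ ∃ e ∈ E, inner ℂ x e ≠ 0 := by
    intro F' hFU' hF' hF1' f hf hxf
    have := Submodule.finiteDimensional_of_le hFU'
    obtain ⟨E, hE, h⟩ := ih _ (Submodule.finrank_lt_finrank_of_lt (lt_of_le_of_ne hFU' hF1')) hF'
      hf hxf rfl
    exact ⟨E, hE.trans hFU', h⟩
  have := Submodule.finiteDimensional_of_le hFU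
  by_cases h1 : inner ℂ x (F.starProjection e) = 0
  · refine key (Fᗮ ⊓ U) inf_le_right (fun k hk y hy => ⟨?_, hU k hk y hy.2⟩) (fun h => ?_)
      (e - F.starProjection e) ⟨?_, U.sub_mem he (hFU (Submodule.starProjection_apply_mem F e))⟩ ?_
    · refine (Submodule.mem_orthogonal' F _).mpr fun w hw => ?_
      rw [inner_act_left]
      exact (Submodule.mem_orthogonal' F y).mp hy.1 _ (hF _ (K.inv_mem hk) w hw)
    · refine hF0 ((Submodule.eq_bot_iff F).mpr fun y hy => ?_)
      have h2 : y ∈ Fᗮ ⊓ U := by rw [h]; exact hFU hy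
      exact inner_self_eq_zero.mp (h2.1 y hy)
    · exact (Submodule.mem_orthogonal' F _).mpr
        fun w hw => Submodule.starProjection_inner_eq_zero e w hw
    · rwa [inner_sub_right, h1, sub_zero]
  · exact key F hFU hF hF1 _ (Submodule.starProjection_apply_mem F e) h1

/-- Cyclicity of vectors in topologically irreducible representations. -/
theorem eq_zero_of_forall_inner_act (hirr : ∀ W : Submodule ℂ H, IsClosed (W : Set H) →
    (∀ g, ∀ v ∈ W, act g v ∈ W) → W = ⊥ ∨ W = ⊤) {x y : H} (hx : x ≠ 0)
    (h : ∀ g, inner ℂ (act g x) y = 0) : y = 0 := by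
  let W : Submodule ℂ H :=
    { carrier := {z | ∀ g, inner ℂ (act g z) y = 0}
      add_mem' := fun hu hw g => by rw [map_add, inner_add_left, hu, hw, add_zero]
      zero_mem' := fun g => by rw [map_zero, inner_zero_left]
      smul_mem' := fun c u hu g => by rw [map_smul, inner_smul_left, hu, mul_zero] }
  have hW : IsClosed (W : Set H) := by
    have h1 : (W : Set H) = ⋂ g, {z | inner ℂ (act g z) y = 0} := by
      ext z
      simp only [Set.mem_iInter]
      rfl
    rw [h1]
    exact isClosed_iInter fun g =>
      isClosed_eq ((act g).continuous.inner continuous_const) continuous_const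
  have htop := (hirr W hW fun g v hv g' => by rw [← act_mul_apply]; exact hv _).resolve_left
    fun hb => hx (by rw [← Submodule.mem_bot ℂ, ← hb]; exact h)
  have hy : y ∈ W := by rw [htop]; trivial
  have h1 := hy 1
  rw [map_one] at h1
  exact inner_self_eq_zero.mp h1

theorem starProjection_ne_zero {E : Submodule ℂ H} [E.HasOrthogonalProjection] {x e : H}
    (he : e ∈ E) (hxe : inner ℂ x e ≠ 0) : E.starProjection x ≠ 0 := fun h => hxe (by
  have h1 := Submodule.starProjection_inner_eq_zero x e he
  rwa [h, sub_zero] at h1)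

theorem starProjection_mem_subordinate {K K' : Subgroup G} (hK : K ≤ K') {E : Submodule ℂ H}
    [E.HasOrthogonalProjection] (hE : IsStable act K' E) {x v : H}
    (hx : x ∈ subordinate (isometryRep act).asAlgebraHom K v) :
    E.starProjection x ∈ subordinate (isometryRep act).asAlgebraHom K v := fun a ha hav => by
  rw [← hE.starProjection_asAlgebraHom (groupSubalgebra_mono hK ha), hx a ha hav, map_zero]

/-- The projection onto `E` is self-adjoint, so preserving `S` it also preserves the orthogonal
complement of `S`. -/
theorem starProjection_comm_of_mapsTo {E S : Submodule ℂ H} [E.HasOrthogonalProjection]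
    [S.HasOrthogonalProjection] (h : ∀ x ∈ S, E.starProjection x ∈ S) (x : H) :
    S.starProjection (E.starProjection x) = E.starProjection (S.starProjection x) := by
  refine Submodule.eq_starProjection_of_mem_of_inner_eq_zero
    (h _ (Submodule.starProjection_apply_mem S x)) fun w hw => ?_
  rw [← map_sub, Submodule.inner_starProjection_left_eq_right]
  exact Submodule.starProjection_inner_eq_zero x _ (h w hw)

end SmoothVectors

/-! ### Multiplicity one and the smooth representation inside a unitary one. -/

section SmoothVectors

open Filter Topology

variable {G : Type} [Group G] [TopologicalSpace G] [IsTopologicalGroup G]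

/-- A stable simple vector of a unitary representation spans the space of its subordinate
vectors. -/
theorem subordinate_le_span {H : Type*} [NormedAddCommGroup H] [InnerProductSpace ℂ H]
    [CompleteSpace H] {act : G →* (H ≃ₗᵢ[ℂ] H)}
    (hirr : ∀ W : Submodule ℂ H, IsClosed (W : Set H) →
      (∀ g, ∀ v ∈ W, act g v ∈ W) → W = ⊥ ∨ W = ⊤)
    {K : ℕ → Subgroup G} (hmono : Monotone K) (hcomp : ∀ m, IsCompact (K m : Set G))
    (hex : ∀ g, ∃ m, g ∈ K m) {K₀ : Subgroup G} (hK₀ : IsOpen (K₀ : Set G)) {m : ℕ} {v : H}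
    (hKm : K₀ ≤ K m) (hfix : ∀ k ∈ K₀, act k v = v) (hv0 : v ≠ 0)
    (hstab : ∀ m' ≥ m, ∀ v', IsSimpleVector (isometryRep act).asAlgebraHom (K m') v' →
        v' ∈ subordinate (isometryRep act).asAlgebraHom (K m) v →
        ∀ w ∈ orbitSpan (isometryRep act).asAlgebraHom (K m') v',
          w ∈ subordinate (isometryRep act).asAlgebraHom (K m) v →
          w ∈ Submodule.span ℂ {v'}) :
    subordinate (isometryRep act).asAlgebraHom (K m) v ≤ Submodule.span ℂ {v} := by
  set Φ := (isometryRep act).asAlgebraHom with hΦ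
  set S := subordinate Φ (K m) v with hS
  have : CompleteSpace S := (isClosed_subordinate (K m) v).completeSpace_coe
  have hof : ∀ g x, Φ (MonoidAlgebra.of ℂ G g) x = act g x := asAlgebraHom_isometryRep_of
  have hex' : ∀ m₁ g, ∃ m' ≥ m₁, g ∈ K m' := fun m₁ g => by
    obtain ⟨m', hm'⟩ := hex g
    exact ⟨max m₁ m', le_max_left _ _, hmono (le_max_right _ _) hm'⟩
  have hfd : ∀ m', ∀ x ∈ S, FiniteDimensional ℂ (orbitSpan Φ (K m') x) := fun m' x hx =>
    finiteDimensional_orbitSpan (hcomp m') hK₀ fun k hk =>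
      of_apply_eq_of_mem_subordinate hx (hKm hk) ((hof k v).trans (hfix k hk))
  have hPS : ∀ m' ≥ m, ∀ E : Submodule ℂ H, [E.HasOrthogonalProjection] → IsStable act (K m') E →
      ∀ x ∈ S, E.starProjection x ∈ S := fun m' hm' E _ hE x hx =>
    starProjection_mem_subordinate (hmono hm') hE hx
  -- Compression of `g ∈ K m'` to `S` commutes with projections onto `K m'`-stable subspaces. Since
  -- a minimal such `E` meets `S` in at most a line (`hline`), projecting a vector of `S` to `E`
  -- gives zero or an eigenvector of the compression.
  have hT : ∀ m' ≥ m, ∀ g ∈ K m', ∀ E : Submodule ℂ H, [E.HasOrthogonalProjection] →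
      IsStable act (K m') E → ∀ x, S.starProjection (act g (E.starProjection x)) =
        E.starProjection (S.starProjection (act g x)) := fun m' hm' g hg E _ hE x => by
    rw [← hE.starProjection_act hg, starProjection_comm_of_mapsTo (hPS m' hm' E hE)]
  have hline : ∀ m' ≥ m, ∀ E, IsMinimalStable act (K m') E → ∀ x ∈ S, x ∈ E → x ≠ 0 →
      ∀ y ∈ S, y ∈ E → ∃ c : ℂ, c • x = y := fun m' hm' E hE x hxS hxE hx0 y hyS hyE =>
    Submodule.mem_span_singleton.mp
      (hstab m' hm' x (hE.isSimpleVector hxE hx0) hxS y (hE.le_orbitSpan hxE hx0 hyE) hyS)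
  -- All eigenvalues of the compression of `g` agree. By irreducibility some translate of `x` is not
  -- orthogonal to `y`; a minimal `E` for a large `K m'` then sees both, and their projections lie
  -- on the same line of `E ∩ S`.
  have hcompare : ∀ g, ∀ x ∈ S, ∀ y ∈ S, x ≠ 0 → y ≠ 0 → ∀ c d : ℂ,
      S.starProjection (act g x) = c • x → S.starProjection (act g y) = d • y → c = d := by
    intro g x hx y hy hx0 hy0 c d hc hd
    obtain ⟨h, hh⟩ : ∃ h, inner ℂ (act h x) y ≠ 0 := by
      by_contra! hcon
      exact hy0 (eq_zero_of_forall_inner_act hirr hx0 hcon)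
    obtain ⟨m₁, hm₁, hg⟩ := hex' m g
    obtain ⟨m', hm₁', hhm⟩ := hex' m₁ h
    have hm' : m' ≥ m := hm₁.le.trans hm₁'
    replace hg : g ∈ K m' := hmono hm₁' hg
    have := hfd m' x hx
    obtain ⟨E, hEU, hE, e, he, hye⟩ := exists_isMinimalStable (isStable_orbitSpan (K m') x)
      (x := y) (e := act h x) (by
        rw [← hof]
        exact apply_mem_orbitSpan (of_mem_groupSubalgebra hhm) self_mem_orbitSpan)
      (fun h0 => hh (inner_eq_zero_symm.mp h0))
    have := Submodule.finiteDimensional_of_le hEU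
    have hy1 := starProjection_ne_zero he hye
    have hx1 : E.starProjection x ≠ 0 := fun h0 => hye (by
      obtain ⟨a, ha, rfl⟩ := hEU he
      have h1 := hE.1.starProjection_asAlgebraHom ha x
      rw [h0, map_zero] at h1
      have h2 := Submodule.starProjection_eq_self_iff.mpr he
      rw [← h2]
      change inner ℂ y (E.starProjection ((isometryRep act).asAlgebraHom a x)) = 0
      rw [h1, inner_zero_right])
    obtain ⟨r, hr⟩ := hline m' hm' E hE _ (hPS m' hm' E hE.1 x hx)
      (Submodule.starProjection_apply_mem E x) hx1 _ (hPS m' hm' E hE.1 y hy)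
      (Submodule.starProjection_apply_mem E y)
    have h1 := hT m' hm' g hg E hE.1 x
    have h2 := hT m' hm' g hg E hE.1 y
    rw [hc, map_smul] at h1
    rw [hd, map_smul, ← hr, map_smul, map_smul, h1, smul_smul, smul_smul, mul_comm,
      ← sub_eq_zero, ← sub_smul] at h2
    have hr0 : r ≠ 0 := by
      rintro rfl
      exact hy1 (by rw [← hr, zero_smul])
    have h3 := (smul_eq_zero.mp h2).resolve_right hx1
    rw [← sub_mul] at h3
    exact sub_eq_zero.mp ((mul_eq_zero.mp h3).resolve_right hr0)
  have hvS : v ∈ S := self_mem_subordinate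
  have hscalar : ∀ g, ∃ c : ℂ, S.starProjection (act g v) = c • v := by
    intro g
    obtain ⟨m', hm', hg⟩ := hex' m g
    set U := orbitSpan Φ (K m') v with hU
    have := hfd m' v hvS
    have hUst : IsStable act (K m') U := isStable_orbitSpan (K m') v
    have heig : ∀ E ≤ U, IsMinimalStable act (K m') E → ∀ [E.HasOrthogonalProjection],
        E.starProjection v ≠ 0 → ∃ c : ℂ,
        S.starProjection (act g (E.starProjection v)) = c • E.starProjection v := by
      intro E hEU hE _ h0
      obtain ⟨c, hc⟩ := hline m' hm' E hE _ (hPS m' hm' E hE.1 v hvS)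
        (Submodule.starProjection_apply_mem E v) h0
        (S.starProjection (act g (E.starProjection v))) (Submodule.starProjection_apply_mem S _)
        (by rw [hT m' hm' g hg E hE.1]; exact Submodule.starProjection_apply_mem E _)
      exact ⟨c, hc.symm⟩
    obtain ⟨E₀, hE₀U, hE₀, e, he, hve⟩ := exists_isMinimalStable hUst (x := v) (e := v)
      self_mem_orbitSpan (fun h => hv0 (inner_self_eq_zero.mp h))
    have := Submodule.finiteDimensional_of_le hE₀U
    have hv1 := starProjection_ne_zero he hve
    obtain ⟨c, hc⟩ := heig E₀ hE₀U hE₀ hv1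
    refine ⟨c, ?_⟩
    by_contra hne
    -- A nonzero difference would have a nonzero projection to some minimal `E` in `U`. But there
    -- the compression acts on the projection of `v` by the same scalar `c`.
    have hzU : S.starProjection (act g v) - c • v ∈ U := by
      refine U.sub_mem ?_ (U.smul_mem c self_mem_orbitSpan)
      have h1 : act g v ∈ U := hUst g hg v self_mem_orbitSpan
      rw [← Submodule.starProjection_eq_self_iff.mpr h1,
        starProjection_comm_of_mapsTo (hPS m' hm' U hUst)]
      exact Submodule.starProjection_apply_mem U _
    obtain ⟨E, hEU, hE, e', he', hze⟩ := exists_isMinimalStable hUst hzU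
      (fun h => hne (sub_eq_zero.mp (inner_self_eq_zero.mp h)))
    have := Submodule.finiteDimensional_of_le hEU
    refine starProjection_ne_zero he' hze ?_
    rw [map_sub, map_smul, ← hT m' hm' g hg E hE.1]
    by_cases h0 : E.starProjection v = 0
    · rw [h0, map_zero, map_zero, smul_zero, sub_zero]
    · obtain ⟨c', hc'⟩ := heig E hEU hE h0
      rw [hc', hcompare g _ (hPS m' hm' E hE.1 v hvS) _ (hPS m' hm' E₀ hE₀.1 v hvS) h0 hv1 c' c hc'
        hc, sub_self]
  intro w hw
  set z := w - (Submodule.span ℂ {v}).starProjection w with hz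
  have hzS : z ∈ S := S.sub_mem hw ((Submodule.span_singleton_le_iff_mem v S).mpr hvS
    (Submodule.starProjection_apply_mem _ w))
  have hzv : inner ℂ v z = 0 := inner_eq_zero_symm.mp
    (Submodule.starProjection_inner_eq_zero w v (Submodule.mem_span_singleton_self v))
  -- All compressions act on `v` by scalars, so `z ∈ S` orthogonal to `v` is orthogonal to the whole
  -- orbit of `v`.
  have hz0 : z = 0 := by
    refine eq_zero_of_forall_inner_act hirr hv0 fun g => ?_
    obtain ⟨c, hc⟩ := hscalar g
    rw [← Submodule.starProjection_eq_self_iff.mpr hzS, ← Submodule.inner_starProjection_left_eq_right,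
      hc, inner_smul_left, hzv, mul_zero]
  rw [sub_eq_zero.mp hz0]
  exact Submodule.starProjection_apply_mem _ w

/-- Every irreducible unitary representation is the completion of an irreducible smooth
representation. -/
theorem exists_smoothIrrep_isUnitaryCompletion (hG : IsLocallyElliptic G) (hA : SmoothAdmissible G)
    (π : UnitaryIrrep G) : ∃ σ : SmoothIrrep G, IsUnitaryCompletion σ π := by
  obtain ⟨K, hmono, hopen, hcomp, hex⟩ := hG.exhaust
  set Φ := (isometryRep π.act).asAlgebraHom with hΦ
  have hof : ∀ g x, Φ (MonoidAlgebra.of ℂ G g) x = π.act g x := asAlgebraHom_isometryRep_of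
  have := π.nontrivial
  obtain ⟨w, hw⟩ := exists_ne (0 : π.H)
  obtain ⟨K₀, hK₀o, hK₀c, u, -, hu, huw⟩ := exists_fixed_near hG π.continuous_act ⊤ isClosed_univ
    (fun _ _ _ => trivial) (Submodule.mem_top (x := w)) (half_pos (norm_pos_iff.mpr hw))
  have hu0 : u ≠ 0 := by
    rintro rfl
    rw [zero_sub, norm_neg] at huw
    linarith [norm_pos_iff.mpr hw]
  obtain ⟨m₀, hm₀⟩ := hK₀c.elim_directed_cover (fun m => (K m : Set G)) hopen
    (fun g _ => Set.mem_iUnion.mpr (hex g)) (directed_of_isDirected_le fun i j h => hmono h)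
  replace hm₀ : K₀ ≤ K m₀ := hm₀
  have hfixu : ∀ k ∈ K₀, Φ (MonoidAlgebra.of ℂ G k) u = u := fun k hk => (hof k u).trans (hu k hk)
  have := finiteDimensional_orbitSpan (hcomp m₀) hK₀o hfixu
  obtain ⟨E, hEU, hE, e, he, hue⟩ := exists_isMinimalStable (act := π.act) (isStable_orbitSpan (K m₀) u)
    (x := u) self_mem_orbitSpan (fun h => hu0 (inner_self_eq_zero.mp h))
  have := Submodule.finiteDimensional_of_le hEU
  obtain ⟨m, v, hKm, hfix, hv, hstab⟩ := exists_stable_simpleVector hG hA hmono hcomp hex hK₀o hm₀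
    (v₀ := E.starProjection u)
    (fun k hk => by
      rw [hof, ← hE.1.starProjection_act (hm₀ hk)]
      exact congrArg E.starProjection (hu k hk))
    (hE.isSimpleVector (Submodule.starProjection_apply_mem E u) (starProjection_ne_zero he hue))
  have hfixv : ∀ k ∈ K₀, π.act k v = v := fun k hk => (hof k v).symm.trans (hfix k hk)
  have hspan := subordinate_le_span π.irreducible hmono hcomp hex hK₀o hKm hfixv hv.1 hstab
  -- The projection of `v` to a minimal `E` stays in the line spanned by `v`; choosing `E` not
  -- orthogonal to `v` gives `v ∈ E`. Simplicity at all large levels makes the annihilator of `v` a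
  -- maximal left ideal.
  have hsimple : ∀ m' ≥ m, IsSimpleVector Φ (K m') v := fun m' hm' => by
    have := finiteDimensional_orbitSpan (hcomp m') hK₀o hfix
    obtain ⟨E, hEU, hE, e, he, hve⟩ := exists_isMinimalStable (act := π.act) (isStable_orbitSpan (K m') v)
      (x := v) self_mem_orbitSpan (fun h => hv.1 (inner_self_eq_zero.mp h))
    have := Submodule.finiteDimensional_of_le hEU
    obtain ⟨c, hc⟩ := Submodule.mem_span_singleton.mp
      (hspan (starProjection_mem_subordinate (hmono hm') hE.1 self_mem_subordinate))
    have hvE := Submodule.starProjection_apply_mem E v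
    have hv1 := starProjection_ne_zero he hve
    rw [← hc] at hvE hv1
    exact hE.isSimpleVector ((E.smul_mem_iff (left_ne_zero_of_smul hv1)).mp hvE) hv.1
  let q : MonoidAlgebra ℂ G →ₗ[ℂ] π.H := LinearMap.applyₗ v ∘ₗ Φ.toLinearMap
  have hq : ∀ a, q a = Φ a v := fun a => rfl
  obtain ⟨σ, f, hf, hker, hσ⟩ := exists_smoothIrrep_of_leftIdeal hG (LinearMap.ker q)
    (fun a b hb => by
      rw [LinearMap.mem_ker, hq] at hb ⊢
      rw [map_mul, Module.End.mul_apply, hb, map_zero])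
    (fun h => hv.1 (by simpa [hq] using h))
    (fun a ha => by
      obtain ⟨m', hm'⟩ := exists_mem_groupSubalgebra hmono hex a
      obtain ⟨b, -, hb⟩ := (hsimple (max m m') (le_max_left _ _)).2 a
        (groupSubalgebra_mono (hmono (le_max_right _ _)) hm') ha
      refine ⟨b, (sub_apply_eq_zero (Φ := Φ) (v := v)).mpr ?_⟩
      rw [hb, map_one, Module.End.one_apply])
    K₀ hK₀o (fun k hk => (sub_apply_eq_zero (Φ := Φ) (v := v)).mpr (by
      rw [hfix k hk, map_one, Module.End.one_apply]))
  let ι : σ.V →ₗ[ℂ] π.H := (LinearMap.ker f).liftQ q hker.le ∘ₗ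
    (f.quotKerEquivOfSurjective hf).symm.toLinearMap
  have hι : ∀ a, ι (f a) = Φ a v := fun a => by
    have h1 : (f.quotKerEquivOfSurjective hf).symm (f a) = (LinearMap.ker f).mkQ a :=
      (LinearEquiv.symm_apply_eq _).mpr rfl
    change (LinearMap.ker f).liftQ q hker.le ((f.quotKerEquivOfSurjective hf).symm (f a)) = _
    rw [h1]
    rfl
  have hequiv : ∀ g x, ι (σ.act g x) = π.act g (ι x) := fun g x => by
    obtain ⟨a, rfl⟩ := hf x
    rw [← hσ, hι, hι, map_mul, Module.End.mul_apply, hof]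
  refine ⟨σ, ι, ?_, ?_, hequiv⟩
  · rw [← LinearMap.ker_eq_bot, Submodule.eq_bot_iff]
    intro x hx
    obtain ⟨a, rfl⟩ := hf x
    rw [LinearMap.mem_ker, hι] at hx
    rw [← LinearMap.mem_ker, hker]
    exact hx
  · have htop := (π.irreducible (LinearMap.range ι).topologicalClosure
      (Submodule.isClosed_topologicalClosure _) fun g x hx => ?_).resolve_left fun h => hv.1 ?_
    · rw [DenseRange, ← LinearMap.coe_range]
      exact Submodule.dense_iff_topologicalClosure_eq_top.mpr htop
    · refine map_mem_closure (s := (LinearMap.range ι : Set π.H)) (π.act g).continuous hx ?_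
      rintro _ ⟨y, rfl⟩
      exact ⟨σ.act g y, hequiv g y⟩
    · have h1 : v ∈ (LinearMap.range ι).topologicalClosure :=
        Submodule.le_topologicalClosure _ ⟨f 1, by rw [hι, map_one, Module.End.one_apply]⟩
      rwa [h, Submodule.mem_bot] at h1

end SmoothVectors

/-! ### Comparison of the two topologies -/

section Topologies

open Filter Topology

variable {G : Type} [Group G] [TopologicalSpace G] [IsTopologicalGroup G]

/-- Strict inequalities on a compact set leave a uniform margin; this makes a basic set for one
topology a neighbourhood, in the other, of each of its points. -/
theorem exists_gap_of_isCompact {X ι : Type*} [TopologicalSpace X] [Finite ι] {Ω : Set X}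
    (hΩ : IsCompact Ω) {f : ι → X → ℝ} (hf : ∀ i, Continuous (f i)) {ε : ℝ}
    (h : ∀ x ∈ Ω, ∀ i, f i x < ε) : ∃ δ > 0, ∀ x ∈ Ω, ∀ i, f i x + δ < ε := by
  rcases Ω.eq_empty_or_nonempty with rfl | hne
  · exact ⟨1, one_pos, fun x hx => hx.elim⟩
  have h1 : ∀ᶠ δ in 𝓝[>] (0 : ℝ), ∀ i, ∀ x ∈ Ω, f i x + δ < ε := by
    rw [eventually_all]
    intro i
    obtain ⟨x₀, hx₀, hmax⟩ := hΩ.exists_isMaxOn hne (hf i).continuousOn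
    have h2 : ∀ᶠ δ in 𝓝[>] (0 : ℝ), δ < ε - f i x₀ :=
      (eventually_lt_nhds (sub_pos.mpr (h x₀ hx₀ i))).filter_mono nhdsWithin_le_nhds
    refine h2.mono fun δ hδ x hx => ?_
    have h3 : f i x ≤ f i x₀ := hmax hx
    linarith
  obtain ⟨δ, hδ, hδ0⟩ := (h1.and eventually_mem_nhdsWithin).exists
  exact ⟨δ, hδ0, fun x hx i => hδ i x hx⟩

/-- On finite-dimensional subspaces, functionals are given by inner products. -/
theorem exists_inner_eq_of_isCompact (σ : SmoothIrrep G) {H : Type*} [NormedAddCommGroup H]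
    [InnerProductSpace ℂ H] (ι : σ.V →ₗ[ℂ] H) (hι : Function.Injective ι) {Ω : Set G}
    (hΩ : IsCompact Ω) {k : ℕ} (v : Fin k → σ.V) (l : Module.Dual ℂ σ.V) :
    ∃ w : H, ∀ g ∈ Ω, ∀ i, inner ℂ w (ι (σ.act g (v i))) = l (σ.act g (v i)) := by
  -- The orbits under `Ω` are finite, so only the finite-dimensional span `F` matters, and the Riesz
  -- representation on `ι(F)` gives the vector.
  let s : Set σ.V := ⋃ i, (fun g => σ.act g (v i)) '' Ω
  have hs : s.Finite := Set.finite_iUnion fun i =>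
    Representation.finite_image_of_isCompact (σ.isSmooth.eventually_eq (v i)) hΩ
  let F := Submodule.span ℂ s
  have : FiniteDimensional ℂ F := FiniteDimensional.span_of_finite ℂ hs
  let e : F ≃ₗ[ℂ] F.map ι := F.equivMapOfInjective ι hι
  let L : F.map ι →ₗ[ℂ] ℂ := l ∘ₗ F.subtype ∘ₗ e.symm.toLinearMap
  refine ⟨((InnerProductSpace.toDual ℂ (F.map ι)).symm (LinearMap.toContinuousLinearMap L) :
    F.map ι), fun g hg i => ?_⟩
  have hmem : σ.act g (v i) ∈ F := Submodule.subset_span (Set.mem_iUnion.mpr ⟨i, g, hg, rfl⟩)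
  have h1 := InnerProductSpace.toDual_symm_apply (𝕜 := ℂ) (x := e ⟨_, hmem⟩)
    (y := LinearMap.toContinuousLinearMap L)
  refine Eq.trans ?_ (h1.trans ?_)
  · rw [Submodule.coe_inner]
    rfl
  · change l (e.symm (e ⟨_, hmem⟩) : F) = _
    rw [LinearEquiv.symm_apply_apply]

/-- Operators `act g` are isometries, so approximating the vectors is uniform in `g`, without any
compactness. -/
theorem exists_approx_of_denseRange {H V : Type*} [NormedAddCommGroup H] [InnerProductSpace ℂ H]
    (act : G →* (H ≃ₗᵢ[ℂ] H)) {ι : V → H} (hι : DenseRange ι) {k : ℕ} (v w : Fin k → H)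
    {δ : ℝ} (hδ : 0 < δ) : ∃ z : Fin k → V, ∀ g i j,
      ‖inner ℂ (w j) (act g (v i)) - inner ℂ (w j) (act g (ι (z i)))‖ < δ := by
  have hC : 0 < ∑ j, ‖w j‖ + 1 := by positivity
  choose z hz using fun i => hι.exists_dist_lt (v i) (div_pos hδ hC)
  refine ⟨z, fun g i j => ?_⟩
  have hw : ‖w j‖ ≤ ∑ j, ‖w j‖ + 1 :=
    (Finset.single_le_sum (fun j _ => norm_nonneg (w j)) (Finset.mem_univ j)).trans
      (le_add_of_nonneg_right zero_le_one)
  rw [← inner_sub_right, ← map_sub]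
  calc ‖inner ℂ (w j) (act g (v i - ι (z i)))‖ ≤ ‖w j‖ * ‖v i - ι (z i)‖ :=
        (norm_inner_le_norm _ _).trans (by rw [(act g).norm_map])
    _ ≤ (∑ j, ‖w j‖ + 1) * ‖v i - ι (z i)‖ := mul_le_mul_of_nonneg_right hw (norm_nonneg _)
    _ < δ := by
        rw [mul_comm, ← lt_div_iff₀ hC, ← dist_eq_norm]
        exact hz i

theorem exists_smoothDual_equiv_unitaryDual (hG : IsLocallyElliptic G) (hA : SmoothAdmissible G) :
    ∃ e : SmoothDual G ≃ UnitaryDual G, ∀ (σ : SmoothIrrep G) (π : UnitaryIrrep G),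
      e ⟦σ⟧ = ⟦π⟧ ↔ IsUnitaryCompletion σ π := by
  choose c hc using exists_isUnitaryCompletion hG hA
  let f : SmoothDual G → UnitaryDual G := Quotient.lift (fun σ => ⟦c σ⟧) fun σ τ ⟨h⟩ =>
    Quotient.sound ((hc σ).equivalent hA ((hc τ).congr_left h))
  have hf : ∀ (σ : SmoothIrrep G) (π : UnitaryIrrep G), f ⟦σ⟧ = ⟦π⟧ ↔ IsUnitaryCompletion σ π :=
    fun σ π => ⟨fun h => (hc σ).congr_right (Quotient.exact h),
      fun h => Quotient.sound ((hc σ).equivalent hA h)⟩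
  refine ⟨Equiv.ofBijective f ⟨fun x y hxy => ?_, fun y => ?_⟩, hf⟩
  · induction x using Quotient.inductionOn with
    | h σ =>
    induction y using Quotient.inductionOn with
    | h τ => exact Quotient.sound (IsUnitaryCompletion.nonempty_equiv hA (hc σ)
        ((hf τ (c σ)).mp hxy.symm))
  · induction y using Quotient.inductionOn with
    | h π =>
    obtain ⟨σ, hσ⟩ := exists_smoothIrrep_isUnitaryCompletion hG hA π
    exact ⟨⟦σ⟧, (hf σ π).mpr hσ⟩

variable {e : SmoothDual G ≃ UnitaryDual G}

/-- Around a point of the preimage, the vectors are moved into the dense smooth part and the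
functionals are inner products; inside the resulting smooth basic set, functionals are converted
back to vectors by `exists_inner_eq_of_isCompact`. Each of the two approximations spends half of the
margin. -/
theorem isOpen_preimage_fellBasicSet
    (he : ∀ (σ : SmoothIrrep G) (π : UnitaryIrrep G), e ⟦σ⟧ = ⟦π⟧ ↔ IsUnitaryCompletion σ π)
    (π : UnitaryIrrep G) {Ω : Set G} (hΩ : IsCompact Ω) {ε : ℝ}
    {k : ℕ} (v w : Fin k → π.H) :
    IsOpen[gelfandKazhdanTopology G] (e ⁻¹' fellBasicSet π Ω ε v w) := by
  refine (@isOpen_iff_forall_mem_open _ (gelfandKazhdanTopology G) _).mpr fun x hx => ?_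
  induction x using Quotient.inductionOn with
  | h σ =>
  obtain ⟨π₀, hπ₀, v₀, w₀, h₀⟩ := hx
  obtain ⟨ι, hi, hd, hι⟩ := (he σ π₀).mp hπ₀.symm
  obtain ⟨δ, hδ, hgap⟩ := exists_gap_of_isCompact (ι := Fin k × Fin k) hΩ
    (f := fun q g => ‖inner ℂ (w q.2) (π.act g (v q.1)) - inner ℂ (w₀ q.2) (π₀.act g (v₀ q.1))‖)
    (fun q => ((continuous_const.inner (π.continuous_act _)).sub
      (continuous_const.inner (π₀.continuous_act _))).norm) (fun g hg q => h₀ g hg q.1 q.2)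
  obtain ⟨z, hz⟩ := exists_approx_of_denseRange π₀.act hd v₀ w₀ (half_pos hδ)
  let l : Fin k → Module.Dual ℂ σ.V := fun j => (innerSL ℂ (w₀ j)).toLinearMap ∘ₗ ι
  refine ⟨gelfandKazhdanBasicSet σ Ω (δ / 2) z l, ?_, ?_,
    ⟨σ, rfl, z, l, fun g _ i j => by rw [sub_self, norm_zero]; exact half_pos hδ⟩⟩
  · rintro _ ⟨τ, rfl, z', l', h'⟩
    obtain ⟨π₁, hπ₁⟩ := Quotient.exists_rep (e ⟦τ⟧)
    obtain ⟨ι₁, hi₁, hd₁, hι₁⟩ := (he τ π₁).mp hπ₁.symm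
    choose w₁ hw₁ using fun j => exists_inner_eq_of_isCompact τ ι₁ hi₁ hΩ z' (l' j)
    refine ⟨π₁, hπ₁, fun i => ι₁ (z' i), w₁, fun g hg i j => ?_⟩
    have h1 := hgap g hg (i, j)
    have h2 := hz g i j
    have h3 := h' g hg j i
    rw [← hι₁, hw₁ j g hg i]
    have h4 : l j (σ.act g (z i)) = inner ℂ (w₀ j) (π₀.act g (ι (z i))) := by
      rw [← hι]
      rfl
    rw [h4] at h3
    have h5 := norm_add₃_le
      (a := inner ℂ (w j) (π.act g (v i)) - inner ℂ (w₀ j) (π₀.act g (v₀ i)))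
      (b := inner ℂ (w₀ j) (π₀.act g (v₀ i)) - inner ℂ (w₀ j) (π₀.act g (ι (z i))))
      (c := inner ℂ (w₀ j) (π₀.act g (ι (z i))) - l' j (τ.act g (z' i)))
    rw [sub_add_sub_cancel, sub_add_sub_cancel] at h5
    simp only at h1
    linarith
  · exact TopologicalSpace.isOpen_generateFrom_of_mem ⟨σ, Ω, δ / 2, k, z, l, hΩ, half_pos hδ, rfl⟩

/-- The roles are exchanged: functionals become vectors at the centre of the neighbourhood, and
density is used at the nearby representation, whose approximating vectors need not be smooth. -/
theorem isOpen_image_gelfandKazhdanBasicSet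
    (he : ∀ (σ : SmoothIrrep G) (π : UnitaryIrrep G), e ⟦σ⟧ = ⟦π⟧ ↔ IsUnitaryCompletion σ π)
    (σ : SmoothIrrep G) {Ω : Set G} (hΩ : IsCompact Ω)
    {ε : ℝ} {k : ℕ} (v : Fin k → σ.V) (l : Fin k → Module.Dual ℂ σ.V) :
    IsOpen[fellTopology G] (e.symm ⁻¹' gelfandKazhdanBasicSet σ Ω ε v l) := by
  refine (@isOpen_iff_forall_mem_open _ (fellTopology G) _).mpr fun x hx => ?_
  induction x using Quotient.inductionOn with
  | h π₀ =>
  obtain ⟨σ₀, hσ₀, v₀, l₀, h₀⟩ := hx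
  obtain ⟨ι, hi, hd, hι⟩ := (he σ₀ π₀).mp (by rw [hσ₀, Equiv.apply_symm_apply])
  have hcont : ∀ (τ : SmoothIrrep G) (u : τ.V) (f : Module.Dual ℂ τ.V),
      Continuous fun g => f (τ.act g u) := fun τ u f => continuous_iff_continuousAt.mpr fun g =>
    tendsto_const_nhds.congr' ((τ.isSmooth.eventually_eq u g).mono fun x hx => (congrArg f hx).symm)
  obtain ⟨δ, hδ, hgap⟩ := exists_gap_of_isCompact (ι := Fin k × Fin k) hΩ
    (f := fun q g => ‖l q.1 (σ.act g (v q.2)) - l₀ q.1 (σ₀.act g (v₀ q.2))‖)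
    (fun q => ((hcont _ _ _).sub (hcont _ _ _)).norm) (fun g hg q => h₀ g hg q.1 q.2)
  choose w hw using fun j => exists_inner_eq_of_isCompact σ₀ ι hi hΩ v₀ (l₀ j)
  refine ⟨fellBasicSet π₀ Ω (δ / 2) (fun i => ι (v₀ i)) w, ?_, ?_,
    ⟨π₀, rfl, _, w, fun g _ i j => by rw [sub_self, norm_zero]; exact half_pos hδ⟩⟩
  · rintro _ ⟨π₁, rfl, x, y, h'⟩
    obtain ⟨τ, hτ⟩ := Quotient.exists_rep (e.symm ⟦π₁⟧)
    obtain ⟨ι₁, hi₁, hd₁, hι₁⟩ := (he τ π₁).mp (by rw [hτ, Equiv.apply_symm_apply])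
    obtain ⟨z, hz⟩ := exists_approx_of_denseRange π₁.act hd₁ x y (half_pos hδ)
    refine ⟨τ, hτ, z, fun j => (innerSL ℂ (y j)).toLinearMap ∘ₗ ι₁, fun g hg i j => ?_⟩
    have h1 := hgap g hg (i, j)
    have h2 := hz g j i
    have h3 := h' g hg j i
    rw [← hι, hw i g hg j] at h3
    have h4 : ((innerSL ℂ (y i)).toLinearMap ∘ₗ ι₁) (τ.act g (z j)) =
        inner ℂ (y i) (π₁.act g (ι₁ (z j))) := by
      rw [← hι₁]
      rfl
    rw [h4]
    have h5 := norm_add₃_le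
      (a := l i (σ.act g (v j)) - l₀ i (σ₀.act g (v₀ j)))
      (b := l₀ i (σ₀.act g (v₀ j)) - inner ℂ (y i) (π₁.act g (x j)))
      (c := inner ℂ (y i) (π₁.act g (x j)) - inner ℂ (y i) (π₁.act g (ι₁ (z j))))
    rw [sub_add_sub_cancel, sub_add_sub_cancel] at h5
    simp only at h1
    linarith
  · exact TopologicalSpace.isOpen_generateFrom_of_mem ⟨π₀, Ω, δ / 2, k, _, w, hΩ, half_pos hδ, rfl⟩

theorem fellTopology_eq_coinduced
    (he : ∀ (σ : SmoothIrrep G) (π : UnitaryIrrep G), e ⟦σ⟧ = ⟦π⟧ ↔ IsUnitaryCompletion σ π) :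
    fellTopology G = TopologicalSpace.coinduced e (gelfandKazhdanTopology G) := by
  refine le_antisymm ?_ (le_generateFrom ?_)
  · have h1 : TopologicalSpace.coinduced e (gelfandKazhdanTopology G) =
        TopologicalSpace.induced e.symm (gelfandKazhdanTopology G) :=
      congrFun (Equiv.coinduced_symm e.symm) _
    rw [h1, gelfandKazhdanTopology, induced_generateFrom_eq]
    refine le_generateFrom ?_
    rintro _ ⟨_, ⟨σ, Ω, ε, k, v, l, hΩ, -, rfl⟩, rfl⟩
    exact isOpen_image_gelfandKazhdanBasicSet he σ hΩ v l
  · rintro _ ⟨π, Ω, ε, k, v, w, hΩ, -, rfl⟩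
    exact isOpen_preimage_fellBasicSet he π hΩ v w

end Topologies

theorem mainTheorem5 (p : ℕ) [Fact p.Prime] (n : ℕ) (N : Subgroup (GL (Fin n) ℚ_[p]))
    (hN : IsUnipotentAlgebraic N) :
    ∃ e : SmoothDual N ≃ UnitaryDual N,
      (∀ (σ : SmoothIrrep N) (π : UnitaryIrrep N), e ⟦σ⟧ = ⟦π⟧ ↔ IsUnitaryCompletion σ π) ∧
      fellTopology N = TopologicalSpace.coinduced e (gelfandKazhdanTopology N) := by
  have hA : SmoothAdmissible N := fun σ =>
    hN.isPowClosed.isAdmissible _ N rfl σ.V σ.act σ.irreducible σ.isSmooth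
  obtain ⟨e, he⟩ := exists_smoothDual_equiv_unitaryDual hN.isLocallyElliptic hA
  exact ⟨e, he, fellTopology_eq_coinduced he⟩
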